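/- **Setting.** Let $\mathcal G_2$ be the complex Jacobi algebra with basis $a_i^\pm$, $b_i^\pm=K^\pm_{ii}$, $c^\pm=K^\pm_{12}$, $d^+=K^0_{12}$, $d^-=K^0_{21}$, $h_i=K^0_{ii}$ $(i=1,2)$ and the central element $1$. Its commutation relations are, for $i,j,k,l\in\{1,2\}$ and with $K^\pm_{ij}=K^\pm_{ji}$: $[a_i^-,a_j^+]=\delta_{ij}1$, $[a_i^\pm,a_j^\pm]=0$, $[a_k^\pm,K_{ij}^\pm]=0$, $[a_i^-,K^+_{kj}]=\tfrac12(\delta_{ik}a_j^++\delta_{ij}a_k^+)$, $[K^-_{kj},a_i^+]=\tfrac12(\delta_{ik}a_j^-+\delta_{ij}a_k^-)$, $[K^0_{ij},a_k^+]=\tfrac12\delta_{jk}a_i^+$, $[a_k^-,K^0_{ij}]=\tfrac12\delta_{ik}a_j^-$, $[K^\pm_{ij},K^\pm_{kl}]=0$, $2[K^-_{ij},K^0_{kl}]=\delta_{kj}K^-_{il}+\delta_{ki}K^-_{jl}$, $2[K^-_{ij},K^+_{kl}]=\delta_{li}K^0_{kj}+\delta_{ki}K^0_{lj}+\delta_{lj}K^0_{ki}+\delta_{kj}K^0_{li}$,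 $2[K^+_{ij},K^0_{kl}]=-\delta_{jl}K^+_{ik}-\delta_{li}K^+_{jk}$, $2[K^0_{ji},K^0_{kl}]=\delta_{ki}K^0_{jl}-\delta_{lj}K^0_{ki}$. Let $\mathcal G_2^\pm$ be the span of $a_i^\pm,b_i^\pm,c^\pm,d^\pm$ and $\mathcal K_2$ the span of $h_1,h_2,1$. Let $G$ be the real Jacobi group whose Lie algebra is the real span of the above basis, realised as a group of real $6\times6$ matrices, and let $G^\pm, K\subset G$ be the connected subgroups belonging to the real forms of $\mathcal G_2^\pm$, $\mathcal K_2$. On $G^+\cong\mathbb R^6$ use the coordinates $v=(\xi_1,\xi_2,\eta_1,\eta_2,\zeta,\omega)$ given by $$g^+(v)=\exp(x_1a_1^++x_2a_2^+)\exp(y_1b_1^++y_2b_2^++zc^++wd^+),$$ $$x_1=\xi_1+\tfrac{\omega}{2}\xi_2,\quad x_2=\xi_2,\quad y_1=\eta_1+\tfrac{\zeta\omega}{4}+\tfrac{\eta_2\omega^2}{24},\quad y_2=\eta_2,\quad z=\zeta+\tfrac{\eta_2\omega}{2},\quad w=\omega .$$ For a weight $\Lambda\in\mathcal K_2^*$,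 given by the complex numbers $\Lambda_i=\Lambda(h_i)$ and $\hat\Lambda=\Lambda(1)$, let $\mathcal C_\Lambda$ be the space of smooth functions $\mathcal F:G^+KG^-\to\mathbb C$ on the cell $G^+KG^-$ such that $\mathcal F(g\,e^H g^-)=e^{\Lambda(H)}\mathcal F(g)$ for $e^H\in K$, $g^-\in G^-$. For real $X$, the right action of $X\in\mathcal G_2^+$ on the restrictions to $G^+$ is $(\pi_R(X)\mathcal F)(g)=\frac{d}{dt}\mathcal F(g\,e^{tX})|_{t=0}$, and the left action of $X\in\mathcal G_2$ on $\mathcal C_\Lambda$ is $(\pi_L(X)\mathcal F)(g)=\frac{d}{dt}\mathcal F(e^{-tX}g)|_{t=0}$; the latter is extended complex-linearly to all of $\mathcal G_2$. Write $\Lambda+m_1\delta_1+m_2\delta_2$ for the weight with values $\Lambda_1+\frac{m_1}{2}$, $\Lambda_2+\frac{m_2}{2}$, $\hat\Lambda$ on $h_1,h_2,1$. Put $$B_k=\partial_{\eta_k}-\tfrac12\partial_{\xi_k}^2,\qquad C=\partial_\zeta-\tfrac12\partial_{\xi_1}\partial_{\xi_2},\qquad D=\partial_\omega-\tfrac{\xi_2}{2}\partial_{\xi_1}-\tfrac{\zeta}{2}\partial_{\eta_1}-\eta_2\partial_\zeta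 .$$ **Statement.** For every $\Lambda$, restriction to $G^+$ is a bijection of $\mathcal C_\Lambda$ onto the space $C^\infty(\mathbb R^6,\mathbb C)$ of functions of $v$. Let $p,q$ be positive integers. In (ii)–(v) assume $\hat\Lambda=1$; in (i) $\hat\Lambda$ is arbitrary. In each of the following cases the left actions on $\mathcal C_\Lambda$ and $\mathcal C_{\Lambda'}$ exist, and the operator $\mathcal D$, through restriction to $G^+$, defines a linear map $\mathcal C_\Lambda\to\mathcal C_{\Lambda'}$ with $\mathcal D\,\pi_L(X)=\pi_L(X)\,\mathcal D$ for all $X\in\mathcal G_2$, where the left-hand $\pi_L$ is the left action on $\mathcal C_\Lambda$ and the right-hand one that on $\mathcal C_{\Lambda'}$: (i) $\Lambda_1-\Lambda_2=\frac12(1-p)$, $\Lambda'=\Lambda+p(\delta_1-\delta_2)$, $\mathcal D_{(i)}=D^p$. (ii) $\Lambda_2=\frac34-\frac p2$, $\Lambda_1$ arbitrary, $\Lambda'=\Lambda+2p\,\delta_2$, $\mathcal D_{(ii)}=B_2^{\,p}$. (iii) $\Lambda_1=\frac54-\frac12(p-q)$, $\Lambda_2=\frac34-\frac12q$, $p\ne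 q$, $p\neq 2q$, $\Lambda'=\Lambda+p\,\delta_1+(2q-p)\,\delta_2$, and $$\mathcal D_{(iii)}=\sum_{k,n}\frac{p!\,q!}{4^k\,k!\,n!\,(p-2k-n)!\,(q-k-n)!}\;B_1^{\,k}B_2^{\,q-k-n}C^{\,n}D^{\,p-2k-n},$$ where the sum is (a) $\sum_{k=0}^{\lfloor p/2\rfloor}\sum_{n=0}^{p-2k}$ if $p<q$; (b) $\sum_{k=0}^{p-q}\sum_{n=0}^{q-k}+\sum_{k=p-q+1}^{\lfloor p/2\rfloor}\sum_{n=0}^{p-2k}$ if $q<p<2q$; (c) $\sum_{k=0}^{q}\sum_{n=0}^{q-k}$ if $2q<p$. (iv) $\Lambda_1+\Lambda_2=2-\frac p2$, $\Lambda'=\Lambda+p(\delta_1+\delta_2)$, and $$\mathcal D_{(iv)}=\sum_{k=0}^{\lfloor p/2\rfloor}\sum_{n=0}^{p-2k}\frac{p!}{4^k\,k!\,n!\,(p-2k-n)!}\,\frac{\Gamma(2\Lambda_1+p-\frac32)}{\Gamma(2\Lambda_1+p-\frac32-k-n)}\;B_1^{\,k}B_2^{\,p-k-n}C^{\,n}D^{\,p-2k-n}.$$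 (v) $\Lambda_1=\frac54-\frac p2$, $\Lambda_2$ arbitrary, $\Lambda'=\Lambda+2p\,\delta_1$, and $$\mathcal D_{(v)}=\sum_{k=0}^{p}\sum_{n=0}^{p-k}\frac{(-1)^n}{4^k\,k!\,n!}\,\frac{p!}{(p-k-n)!}\,\frac{\Gamma(2\Lambda_2-p-\frac32+2k+n)}{\Gamma(2\Lambda_2-p-\frac32)}\;B_1^{\,k}B_2^{\,p-k-n}C^{\,n}D^{\,2p-2k-n}.$$ The Gamma ratios are continued to their removable singularities, that is, $\Gamma(x)/\Gamma(x-m)=\prod_{j=1}^m(x-j)$ and $\Gamma(x+m)/\Gamma(x)=\prod_{j=0}^{m-1}(x+j)$ for all complex $x$ and integers $m\geq0$. Moreover, in each case $\mathcal D$ is obtained from an ordered polynomial in the generators of $\mathcal G_2^+$ — $(d^+)^p$ in (i), $(\hat b_2^+)^p$ in (ii), and in (iii)–(v) the same sum with $B_k,C,D$ replaced by $\hat b_k^+=b_k^+-\frac12(a_k^+)^2$, $\hat c^+=c^+-\frac12a_1^+a_2^+$, $d^+$ — by substituting for each generator $X\in\{a_1^+,a_2^+,b_1^+,b_2^+,c^+,d^+\}$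 its right-action differential operator $\pi_R(X)$ in the coordinates $v$. -/

import Mathlib

open scoped Nat ContDiff

noncomputable section

namespace JacobiG2

/-! ### The Jacobi algebra and its matrix group

The split real form of the Jacobi algebra is realised faithfully by real `6 × 6` matrices: it acts by
the adjoint action on the span of `1, a₁⁺, a₂⁺, a₁⁻, a₂⁻` and of a grading element `D`, with
`[D, a] = a` for `a = aᵢ^±`, `[D, 1] = 2 · 1` and `[D, K] = 0`; these six vectors are numbered
`0, 1, 2, 3, 4, 5` in this order. The defining commutation relations are verified below. -/

abbrev Mat : Type := Matrix (Fin 6) (Fin 6) ℝ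

/-- The number of the basis vector `aᵢ⁺`. -/
def up : Fin 2 → Fin 6 := ![1, 2]

/-- The number of the basis vector `aᵢ⁻`. -/
def dn : Fin 2 → Fin 6 := ![3, 4]

/-- Matrix units. -/
def unitMat (i j : Fin 6) : Mat := Matrix.single i j 1

def aPlus (i : Fin 2) : Mat := -unitMat 0 (dn i) - unitMat (up i) 5

def aMinus (i : Fin 2) : Mat := unitMat 0 (up i) - unitMat (dn i) 5

/-- The central element `1` of the Heisenberg algebra, `[aᵢ⁻, aⱼ⁺] = δᵢⱼ 1`. -/
def central : Mat := (-2 : ℝ) • unitMat 0 5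

def KPlus (i j : Fin 2) : Mat := (-1 / 2 : ℝ) • (unitMat (up i) (dn j) + unitMat (up j) (dn i))

def KMinus (i j : Fin 2) : Mat := (1 / 2 : ℝ) • (unitMat (dn i) (up j) + unitMat (dn j) (up i))

def KZero (i j : Fin 2) : Mat := (1 / 2 : ℝ) • (unitMat (up i) (up j) - unitMat (dn j) (dn i))

/-- The Kronecker symbol. -/
def kd (i j : Fin 2) : ℝ := if i = j then 1 else 0

theorem unitMat_mul (i j k l : Fin 6) :
    unitMat i j * unitMat k l = if j = k then unitMat i l else 0 := by
  by_cases h : j = k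
  · subst h; simp [unitMat]
  · simp [unitMat, h]

theorem heisenberg_relations (i j : Fin 2) :
    ⁅aMinus i, aPlus j⁆ = kd i j • central ∧ ⁅aMinus i, aMinus j⁆ = 0 ∧
      ⁅aPlus i, aPlus j⁆ = 0 := by
  refine ⟨?_, ?_, ?_⟩ <;> fin_cases i <;> fin_cases j <;>
    simp [Ring.lie_def, aPlus, aMinus, central, kd, up, dn, mul_sub, sub_mul, unitMat_mul] <;>
    module

theorem mixed_relations (i k j : Fin 2) :
    ⁅aPlus k, KPlus i j⁆ = 0 ∧ ⁅aMinus k, KMinus i j⁆ = 0 ∧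
    ⁅aMinus i, KPlus k j⁆ = (1 / 2 * kd i k) • aPlus j + (1 / 2 * kd i j) • aPlus k ∧
    ⁅KMinus k j, aPlus i⁆ = (1 / 2 * kd i k) • aMinus j + (1 / 2 * kd i j) • aMinus k ∧
    ⁅KZero i j, aPlus k⁆ = (1 / 2 * kd j k) • aPlus i ∧
    ⁅aMinus k, KZero i j⁆ = (1 / 2 * kd i k) • aMinus j := by
  refine ⟨?_, ?_, ?_, ?_, ?_, ?_⟩ <;> fin_cases i <;> fin_cases k <;> fin_cases j <;>
    simp [Ring.lie_def, aPlus, aMinus, KPlus, KMinus, KZero, kd, up, dn, mul_sub, sub_mul, mul_add,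
      add_mul, unitMat_mul] <;>
    module

theorem symplectic_relations (i j k l : Fin 2) :
    ⁅KMinus i j, KMinus k l⁆ = 0 ∧ ⁅KPlus i j, KPlus k l⁆ = 0 ∧
    (2 : ℝ) • ⁅KMinus i j, KZero k l⁆ = kd k j • KMinus i l + kd k i • KMinus j l ∧
    (2 : ℝ) • ⁅KMinus i j, KPlus k l⁆ =
      kd l i • KZero k j + kd k i • KZero l j + kd l j • KZero k i + kd k j • KZero l i ∧
    (2 : ℝ) • ⁅KPlus i j, KZero k l⁆ = -(kd j l • KPlus i k) - kd l i • KPlus j k ∧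
    (2 : ℝ) • ⁅KZero j i, KZero k l⁆ = kd k i • KZero j l - kd l j • KZero k i := by
  refine ⟨?_, ?_, ?_, ?_, ?_, ?_⟩ <;> fin_cases i <;> fin_cases j <;> fin_cases k <;> fin_cases l <;>
    simp [Ring.lie_def, KPlus, KMinus, KZero, kd, up, dn, mul_sub, sub_mul, mul_add, add_mul,
      unitMat_mul] <;>
    module

/-- A basis of `𝒢₂⁺`, in the order `a₁⁺, a₂⁺, b₁⁺, b₂⁺, c⁺, d⁺`. -/
def posGen : Fin 6 → Mat :=
  ![aPlus 0, aPlus 1, KPlus 0 0, KPlus 1 1, KPlus 0 1, KZero 0 1]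

/-- A basis of `𝒢₂⁻`, in the order `a₁⁻, a₂⁻, b₁⁻, b₂⁻, c⁻, d⁻`. -/
def negGen : Fin 6 → Mat :=
  ![aMinus 0, aMinus 1, KMinus 0 0, KMinus 1 1, KMinus 0 1, KZero 1 0]

/-- A basis of `𝒦₂`, in the order `h₁, h₂, 1`. -/
def cartanGen : Fin 3 → Mat := ![KZero 0 0, KZero 1 1, central]

/-- The real Lie algebra spanned by all generators. -/
def jacobiAlgebra : Submodule ℝ Mat :=
  Submodule.span ℝ (Set.range posGen ∪ Set.range cartanGen ∪ Set.range negGen)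

/-! ### The cell `G⁺ K G⁻` -/

/-- Coordinates on `G⁺ ≅ ℝ⁶`. -/
abbrev Coord : Type := Fin 6 → ℝ

/-- The element of `G⁺` with parameters `(x₁, x₂, y₁, y₂, z, w)`. -/
def gPlusOld (x : Coord) : Mat :=
  NormedSpace.exp (x 0 • posGen 0 + x 1 • posGen 1) *
    NormedSpace.exp (x 2 • posGen 2 + x 3 • posGen 3 + x 4 • posGen 4 + x 5 • posGen 5)

/-- The change of parameters `(x₁, x₂, y₁, y₂, z, w) ↦ (ξ₁, ξ₂, η₁, η₂, ζ, ω)`. -/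
def newCoord (x : Coord) : Coord :=
  ![x 0 - x 5 / 2 * x 1, x 1, x 2 + x 5 ^ 2 / 12 * x 3 - x 5 / 4 * x 4, x 3,
    x 4 - x 5 / 2 * x 3, x 5]

/-- The inverse change of parameters `(ξ₁, ξ₂, η₁, η₂, ζ, ω) ↦ (x₁, x₂, y₁, y₂, z, w)`. -/
def oldCoord (v : Coord) : Coord :=
  ![v 0 + v 5 / 2 * v 1, v 1, v 2 + v 4 * v 5 / 4 + v 3 * v 5 ^ 2 / 24, v 3,
    v 4 + v 3 * v 5 / 2, v 5]

theorem oldCoord_newCoord (x : Coord) : oldCoord (newCoord x) = x := by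
  funext i; fin_cases i <;> simp [oldCoord, newCoord] <;> ring

theorem newCoord_oldCoord (v : Coord) : newCoord (oldCoord v) = v := by
  funext i; fin_cases i <;> simp [oldCoord, newCoord] <;> ring

/-- The element of `G⁺` with coordinates `(ξ₁, ξ₂, η₁, η₂, ζ, ω)`. -/
def gPlus (v : Coord) : Mat := gPlusOld (oldCoord v)

/-- The element `exp (s₀ h₁ + s₁ h₂ + s₂ 1)` of `K`. -/
def kElt (s : Fin 3 → ℝ) : Mat := NormedSpace.exp (∑ i, s i • cartanGen i)

/-- The elements of `G⁻`; the exponential map of a nilpotent Lie algebra is onto. -/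
def gMinus (u : Fin 6 → ℝ) : Mat := NormedSpace.exp (∑ i, u i • negGen i)

/-- The cell `G⁺ K G⁻` of the Jacobi group. -/
def bigCell : Set Mat := {g | ∃ v s u, g = gPlus v * kElt s * gMinus u}

/-! ### Weights and right covariant functions -/

/-- A weight `Λ ∈ 𝒦₂*`: its values on `h₁`, `h₂` and on the central element `1`. -/
@[ext] structure Weight where
  h₁ : ℂ
  h₂ : ℂ
  hat : ℂ

/-- `Λ + m₁ δ₁ + m₂ δ₂`, where `δ₁ = (1/2, 0)` and `δ₂ = (0, 1/2)` in terms of the values on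
`(h₁, h₂)`. -/
def Weight.shift (Λ : Weight) (m₁ m₂ : ℤ) : Weight :=
  ⟨Λ.h₁ + (m₁ : ℂ) / 2, Λ.h₂ + (m₂ : ℂ) / 2, Λ.hat⟩

/-- `e^{Λ(H)}` for `H = s₀ h₁ + s₁ h₂ + s₂ 1`. -/
def Weight.char (Λ : Weight) (s : Fin 3 → ℝ) : ℂ :=
  Complex.exp (Λ.h₁ * (s 0 : ℂ) + Λ.h₂ * (s 1 : ℂ) + Λ.hat * (s 2 : ℂ))

/-- The space `𝒞_Λ` of smooth functions `F` on the cell `G⁺ K G⁻` (extended by zero to the other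
matrices) with `F (g k g⁻) = e^{Λ(H)} F g` for `k = e^H ∈ K` and `g⁻ ∈ G⁻`. Smoothness is smoothness
in the global chart of the cell. -/
def CovFun (Λ : Weight) : Submodule ℂ (Mat → ℂ) where
  carrier := {F |
    ContDiff ℝ ∞ (fun p : Coord × (Fin 3 → ℝ) × (Fin 6 → ℝ) =>
      F (gPlus p.1 * kElt p.2.1 * gMinus p.2.2)) ∧
    (∀ g ∈ bigCell, ∀ s u, F (g * (kElt s * gMinus u)) = Λ.char s * F g) ∧
    ∀ g ∉ bigCell, F g = 0}
  add_mem' := by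
    rintro F F' ⟨h1, h2, h3⟩ ⟨h1', h2', h3'⟩
    refine ⟨h1.add h1', fun g hg s u => ?_, fun g hg => ?_⟩
    · simp [h2 g hg, h2' g hg, mul_add]
    · simp [h3 g hg, h3' g hg]
  zero_mem' := ⟨contDiff_const, by simp, by simp⟩
  smul_mem' := by
    rintro c F ⟨h1, h2, h3⟩
    refine ⟨contDiff_const.smul h1, fun g hg s u => ?_, fun g hg => ?_⟩
    · simp [h2 g hg]; ring
    · simp [h3 g hg]

/-- Smooth complex functions of the coordinates `(ξ₁, ξ₂, η₁, η₂, ζ, ω)`. -/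
def SmoothFun : Submodule ℂ (Coord → ℂ) where
  carrier := {f | ContDiff ℝ ∞ f}
  add_mem' := by
    intro f g (hf : ContDiff ℝ ∞ f) (hg : ContDiff ℝ ∞ g)
    exact hf.add hg
  zero_mem' := (contDiff_const : ContDiff ℝ ∞ (fun _ : Coord => (0 : ℂ)))
  smul_mem' := by
    intro c f (hf : ContDiff ℝ ∞ f)
    exact hf.const_smul c

/-- Linear operators on smooth functions of the coordinates; products are compositions. -/
abbrev Op : Type := Module.End ℂ SmoothFun

theorem kElt_zero : kElt 0 = 1 := by simp [kElt]

theorem gMinus_zero : gMinus 0 = 1 := by simp [gMinus]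

/-- The restriction of a right covariant function to `G⁺`, in the coordinates. -/
def restrict (Λ : Weight) : CovFun Λ →ₗ[ℂ] SmoothFun where
  toFun F := ⟨fun v => (F : Mat → ℂ) (gPlus v), by
    have h := F.2.1.comp (contDiff_id.prodMk contDiff_const :
      ContDiff ℝ ∞ (fun v : Coord => (v, ((0 : Fin 3 → ℝ), (0 : Fin 6 → ℝ)))))
    simp only [Function.comp_def, kElt_zero, gMinus_zero, mul_one] at h
    exact h⟩
  map_add' _ _ := rfl
  map_smul' _ _ := rfl

/-- `R` is the right action `π_R(X)`, for `X ∈ 𝒢₂⁺`, on the functions on `G⁺`: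
`(π_R(X) F)(g) = d/dt F(g exp(tX))` at `t = 0`. -/
def IsRightAction (X : Mat) (R : Op) : Prop :=
  ∀ (Λ : Weight) (F : CovFun Λ) (v : Coord),
    HasDerivAt (fun t : ℝ => (F : Mat → ℂ) (gPlus v * NormedSpace.exp (t • X)))
      ((R (restrict Λ F) : Coord → ℂ) v) 0

/-- `π` is the left action on `𝒞_Λ`: `(π_L(X) F)(g) = d/dt F(exp(-tX) g)` at `t = 0`. -/
def IsLeftAction (Λ : Weight) (π : jacobiAlgebra →ₗ[ℝ] Module.End ℂ (CovFun Λ)) : Prop :=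
  ∀ (X : jacobiAlgebra) (F : CovFun Λ), ∀ g ∈ bigCell,
    HasDerivAt (fun t : ℝ => (F : Mat → ℂ) (NormedSpace.exp (-(t • (X : Mat))) * g))
      ((π X F : Mat → ℂ) g) 0

/-- The operator `𝒟`, which acts on functions of the coordinates of `G⁺`, defines a linear map
`𝒞_Λ → 𝒞_Λ'` that intertwines the left actions of the (complex) Jacobi algebra, whose elements are
`X + i Y` with `X`, `Y` in the real form. -/
def Intertwines (Λ Λ' : Weight) (𝒟 : Op) : Prop :=
  ∃ (π : jacobiAlgebra →ₗ[ℝ] Module.End ℂ (CovFun Λ))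
    (π' : jacobiAlgebra →ₗ[ℝ] Module.End ℂ (CovFun Λ')) (T : CovFun Λ →ₗ[ℂ] CovFun Λ'),
    IsLeftAction Λ π ∧ IsLeftAction Λ' π' ∧
    (∀ F, restrict Λ' (T F) = 𝒟 (restrict Λ F)) ∧
    ∀ X Y : jacobiAlgebra,
      T ∘ₗ (π X + Complex.I • π Y) = (π' X + Complex.I • π' Y) ∘ₗ T

/-! ### Ordered polynomials in the generators of `𝒢₂⁺` -/

/-- `Γ(x) / Γ(x - m)`, continued to its removable singularities. -/
def gammaFall (x : ℂ) (m : ℕ) : ℂ := ∏ j ∈ Finset.range m, (x - 1 - j)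

/-- `Γ(x + m) / Γ(x)`, continued to its removable singularities. -/
def gammaRise (x : ℂ) (m : ℕ) : ℂ := ∏ j ∈ Finset.range m, (x + j)

theorem gammaRise_eq (x : ℂ) (m : ℕ) (hx : ∀ j : ℕ, x ≠ -j) :
    gammaRise x m = Complex.Gamma (x + m) / Complex.Gamma x := by
  have h0 := Complex.Gamma_ne_zero hx
  rw [eq_div_iff h0]
  induction m with
  | zero => simp [gammaRise]
  | succ m ih =>
    have hm : x + m ≠ 0 := fun h => hx m (by linear_combination h)
    have e : x + ((m + 1 : ℕ) : ℂ) = x + m + 1 := by push_cast; ring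
    rw [e, Complex.Gamma_add_one _ hm, ← ih, gammaRise, gammaRise, Finset.prod_range_succ]
    ring

theorem gammaFall_eq (x : ℂ) (m : ℕ) (hx : ∀ j : ℕ, x ≠ -j) :
    gammaFall x m = Complex.Gamma x / Complex.Gamma (x - m) := by
  have h0 := Complex.Gamma_ne_zero hx
  induction m with
  | zero => simp [gammaFall, h0]
  | succ m ih =>
    have e : x - ((m + 1 : ℕ) : ℂ) = x - m - 1 := by push_cast; ring
    have ihs : gammaFall x (m + 1) = gammaFall x m * (x - m - 1) := by
      rw [gammaFall, gammaFall, Finset.prod_range_succ]; ring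
    rw [ihs, ih, e]
    by_cases hz : x - m - 1 = 0
    · simp [hz, Complex.Gamma_zero]
    · have h1 := Complex.Gamma_add_one _ hz
      rw [sub_add_cancel] at h1
      rw [h1]
      field_simp

section Polynomials

variable {A : Type} [Ring A] [Algebra ℂ A]

/-- The coefficient of types (iii). -/
def coeffIII (p q k n : ℕ) : ℂ :=
  ((p ! : ℂ) * (q ! : ℂ)) /
    (4 ^ k * (k ! : ℂ) * (n ! : ℂ) * ((p - 2 * k - n)! : ℂ) * ((q - k - n)! : ℂ))

/-- The coefficient of type (iv); `x` is the value `Λ₁`. -/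
def coeffIV (x : ℂ) (p k n : ℕ) : ℂ :=
  (p ! : ℂ) / (4 ^ k * (k ! : ℂ) * (n ! : ℂ) * ((p - 2 * k - n)! : ℂ)) *
    gammaFall (2 * x + p - 3 / 2) (k + n)

/-- The coefficient of type (v); `x` is the value `Λ₂`. -/
def coeffV (x : ℂ) (p k n : ℕ) : ℂ :=
  (-1) ^ n / (4 ^ k * (k ! : ℂ) * (n ! : ℂ)) * ((p ! : ℂ) / ((p - k - n)! : ℂ)) *
    gammaRise (2 * x - p - 3 / 2) (2 * k + n)

/-- The double sums of types (iii), (iv), (v), for any family `W k ℓ n m` in an algebra. -/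
def sumIIIa (W : ℕ → ℕ → ℕ → ℕ → A) (p q : ℕ) : A :=
  ∑ k ∈ Finset.Icc 0 (p / 2), ∑ n ∈ Finset.Icc 0 (p - 2 * k),
    coeffIII p q k n • W k (q - k - n) n (p - 2 * k - n)

def sumIIIb (W : ℕ → ℕ → ℕ → ℕ → A) (p q : ℕ) : A :=
  (∑ k ∈ Finset.Icc 0 (p - q), ∑ n ∈ Finset.Icc 0 (q - k),
    coeffIII p q k n • W k (q - k - n) n (p - 2 * k - n)) +
  ∑ k ∈ Finset.Icc (p - q + 1) (p / 2), ∑ n ∈ Finset.Icc 0 (p - 2 * k),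
    coeffIII p q k n • W k (q - k - n) n (p - 2 * k - n)

def sumIIIc (W : ℕ → ℕ → ℕ → ℕ → A) (p q : ℕ) : A :=
  ∑ k ∈ Finset.Icc 0 q, ∑ n ∈ Finset.Icc 0 (q - k),
    coeffIII p q k n • W k (q - k - n) n (p - 2 * k - n)

def sumIV (W : ℕ → ℕ → ℕ → ℕ → A) (x : ℂ) (p : ℕ) : A :=
  ∑ k ∈ Finset.Icc 0 (p / 2), ∑ n ∈ Finset.Icc 0 (p - 2 * k),
    coeffIV x p k n • W k (p - k - n) n (p - 2 * k - n)

def sumV (W : ℕ → ℕ → ℕ → ℕ → A) (x : ℂ) (p : ℕ) : A :=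
  ∑ k ∈ Finset.Icc 0 p, ∑ n ∈ Finset.Icc 0 (p - k),
    coeffV x p k n • W k (p - k - n) n (2 * p - 2 * k - n)

/-- `(b̂₁⁺)^k (b̂₂⁺)^ℓ (ĉ⁺)^n (d⁺)^m` with `ρ 0, …, ρ 5` substituted for the generators
`a₁⁺, a₂⁺, b₁⁺, b₂⁺, c⁺, d⁺`, where `b̂ᵢ⁺ = bᵢ⁺ - ½ (aᵢ⁺)²` and `ĉ⁺ = c⁺ - ½ a₁⁺ a₂⁺`. -/
def hatWord (ρ : Fin 6 → A) (k l n m : ℕ) : A :=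
  (ρ 2 - (1 / 2 : ℂ) • ρ 0 ^ 2) ^ k * (ρ 3 - (1 / 2 : ℂ) • ρ 1 ^ 2) ^ l *
    (ρ 4 - (1 / 2 : ℂ) • (ρ 0 * ρ 1)) ^ n * ρ 5 ^ m

end Polynomials

/-- `𝒟` is what becomes of the ordered polynomial `P` in the generators of `𝒢₂⁺` when every generator
is replaced by its right action. -/
def IsRightSubstitution (𝒟 : Op) (P : (Fin 6 → Op) → Op) : Prop :=
  ∃ ρ : Fin 6 → Op, (∀ i, IsRightAction (posGen i) (ρ i)) ∧ 𝒟 = P ρ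

/-! ### The explicit differential operators -/

/-- The partial derivative with respect to the coordinate with index `i`. -/
def pd (i : Fin 6) : Op where
  toFun f := ⟨fun v => fderiv ℝ (f : Coord → ℂ) v (Pi.single i 1), by
    have hf : ContDiff ℝ ∞ (f : Coord → ℂ) := f.2
    exact (hf.fderiv_right (m := ∞) (by simp)).clm_apply contDiff_const⟩
  map_add' f g := by
    have hf : ContDiff ℝ ∞ (f : Coord → ℂ) := f.2
    have hg : ContDiff ℝ ∞ (g : Coord → ℂ) := g.2
    ext v
    have := fderiv_add (hf.differentiable (by simp) v) (hg.differentiable (by simp) v)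
    simp [this]
  map_smul' c f := by
    have hf : ContDiff ℝ ∞ (f : Coord → ℂ) := f.2
    ext v
    have := fderiv_const_smul (hf.differentiable (by simp) v) c
    simp [this]

/-- Multiplication by the coordinate with index `i`. -/
def mulCoord (i : Fin 6) : Op where
  toFun f := ⟨fun v => (v i : ℂ) * (f : Coord → ℂ) v, by
    have hf : ContDiff ℝ ∞ (f : Coord → ℂ) := f.2
    exact (Complex.ofRealCLM.contDiff.comp (contDiff_apply ℝ ℝ i)).mul hf⟩
  map_add' f g := by ext v; simp [mul_add]
  map_smul' c f := by ext v; simp; ring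

def dξ₁ : Op := pd 0
def dξ₂ : Op := pd 1
def dη₁ : Op := pd 2
def dη₂ : Op := pd 3
def dζ : Op := pd 4
def dω : Op := pd 5
def ξ₂ : Op := mulCoord 1
def η₂ : Op := mulCoord 3
def ζ : Op := mulCoord 4

/-- `∂_ω - (ξ₂/2) ∂_{ξ₁} - (ζ/2) ∂_{η₁} - η₂ ∂_ζ`. -/
def opD : Op := dω - (1 / 2 : ℂ) • (ξ₂ * dξ₁) - (1 / 2 : ℂ) • (ζ * dη₁) - η₂ * dζ

/-- `∂_{η₁} - ½ ∂_{ξ₁}²`. -/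
def opB₁ : Op := dη₁ - (1 / 2 : ℂ) • dξ₁ ^ 2

/-- `∂_{η₂} - ½ ∂_{ξ₂}²`. -/
def opB₂ : Op := dη₂ - (1 / 2 : ℂ) • dξ₂ ^ 2

/-- `∂_ζ - ½ ∂_{ξ₁} ∂_{ξ₂}`. -/
def opC : Op := dζ - (1 / 2 : ℂ) • (dξ₁ * dξ₂)

/-- The product of powers which occurs in the summands of types (iii), (iv), (v). -/
def opWord (k l n m : ℕ) : Op := opB₁ ^ k * opB₂ ^ l * opC ^ n * opD ^ m

def opI (p : ℕ) : Op := opD ^ p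
def opII (p : ℕ) : Op := opB₂ ^ p
def opIIIa (p q : ℕ) : Op := sumIIIa opWord p q
def opIIIb (p q : ℕ) : Op := sumIIIb opWord p q
def opIIIc (p q : ℕ) : Op := sumIIIc opWord p q
def opIV (x : ℂ) (p : ℕ) : Op := sumIV opWord x p
def opV (x : ℂ) (p : ℕ) : Op := sumV opWord x p

end JacobiG2

end

noncomputable section

namespace JacobiG2

/-! ### Explicit matrices -/

/-! The argument turns intertwining differential operators into singular vectors of lowest weight
modules.

The matrix group lies in the stabiliser of a vector in the symplectic group of a six-dimensional
space. Inside this stabiliser the cell is cut out by the positivity of two minors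
(`mem_bigCell_iff`), and its Gauss factors are ratios of minors. Hence a covariant function is the
same as a smooth function of `v`, and a single computation (`CovFun.hasDerivAt`) differentiates it
along any curve in the stabiliser that starts in `G⁺`: the `G⁺`-part of the velocity acts by right
derivatives, the `K`-part by the weight, and the `G⁻`-part by zero. Since `exp(-tX) g = g exp(-t
Ad(g⁻¹)X)`, this yields both the right and the left action. The left operators respect brackets
(`leftOp_lie`) because `Λ` is a character of the sum of the `K`- and `G⁻`-parts.

Fix a point `v` and let the Jacobi algebra act on functionals by the contragredient of the left
action, twisted by the adjoint action of `gPlus v`. Evaluation at `v` is then killed by `𝒢₂⁻` and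
has weight `Λ` (`isSingular_evalAt`). Right derivatives commute with left translations by `G⁺`.
Therefore a polynomial in right derivatives, read at `v`, is the same polynomial, in the same order,
applied to the evaluation functional (`rightOp_mem_pointwise`). If the result is again killed by
`𝒢₂⁻` and has weight `Λ'`, the operator intertwines (`mul_leftOp`).

It remains to find singular vectors. Testing `d⁻`, `b₂⁻` and `a₂⁻` suffices, as they generate `𝒢₂⁻`.
When the central element acts by `1`, the hatted generators commute with `a₂⁻`, so only the first
two matter. Case (i) is the usual `sl₂` string. In the double sums, `d⁻` and `b₂⁻` give two
three-term recursions (`N_vec`, `B_vec`). All the coefficients have one form, `coeffHat x y`, a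
product of two falling factorials over `4ᵏ k! n!`. Its contiguity relations reduce both recursions
to polynomial identities that hold at the stated weights, and its zeros stop the sums at the right
boundary (`intertwines_sumHat`). -/

theorem exp_of_pow_four_eq_zero {X : Mat} (h : X ^ 4 = 0) :
    NormedSpace.exp X = 1 + X + (1 / 2 : ℝ) • X ^ 2 + (1 / 6 : ℝ) • X ^ 3 := by
  simp only [NormedSpace.exp_eq_tsum ℝ]
  rw [tsum_eq_sum (s := Finset.range 4)]
  · simp [Finset.sum_range_succ, Nat.factorial]
  · intro n hn
    have : 4 ≤ n := by simpa using hn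
    rw [pow_eq_zero_of_le this h, smul_zero]

/-- The generic element of `𝒢₂⁺`. -/
def posMat (y : Fin 6 → ℝ) : Mat :=
  !![0, 0, 0, -y 0, -y 1, 0;
     0, 0, y 5 / 2, -y 2, -y 4 / 2, -y 0;
     0, 0, 0, -y 4 / 2, -y 3, -y 1;
     0, 0, 0, 0, 0, 0;
     0, 0, 0, -y 5 / 2, 0, 0;
     0, 0, 0, 0, 0, 0]

def negMat (u : Fin 6 → ℝ) : Mat :=
  !![0, u 0, u 1, 0, 0, 0;
     0, 0, 0, 0, 0, 0;
     0, u 5 / 2, 0, 0, 0, 0;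
     0, u 2, u 4 / 2, 0, -u 5 / 2, -u 0;
     0, u 4 / 2, u 3, 0, 0, -u 1;
     0, 0, 0, 0, 0, 0]

def cartanMat (s : Fin 3 → ℝ) : Mat :=
  !![0, 0, 0, 0, 0, -2 * s 2;
     0, s 0 / 2, 0, 0, 0, 0;
     0, 0, s 1 / 2, 0, 0, 0;
     0, 0, 0, -s 0 / 2, 0, 0;
     0, 0, 0, 0, -s 1 / 2, 0;
     0, 0, 0, 0, 0, 0]

theorem sum_posGen (y : Fin 6 → ℝ) : ∑ i, y i • posGen i = posMat y := by
  ext i j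
  fin_cases i <;> fin_cases j <;>
    simp [Fin.sum_univ_six, posGen, posMat, aPlus, KPlus, KZero, up, dn, unitMat, Matrix.single] <;>
    ring

theorem sum_negGen (y : Fin 6 → ℝ) : ∑ i, y i • negGen i = negMat y := by
  ext i j
  fin_cases i <;> fin_cases j <;>
    simp [Fin.sum_univ_six, negGen, negMat, aMinus, KMinus, KZero, up, dn, unitMat,
      Matrix.single] <;>
    ring

theorem sum_cartanGen (s : Fin 3 → ℝ) : ∑ i, s i • cartanGen i = cartanMat s := by
  ext i j
  fin_cases i <;> fin_cases j <;>
    simp [Fin.sum_univ_three, cartanGen, cartanMat, central, KZero, up, dn, unitMat,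
      Matrix.single] <;>
    ring

def gMinusMat (u : Fin 6 → ℝ) : Mat :=
  !![1, u 0 + u 1 * u 5 / 4, u 1, 0, 0, 0;
     0, 1, 0, 0, 0, 0;
     0, u 5 / 2, 1, 0, 0, 0;
     0, u 2 - u 3 * u 5 ^ 2 / 24, u 4 / 2 - u 3 * u 5 / 4, 1, -u 5 / 2, -u 0 + u 1 * u 5 / 4;
     0, u 4 / 2 + u 3 * u 5 / 4, u 3, 0, 1, -u 1;
     0, 0, 0, 0, 0, 1]

theorem gMinus_eq (u : Fin 6 → ℝ) : gMinus u = gMinusMat u := by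
  have h2 : negMat u ^ 2 =
      !![0, u 1 * u 5 / 2, 0, 0, 0, 0;
         0, 0, 0, 0, 0, 0;
         0, 0, 0, 0, 0, 0;
         0, 0, -u 3 * u 5 / 2, 0, 0, u 1 * u 5 / 2;
         0, u 3 * u 5 / 2, 0, 0, 0, 0;
         0, 0, 0, 0, 0, 0] := by
    rw [pow_two]
    ext i j
    fin_cases i <;> fin_cases j <;> simp [negMat, Matrix.mul_apply, Fin.sum_univ_six] <;> ring
  have h3 : negMat u ^ 3 = Matrix.single 3 1 (-u 3 * u 5 ^ 2 / 4) := by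
    rw [pow_succ, h2]
    ext i j
    fin_cases i <;> fin_cases j <;>
      simp [negMat, Matrix.mul_apply, Fin.sum_univ_six, Matrix.single] <;> ring
  have h4 : negMat u ^ 4 = 0 := by
    rw [pow_succ, h3]
    ext i j
    fin_cases i <;> fin_cases j <;>
      simp [negMat, Matrix.mul_apply, Matrix.single]
  rw [gMinus, sum_negGen, exp_of_pow_four_eq_zero h4, h2, h3]
  ext i j
  fin_cases i <;> fin_cases j <;>
    simp [negMat, gMinusMat, Matrix.single] <;> ring

def kMat (s : Fin 3 → ℝ) : Mat :=
  !![1, 0, 0, 0, 0, -2 * s 2;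
     0, Real.exp (s 0 / 2), 0, 0, 0, 0;
     0, 0, Real.exp (s 1 / 2), 0, 0, 0;
     0, 0, 0, Real.exp (-s 0 / 2), 0, 0;
     0, 0, 0, 0, Real.exp (-s 1 / 2), 0;
     0, 0, 0, 0, 0, 1]

theorem kElt_eq (s : Fin 3 → ℝ) : kElt s = kMat s := by
  set D : Mat := Matrix.diagonal ![0, s 0 / 2, s 1 / 2, -s 0 / 2, -s 1 / 2, 0] with hD
  set N : Mat := Matrix.single 0 5 (-2 * s 2) with hN
  have h1 : cartanMat s = D + N := by
    ext i j
    fin_cases i <;> fin_cases j <;> simp [cartanMat, hD, hN, Matrix.single, Matrix.diagonal]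
  -- The nilpotent part sits at the corner (0,5), where both diagonal entries of `D` vanish. The
  -- exponential therefore splits into the two factors.
  have h2 : Commute D N := by
    ext i j
    fin_cases i <;> fin_cases j <;>
      simp [hD, hN, Matrix.single, Matrix.diagonal, Matrix.mul_apply]
  have hN2 : N ^ 2 = 0 := by
    rw [pow_two]
    ext i j
    fin_cases i <;> fin_cases j <;>
      simp [hN, Matrix.single, Matrix.mul_apply]
  have hN4 : N ^ 4 = 0 := pow_eq_zero_of_le (by norm_num) hN2
  have hN3 : N ^ 3 = 0 := pow_eq_zero_of_le (by norm_num) hN2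
  rw [kElt, sum_cartanGen, h1, Matrix.exp_add_of_commute _ _ h2, exp_of_pow_four_eq_zero hN4, hN2,
    hN3, hD, Matrix.exp_diagonal]
  ext i j
  fin_cases i <;> fin_cases j <;>
    simp [hN, Matrix.single, Matrix.diagonal, Matrix.mul_apply, kMat,
      Matrix.one_apply, Pi.coe_exp, ← Real.exp_eq_exp_ℝ]

/-- In the coordinates `v` all entries are at most quadratic, and columns 3 and 4 already determine
`v`. -/
def gPlusMat (v : Coord) : Mat :=
  !![1, 0, 0, -v 0, -v 1, 0;
     0, 1, v 5 / 2, -v 2 - v 5 * v 4 / 4, -v 4 / 2 - v 5 * v 3 / 2, -v 0 - v 5 * v 1 / 2;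
     0, 0, 1, -v 4 / 2, -v 3, -v 1;
     0, 0, 0, 1, 0, 0;
     0, 0, 0, -v 5 / 2, 1, 0;
     0, 0, 0, 0, 0, 1]

def gPlusInv (v : Coord) : Mat :=
  !![1, 0, 0, v 0 + v 5 * v 1 / 2, v 1, 0;
     0, 1, -v 5 / 2, v 2 + v 5 * v 4 / 4, v 4 / 2, v 0;
     0, 0, 1, v 4 / 2 + v 5 * v 3 / 2, v 3, v 1;
     0, 0, 0, 1, 0, 0;
     0, 0, 0, v 5 / 2, 1, 0;
     0, 0, 0, 0, 0, 1]

theorem gPlusOld_eq (x : Coord) : gPlusOld x =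
    (1 + posMat ![x 0, x 1, 0, 0, 0, 0]) *
      !![1, 0, 0, 0, 0, 0;
         0, 1, x 5 / 2, -x 2 + x 3 * x 5 ^ 2 / 24, -x 4 / 2 - x 3 * x 5 / 4, 0;
         0, 0, 1, -x 4 / 2 + x 3 * x 5 / 4, -x 3, 0;
         0, 0, 0, 1, 0, 0;
         0, 0, 0, -x 5 / 2, 1, 0;
         0, 0, 0, 0, 0, 1] := by
  have hA : x 0 • posGen 0 + x 1 • posGen 1 = posMat ![x 0, x 1, 0, 0, 0, 0] := by
    rw [← sum_posGen]; simp [Fin.sum_univ_six]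
  have hB : x 2 • posGen 2 + x 3 • posGen 3 + x 4 • posGen 4 + x 5 • posGen 5 =
      posMat ![0, 0, x 2, x 3, x 4, x 5] := by
    rw [← sum_posGen]; simp [Fin.sum_univ_six]
  set A := posMat ![x 0, x 1, 0, 0, 0, 0] with hAdef
  set B := posMat ![0, 0, x 2, x 3, x 4, x 5] with hBdef
  have hA2 : A ^ 2 = 0 := by
    rw [pow_two]
    ext i j
    fin_cases i <;> fin_cases j <;> simp [hAdef, posMat, Matrix.mul_apply, Fin.sum_univ_six]
  have hB2 : B ^ 2 =
      !![0, 0, 0, 0, 0, 0;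
         0, 0, 0, 0, -x 3 * x 5 / 2, 0;
         0, 0, 0, x 3 * x 5 / 2, 0, 0;
         0, 0, 0, 0, 0, 0;
         0, 0, 0, 0, 0, 0;
         0, 0, 0, 0, 0, 0] := by
    rw [pow_two]
    ext i j
    fin_cases i <;> fin_cases j <;>
      simp [hBdef, posMat, Matrix.mul_apply, Fin.sum_univ_six] <;> ring
  have hB3 : B ^ 3 = Matrix.single 1 3 (x 3 * x 5 ^ 2 / 4) := by
    rw [pow_succ, hB2]
    ext i j
    fin_cases i <;> fin_cases j <;>
      simp [hBdef, posMat, Matrix.mul_apply, Fin.sum_univ_six, Matrix.single] <;> ring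
  have hB4 : B ^ 4 = 0 := by
    rw [pow_succ, hB3]
    ext i j
    fin_cases i <;> fin_cases j <;>
      simp [hBdef, posMat, Matrix.mul_apply, Matrix.single]
  have hA4 : A ^ 4 = 0 := pow_eq_zero_of_le (by norm_num) hA2
  have hA3 : A ^ 3 = 0 := pow_eq_zero_of_le (by norm_num) hA2
  rw [gPlusOld, hA, hB, exp_of_pow_four_eq_zero hA4, exp_of_pow_four_eq_zero hB4, hA2, hA3, hB2,
    hB3]
  simp only [smul_zero, add_zero]
  congr 1
  ext i j
  fin_cases i <;> fin_cases j <;>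
    simp [hBdef, posMat, Matrix.single] <;> ring

theorem gPlus_eq (v : Coord) : gPlus v = gPlusMat v := by
  rw [gPlus, gPlusOld_eq]
  ext i j
  fin_cases i <;> fin_cases j <;>
    simp [posMat, gPlusMat, oldCoord, Matrix.mul_apply, Fin.sum_univ_six, Matrix.one_apply] <;> ring

theorem gPlusInv_mul (v : Coord) : gPlusInv v * gPlus v = 1 := by
  rw [gPlus_eq]
  ext i j
  fin_cases i <;> fin_cases j <;>
    simp [gPlusInv, gPlusMat, Matrix.mul_apply, Fin.sum_univ_six] <;> ring

theorem mul_gPlusInv (v : Coord) : gPlus v * gPlusInv v = 1 :=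
  mul_eq_one_comm.mp (gPlusInv_mul v)

theorem kElt_neg_mul (s : Fin 3 → ℝ) : kElt s * kElt (-s) = 1 := by
  rw [kElt_eq, kElt_eq]
  ext i j
  fin_cases i <;> fin_cases j <;>
    simp [kMat, Matrix.mul_apply, Fin.sum_univ_six, ← Real.exp_add, neg_div]

/-! ### The Jacobi group inside the symplectic group -/

/-- The symplectic form preserved by the Jacobi group. -/
def symp : Mat :=
  !![0, 0, 0, 0, 0, 1;
     0, 0, 0, 1, 0, 0;
     0, 0, 0, 0, 1, 0;
     0, -1, 0, 0, 0, 0;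
     0, 0, -1, 0, 0, 0;
     -1, 0, 0, 0, 0, 0]

/-- The stabiliser of the first basis vector in the symplectic group. -/
structure IsJacobi (g : Mat) : Prop where
  symp : g.transpose * symp * g = symp
  col : ∀ i, g i 0 = (1 : Mat) i 0

/-- The infinitesimal version of `IsJacobi`. -/
structure IsInfJacobi (X : Mat) : Prop where
  symp : X.transpose * symp + JacobiG2.symp * X = 0
  col : ∀ i, X i 0 = 0

theorem symp_entry (g : Mat) (i j : Fin 6) : (g.transpose * symp * g) i j =
    g 0 i * g 5 j - g 5 i * g 0 j + g 1 i * g 3 j - g 3 i * g 1 j + g 2 i * g 4 j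
      - g 4 i * g 2 j := by
  simp [symp, Matrix.mul_apply, Fin.sum_univ_six]
  ring

theorem IsJacobi.mul {g g' : Mat} (h : IsJacobi g) (h' : IsJacobi g') : IsJacobi (g * g') := by
  refine ⟨?_, fun i => ?_⟩
  · calc (g * g').transpose * JacobiG2.symp * (g * g')
        = g'.transpose * (g.transpose * JacobiG2.symp * g) * g' := by
          simp only [Matrix.transpose_mul, mul_assoc]
      _ = JacobiG2.symp := by rw [h.symp, h'.symp]
  · simp only [Matrix.mul_apply, h'.col, Matrix.one_apply]
    simp [h.col, Matrix.one_apply]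

/-- Pairing with the fixed vector under the symplectic form is the last coordinate, so that
functional is fixed too. -/
theorem IsJacobi.row {g : Mat} (h : IsJacobi g) (j : Fin 6) : g 5 j = (1 : Mat) 5 j := by
  have := congrFun₂ h.symp 0 j
  rw [symp_entry] at this
  simp only [h.col] at this
  fin_cases j <;> simpa [JacobiG2.symp, Matrix.one_apply] using this

theorem symp_mul_self : symp * symp = -1 := by
  ext i j
  fin_cases i <;> fin_cases j <;> simp [symp, Matrix.mul_apply, Fin.sum_univ_six]

theorem IsJacobi.mul_inv {g h : Mat} (hg : IsJacobi g) (e : h * g = 1) : IsJacobi h := by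
  refine ⟨?_, fun i => ?_⟩
  · have e' : g * h = 1 := mul_eq_one_comm.mp e
    calc h.transpose * JacobiG2.symp * h
        = h.transpose * (g.transpose * JacobiG2.symp * g) * h := by rw [hg.symp]
      _ = (g * h).transpose * JacobiG2.symp * (g * h) := by
          simp only [Matrix.transpose_mul, mul_assoc]
      _ = JacobiG2.symp := by simp [e']
  · rw [← e, Matrix.mul_apply]
    simp [hg.col, Matrix.one_apply]

theorem IsInfJacobi.add {X Y : Mat} (hX : IsInfJacobi X) (hY : IsInfJacobi Y) :
    IsInfJacobi (X + Y) := by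
  refine ⟨?_, fun i => by simp [hX.col, hY.col]⟩
  calc (X + Y).transpose * JacobiG2.symp + JacobiG2.symp * (X + Y)
      = (X.transpose * JacobiG2.symp + JacobiG2.symp * X)
        + (Y.transpose * JacobiG2.symp + JacobiG2.symp * Y) := by
        rw [Matrix.transpose_add]; noncomm_ring
    _ = 0 := by rw [hX.symp, hY.symp, add_zero]

theorem isInfJacobi_posMat (y : Fin 6 → ℝ) : IsInfJacobi (posMat y) := by
  refine ⟨?_, fun i => by fin_cases i <;> simp [posMat]⟩
  ext i j
  fin_cases i <;> fin_cases j <;>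
    simp [JacobiG2.symp, posMat, Matrix.mul_apply, Fin.sum_univ_six] <;> ring

theorem isInfJacobi_cartanMat (y : Fin 3 → ℝ) : IsInfJacobi (cartanMat y) := by
  refine ⟨?_, fun i => by fin_cases i <;> simp [cartanMat]⟩
  ext i j
  fin_cases i <;> fin_cases j <;>
    simp [JacobiG2.symp, cartanMat, Matrix.mul_apply, Fin.sum_univ_six] <;> ring

theorem isInfJacobi_negMat (y : Fin 6 → ℝ) : IsInfJacobi (negMat y) := by
  refine ⟨?_, fun i => by fin_cases i <;> simp [negMat]⟩
  ext i j
  fin_cases i <;> fin_cases j <;>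
    simp [JacobiG2.symp, negMat, Matrix.mul_apply, Fin.sum_univ_six] <;> ring

/-- The stabiliser of a vector in `sp(6)` has dimension 21 - 6 = 15, exactly the number of
generators. The linear equations leave no further freedom. -/
theorem isInfJacobi_iff (X : Mat) : IsInfJacobi X ↔ ∃ y s u,
    X = posMat y + cartanMat s + negMat u := by
  constructor
  · intro h
    -- Each parameter is read at an entry to which only one of the three matrices contributes.
    refine ⟨![-X 0 3, -X 0 4, -X 1 3, -X 2 4, -2 * X 1 4, 2 * X 1 2],
      ![2 * X 1 1, 2 * X 2 2, -X 0 5 / 2],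
      ![X 0 1, X 0 2, X 3 1, X 4 2, 2 * X 3 2, 2 * X 2 1], ?_⟩
    have e := fun i j => congrFun₂ h.symp i j
    simp only [JacobiG2.symp, Matrix.add_apply, Matrix.mul_apply, Fin.sum_univ_six,
      Matrix.transpose_apply, Matrix.zero_apply] at e
    have e01 := e 0 1; have e02 := e 0 2; have e03 := e 0 3; have e04 := e 0 4; have e05 := e 0 5
    have e12 := e 1 2; have e13 := e 1 3; have e14 := e 1 4; have e15 := e 1 5
    have e23 := e 2 3; have e24 := e 2 4; have e25 := e 2 5; have e34 := e 3 4; have e35 := e 3 5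
    have e45 := e 4 5
    simp [h.col] at e01 e02 e03 e04 e05 e12 e13 e14 e15 e23 e24 e25 e34 e35 e45
    ext i j
    fin_cases i <;> fin_cases j <;> simp [posMat, cartanMat, negMat, h.col] <;> linarith
  · rintro ⟨y, s, u, rfl⟩
    exact ((isInfJacobi_posMat y).add (isInfJacobi_cartanMat s)).add (isInfJacobi_negMat u)

/-- Trades a span for equations that are visibly stable under conjugation and that exponentiate to
the group. -/
theorem mem_jacobiAlgebra_iff (X : Mat) : X ∈ jacobiAlgebra ↔ IsInfJacobi X := by
  rw [isInfJacobi_iff, jacobiAlgebra, Submodule.span_union, Submodule.span_union,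
    Submodule.mem_sup]
  simp only [Submodule.mem_sup, Submodule.mem_span_range_iff_exists_fun, sum_posGen, sum_negGen,
    sum_cartanGen]
  constructor
  · rintro ⟨_, ⟨_, ⟨y, rfl⟩, _, ⟨s, rfl⟩, rfl⟩, _, ⟨u, rfl⟩, rfl⟩
    exact ⟨y, s, u, rfl⟩
  · rintro ⟨y, s, u, rfl⟩
    exact ⟨_, ⟨_, ⟨y, rfl⟩, _, ⟨s, rfl⟩, rfl⟩, _, ⟨u, rfl⟩, rfl⟩

theorem IsInfJacobi.conj {X g h : Mat} (hX : IsInfJacobi X) (hg : IsJacobi g) (e : h * g = 1) :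
    IsInfJacobi (h * X * g) := by
  have e' : g * h = 1 := mul_eq_one_comm.mp e
  refine ⟨?_, fun i => ?_⟩
  · have e1 : h.transpose * JacobiG2.symp = JacobiG2.symp * g := by
      have := (hg.mul_inv e).symp
      calc h.transpose * JacobiG2.symp = (h.transpose * JacobiG2.symp * h) * g := by
            rw [mul_assoc _ h g, e, mul_one]
        _ = _ := by rw [this]
    have e2 : g.transpose * JacobiG2.symp = JacobiG2.symp * h := by
      calc g.transpose * JacobiG2.symp = (g.transpose * JacobiG2.symp * g) * h := by
            rw [mul_assoc _ g h, e', mul_one]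
        _ = _ := by rw [hg.symp]
    calc (h * X * g).transpose * JacobiG2.symp + JacobiG2.symp * (h * X * g)
        = g.transpose * X.transpose * (h.transpose * JacobiG2.symp)
          + (JacobiG2.symp * h) * X * g := by
          simp only [Matrix.transpose_mul, mul_assoc]
      _ = g.transpose * (X.transpose * JacobiG2.symp + JacobiG2.symp * X) * g := by
          rw [e1, ← e2]; simp only [mul_add, add_mul, mul_assoc]
      _ = 0 := by rw [hX.symp]; simp
  · rw [Matrix.mul_apply]
    simp only [hg.col, Matrix.one_apply]
    simp [Matrix.mul_apply, hX.col]

/-- The infinitesimal condition says that the transpose of `X` is conjugate to `-X` by the form.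
Exponentiating that conjugacy gives invariance of the form. -/
theorem IsInfJacobi.exp {X : Mat} (hX : IsInfJacobi X) : IsJacobi (NormedSpace.exp X) := by
  refine ⟨?_, fun i => ?_⟩
  · have h1 : X.transpose = JacobiG2.symp * X * JacobiG2.symp := by
      have h := eq_neg_of_add_eq_zero_left hX.symp
      calc X.transpose = -(X.transpose * (JacobiG2.symp * JacobiG2.symp)) := by
            rw [symp_mul_self]; simp
        _ = _ := by rw [← mul_assoc, h]; simp
    have hu : IsUnit JacobiG2.symp := by
      refine IsUnit.of_mul_eq_one (-JacobiG2.symp) ?_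
      rw [mul_neg, symp_mul_self, neg_neg]
    have hinv : (JacobiG2.symp)⁻¹ = -JacobiG2.symp :=
      Matrix.inv_eq_right_inv (by rw [mul_neg, symp_mul_self, neg_neg])
    have h2 : X.transpose = JacobiG2.symp * (-X) * (JacobiG2.symp)⁻¹ := by
      rw [hinv, h1]; simp
    rw [← Matrix.exp_transpose, h2, Matrix.exp_conj _ _ hu, hinv, Matrix.exp_neg]
    have h3 : (NormedSpace.exp X)⁻¹ * NormedSpace.exp X = 1 :=
      Matrix.nonsing_inv_mul _ ((Matrix.isUnit_iff_isUnit_det _).mp (Matrix.isUnit_exp X))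
    calc JacobiG2.symp * (NormedSpace.exp X)⁻¹ * -JacobiG2.symp * JacobiG2.symp * NormedSpace.exp X
        = -(JacobiG2.symp * (NormedSpace.exp X)⁻¹ * (JacobiG2.symp * JacobiG2.symp)
          * NormedSpace.exp X) := by simp only [mul_assoc, mul_neg, neg_mul]
      _ = JacobiG2.symp * ((NormedSpace.exp X)⁻¹ * NormedSpace.exp X) := by
          rw [symp_mul_self]; simp [mul_assoc]
      _ = JacobiG2.symp := by rw [h3, mul_one]
  · have h0 : X * (Matrix.single 0 0 1 : Mat) = 0 := by
      ext i j
      rw [Matrix.mul_apply]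
      by_cases hj : j = 0
      · subst hj; simp [Matrix.single_apply, hX.col]
      · simp [Ne.symm hj]
    have h1 : NormedSpace.exp X * (Matrix.single 0 0 1 : Mat) = Matrix.single 0 0 1 := by
      -- The first basis vector is killed by `X`; as a semiconjugacy between `0` and `X` this passes
      -- to the exponentials.
      have hs : SemiconjBy (Matrix.single 0 0 1 : Mat) 0 X := by
        rw [SemiconjBy, h0, mul_zero]
      let _ : NormedRing Mat := Matrix.linftyOpNormedRing
      let _ : NormedAlgebra ℝ Mat := Matrix.linftyOpNormedAlgebra
      let _ : NormedAlgebra ℚ Mat := NormedAlgebra.restrictScalars ℚ ℝ Mat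
      have := hs.exp_right
      rw [SemiconjBy, NormedSpace.exp_zero, mul_one] at this
      exact this.symm
    have h2 := congrFun₂ h1 i 0
    rw [Matrix.mul_apply] at h2
    simpa [Matrix.single_apply, Matrix.one_apply, eq_comm] using h2

theorem isJacobi_gPlus (v : Coord) : IsJacobi (gPlus v) := by
  have h1 := (isInfJacobi_posMat ![oldCoord v 0, oldCoord v 1, 0, 0, 0, 0]).exp
  have h2 := (isInfJacobi_posMat ![0, 0, oldCoord v 2, oldCoord v 3, oldCoord v 4,
    oldCoord v 5]).exp
  have := h1.mul h2
  rw [← sum_posGen, ← sum_posGen] at this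
  simpa [gPlus, gPlusOld, Fin.sum_univ_six] using this

theorem isJacobi_gPlusInv (v : Coord) : IsJacobi (gPlusInv v) :=
  (isJacobi_gPlus v).mul_inv (gPlusInv_mul v)

theorem isJacobi_kElt (s : Fin 3 → ℝ) : IsJacobi (kElt s) := by
  rw [kElt, sum_cartanGen]; exact (isInfJacobi_cartanMat s).exp

theorem isJacobi_gMinus (u : Fin 6 → ℝ) : IsJacobi (gMinus u) := by
  rw [gMinus, sum_negGen]; exact (isInfJacobi_negMat u).exp

/-! ### The Gauss decomposition -/

/-- Together with `g 3 3` this is a nested pair of principal minors. Both equal one on `G⁺` and are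
multiplied by positive characters under right translation by `K G⁻`. -/
def minorDet (g : Mat) : ℝ := g 3 3 * g 4 4 - g 3 4 * g 4 3

/-- The coordinates of the `G⁺`-component of an element of the cell. -/
def vOf (g : Mat) : Coord :=
  ![-(g 0 3 / g 3 3), -((g 3 3 * g 0 4 - g 0 3 * g 3 4) / minorDet g),
    -(g 1 3 / g 3 3) - g 4 3 / g 3 3 * (g 2 3 / g 3 3),
    -((g 3 3 * g 2 4 - g 2 3 * g 3 4) / minorDet g),
    -2 * (g 2 3 / g 3 3), -2 * (g 4 3 / g 3 3)]

/-- The coordinates of the `K`-component of an element of the cell. -/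
def sOf (g : Mat) : Fin 3 → ℝ :=
  ![-2 * Real.log (g 3 3), -2 * Real.log (minorDet g / g 3 3),
    -(1 / 2) * (g 0 5 + vOf g 0 * g 3 5 + vOf g 1 * (g 4 5 + vOf g 5 / 2 * g 3 5))]

/-- The positivity conditions which single out the cell. -/
def IsPositive (g : Mat) : Prop := 0 < g 3 3 ∧ 0 < minorDet g

/-- Right multiplication is triangular on the columns in the order 0, 3, 4, 5. This makes suitable
ratios of minors invariant. -/
theorem mul_kElt_gMinus_entries {g : Mat} (hg : IsJacobi g) (s : Fin 3 → ℝ) (u : Fin 6 → ℝ)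
    (i : Fin 6) :
    (g * (kElt s * gMinus u)) i 3 = Real.exp (-s 0 / 2) * g i 3 ∧
    (g * (kElt s * gMinus u)) i 4 =
      Real.exp (-s 1 / 2) * g i 4 - u 5 / 2 * (Real.exp (-s 0 / 2) * g i 3) ∧
    (g * (kElt s * gMinus u)) i 5 = g i 5 - 2 * s 2 * (1 : Mat) i 0 +
      (-u 0 + u 1 * u 5 / 4) * (Real.exp (-s 0 / 2) * g i 3)
      - u 1 * (Real.exp (-s 1 / 2) * g i 4) := by
  rw [kElt_eq, gMinus_eq, ← mul_assoc]
  refine ⟨?_, ?_, ?_⟩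
  · simp [Matrix.mul_apply, Fin.sum_univ_six, kMat, gMinusMat]
    ring
  · simp [Matrix.mul_apply, Fin.sum_univ_six, kMat, gMinusMat]
    ring
  · simp [Matrix.mul_apply, Fin.sum_univ_six, kMat, gMinusMat, hg.col]
    ring

theorem minorDet_mul {g : Mat} (hg : IsJacobi g) (s : Fin 3 → ℝ) (u : Fin 6 → ℝ) :
    minorDet (g * (kElt s * gMinus u)) =
      Real.exp (-s 0 / 2) * Real.exp (-s 1 / 2) * minorDet g := by
  have e := mul_kElt_gMinus_entries hg s u
  simp only [minorDet, (e _).1, (e _).2.1]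
  ring

theorem IsPositive.mul {g : Mat} (hg : IsJacobi g) (h : IsPositive g) (s : Fin 3 → ℝ)
    (u : Fin 6 → ℝ) : IsPositive (g * (kElt s * gMinus u)) := by
  refine ⟨?_, ?_⟩
  · rw [(mul_kElt_gMinus_entries hg s u 3).1]
    exact mul_pos (Real.exp_pos _) h.1
  · rw [minorDet_mul hg]
    exact mul_pos (mul_pos (Real.exp_pos _) (Real.exp_pos _)) h.2

theorem vOf_mul {g : Mat} (hg : IsJacobi g) (h : IsPositive g) (s : Fin 3 → ℝ)
    (u : Fin 6 → ℝ) : vOf (g * (kElt s * gMinus u)) = vOf g := by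
  have e := mul_kElt_gMinus_entries hg s u
  have h3 := h.1.ne'
  have hd := h.2.ne'
  have x0 := (Real.exp_pos (-s 0 / 2)).ne'
  have x1 := (Real.exp_pos (-s 1 / 2)).ne'
  simp only [vOf, minorDet_mul hg, (e _).1, (e _).2.1]
  have q : ∀ a b : ℝ, Real.exp (-s 0 / 2) * a / (Real.exp (-s 0 / 2) * b) = a / b :=
    fun a b => mul_div_mul_left _ _ x0
  -- In a minor of columns 3 and 4 the multiple of column 3 added to column 4 cancels, so numerator
  -- and denominator scale alike.
  have q2 : ∀ i : Fin 6, (Real.exp (-s 0 / 2) * g 3 3 *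
      (Real.exp (-s 1 / 2) * g i 4 - u 5 / 2 * (Real.exp (-s 0 / 2) * g i 3)) -
      Real.exp (-s 0 / 2) * g i 3 *
      (Real.exp (-s 1 / 2) * g 3 4 - u 5 / 2 * (Real.exp (-s 0 / 2) * g 3 3))) /
      (Real.exp (-s 0 / 2) * Real.exp (-s 1 / 2) * minorDet g) =
      (g 3 3 * g i 4 - g i 3 * g 3 4) / minorDet g := by
    intro i
    rw [← mul_div_mul_left (g 3 3 * g i 4 - g i 3 * g 3 4) _ (mul_ne_zero x0 x1)]
    congr 1
    ring
  rw [q2, q2]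
  simp only [q]

theorem sOf_mul {g : Mat} (hg : IsJacobi g) (h : IsPositive g) (s : Fin 3 → ℝ)
    (u : Fin 6 → ℝ) : sOf (g * (kElt s * gMinus u)) = sOf g + s := by
  have e := mul_kElt_gMinus_entries hg s u
  have h3 := h.1.ne'
  have hd := h.2.ne'
  have x0 := (Real.exp_pos (-s 0 / 2)).ne'
  have x1 := (Real.exp_pos (-s 1 / 2)).ne'
  funext i
  fin_cases i
  · simp [sOf, (e _).1, Real.log_mul x0 h3]
    ring
  · have : Real.exp (-s 0 / 2) * Real.exp (-s 1 / 2) * minorDet g /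
        (Real.exp (-s 0 / 2) * g 3 3) = Real.exp (-s 1 / 2) * (minorDet g / g 3 3) := by
      field_simp
    simp [sOf, (e _).1, minorDet_mul hg, this, Real.log_mul x1 (div_ne_zero hd h3)]
    ring
  -- The three relations `k0`, `k1`, `k2` are vanishing entries of `gPlusInv (vOf g) * g` at (0,3),
  -- (4,3) and (0,4), up to a factor. They remove the multiples of columns 3 and 4 that `G⁻` adds to
  -- column 5.
  · have k0 : g 0 3 + vOf g 0 * g 3 3 = 0 := by simp [vOf]; field_simp; ring
    have k1 : g 4 3 + vOf g 5 / 2 * g 3 3 = 0 := by simp [vOf]; field_simp; ring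
    have k2 : g 0 4 + vOf g 0 * g 3 4 + vOf g 1 * (g 4 4 + vOf g 5 / 2 * g 3 4) = 0 := by
      have : g 4 4 + vOf g 5 / 2 * g 3 4 = minorDet g / g 3 3 := by
        simp [vOf, minorDet]; field_simp; ring
      rw [this]
      simp [vOf]
      field_simp
      ring
    simp [sOf, (e _).2.2, vOf_mul hg h]
    linear_combination (-1 / 2 * (-u 0 + u 1 * u 5 / 4) * Real.exp (-s 0 / 2)) * k0
      + (-1 / 2 * (-u 0 + u 1 * u 5 / 4) * Real.exp (-s 0 / 2) * vOf g 1) * k1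
      + 1 / 2 * u 1 * Real.exp (-s 1 / 2) * k2

theorem isPositive_gPlus (v : Coord) : IsPositive (gPlus v) := by
  simp [IsPositive, minorDet, gPlus_eq, gPlusMat]

theorem vOf_gPlus (v : Coord) : vOf (gPlus v) = v := by
  funext i
  fin_cases i <;> simp [vOf, minorDet, gPlus_eq, gPlusMat] <;> ring

theorem sOf_gPlus (v : Coord) : sOf (gPlus v) = 0 := by
  funext i
  fin_cases i <;> simp [sOf, vOf_gPlus] <;> simp [minorDet, gPlus_eq, gPlusMat]

/-- The symplectic relations among the columns force every other entry into the shape of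
`gMinusMat`, so few normalisations have to be checked. -/
theorem exists_gMinus {n : Mat} (hn : IsJacobi n) (h3 : ∀ i, n i 3 = (1 : Mat) i 3)
    (h04 : n 0 4 = 0) (h14 : n 1 4 = 0) (h24 : n 2 4 = 0) (h44 : n 4 4 = 1) (h05 : n 0 5 = 0) :
    ∃ u, n = gMinus u := by
  have e := fun i j => (symp_entry n i j).symm.trans (congrFun₂ hn.symp i j)
  have e13 := e 1 3; have e23 := e 2 3; have e35 := e 3 5
  have e14 := e 1 4; have e24 := e 2 4; have e45 := e 4 5
  have e12 := e 1 2; have e15 := e 1 5; have e25 := e 2 5; have e34 := e 3 4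
  simp [JacobiG2.symp, h3, h04, h14, h24, h44, h05, hn.row] at e12 e13 e23 e35 e14 e24 e45 e15 e25
  simp [e13, e23, e35] at e12 e14 e24 e45 e15 e25
  have e22 : n 2 2 = 1 := by linarith
  have e21 : n 2 1 = -n 3 4 := by linarith
  have e25' : n 2 5 = 0 := by linarith
  -- These parameters solve the entries of `gMinusMat` triangularly, starting from `u 5 = 2 * n 2
  -- 1`, `u 1 = n 0 2` and `u 3 = n 4 2`.
  refine ⟨![n 0 1 - n 0 2 * n 2 1 / 2, n 0 2, n 3 1 + n 4 2 * n 2 1 ^ 2 / 6, n 4 2,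
    2 * n 3 2 + n 4 2 * n 2 1, 2 * n 2 1], ?_⟩
  rw [gMinus_eq]
  rw [e22, e21] at e12
  rw [e22, e25'] at e25
  have e45' : n 4 5 = -n 0 2 := by linarith
  rw [e25', e21, e45'] at e15
  ext i j
  fin_cases i <;> fin_cases j <;>
    simp [gMinusMat, hn.col, hn.row, h3, h04, h14, h24, h44, h05, e13, e23, e35, e22, e25', e21] <;>
    linarith

/-- Strip off the `G⁺`- and `K`-factors predicted by the minors; the remainder satisfies the
normalisations of `exists_gMinus`. -/
theorem exists_gauss {g : Mat} (hg : IsJacobi g) (h : IsPositive g) :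
    ∃ u, g = gPlus (vOf g) * kElt (sOf g) * gMinus u := by
  set v := vOf g with hv
  set s := sOf g with hs
  have h3 := h.1.ne'
  have hd := h.2.ne'
  have x0 : Real.exp (s 0 / 2) = (g 3 3)⁻¹ := by
    have : s 0 / 2 = -Real.log (g 3 3) := by simp [hs, sOf]; ring
    rw [this, Real.exp_neg, Real.exp_log h.1]
  have x0' : Real.exp (-s 0 / 2) = g 3 3 := by
    rw [neg_div, Real.exp_neg, x0, inv_inv]
  have hq : 0 < minorDet g / g 3 3 := div_pos h.2 h.1
  have x1 : Real.exp (s 1 / 2) = g 3 3 / minorDet g := by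
    have : s 1 / 2 = -Real.log (minorDet g / g 3 3) := by simp [hs, sOf]; ring
    rw [this, Real.exp_neg, Real.exp_log hq, inv_div]
  have x1' : Real.exp (-s 1 / 2) = minorDet g / g 3 3 := by
    rw [neg_div, Real.exp_neg, x1, inv_div]
  have hk : kElt (-s) * kElt s = 1 := mul_eq_one_comm.mp (kElt_neg_mul s)
  set n := kElt (-s) * (gPlusInv v * g) with hn
  have hg' : g = gPlus v * kElt s * n := by
    rw [hn, mul_assoc, ← mul_assoc (kElt s), kElt_neg_mul, one_mul, ← mul_assoc, mul_gPlusInv,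
      one_mul]
  have hJ : IsJacobi n := (isJacobi_kElt _).mul ((isJacobi_gPlusInv v).mul hg)
  have hv0 : v 0 = -(g 0 3 / g 3 3) := rfl
  have hv1 : v 1 = -((g 3 3 * g 0 4 - g 0 3 * g 3 4) / minorDet g) := rfl
  have hv2 : v 2 = -(g 1 3 / g 3 3) - g 4 3 / g 3 3 * (g 2 3 / g 3 3) := rfl
  have hv3 : v 3 = -((g 3 3 * g 2 4 - g 2 3 * g 3 4) / minorDet g) := rfl
  have hv4 : v 4 = -2 * (g 2 3 / g 3 3) := rfl
  have hv5 : v 5 = -2 * (g 4 3 / g 3 3) := rfl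
  have hs2 : s 2 = -(1 / 2) * (g 0 5 + v 0 * g 3 5 + v 1 * (g 4 5 + v 5 / 2 * g 3 5)) := rfl
  -- With the minor as an atom and `g 4 4` expressed through it, the remaining goals are rational
  -- identities with denominators `g 3 3` and `d`.
  obtain ⟨d, hdet⟩ : ∃ d, d = minorDet g := ⟨_, rfl⟩
  have hdet' : d = g 3 3 * g 4 4 - g 3 4 * g 4 3 := hdet
  have h44 : g 4 4 = (d + g 3 4 * g 4 3) / g 3 3 := by rw [hdet']; field_simp; ring
  have e := fun i j => (symp_entry g i j).symm.trans (congrFun₂ hg.symp i j)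
  have e34 := e 3 4
  simp [JacobiG2.symp, hg.row] at e34
  have n_entries : ∀ j, n 0 j = g 0 j + (v 0 + v 5 * v 1 / 2) * g 3 j + v 1 * g 4 j
        + 2 * s 2 * g 5 j ∧
      n 1 j = g 3 3 * (g 1 j - v 5 / 2 * g 2 j + (v 2 + v 5 * v 4 / 4) * g 3 j + v 4 / 2 * g 4 j
        + v 0 * g 5 j) ∧
      n 2 j = d / g 3 3 * (g 2 j + (v 4 / 2 + v 5 * v 3 / 2) * g 3 j + v 3 * g 4 j
        + v 1 * g 5 j) ∧
      n 3 j = (g 3 3)⁻¹ * g 3 j ∧ n 4 j = g 3 3 / d * (v 5 / 2 * g 3 j + g 4 j) ∧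
      n 5 j = g 5 j := by
    intro j
    rw [hn, kElt_eq]
    simp only [Matrix.mul_apply, Fin.sum_univ_six]
    refine ⟨?_, ?_, ?_, ?_, ?_, ?_⟩ <;>
      simp [kMat, gPlusInv, x0, x0', x1, x1', hdet, -mul_eq_mul_left_iff] <;> ring
  rw [← hdet] at hd hv1 hv3
  suffices ∃ u, n = gMinus u from this.imp fun u hu => by rw [← hu]; exact hg'
  refine exists_gMinus hJ ?_ ?_ ?_ ?_ ?_ ?_
  · intro i
    have := n_entries 3
    have d3 : (d / g 3 3) ≠ 0 := div_ne_zero hd h3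
    fin_cases i <;> simp [this, hg.row, Matrix.one_apply, h3, hd, hv0, hv2, hv4, hv5] <;>
      field_simp <;> ring
  · rw [(n_entries 4).1, hv0, hv1, hv5, h44, hg.row]
    simp
    field_simp
    ring
  · rw [(n_entries 4).2.1, hg.row, hv2, hv4, hv5, h44]
    -- This entry is not covered by the definition of `vOf`; it comes from the isotropy of columns 3
    -- and 4.
    have : g 1 4 = (g 3 4 * g 1 3 + g 4 4 * g 2 3 - g 4 3 * g 2 4) / g 3 3 := by
      field_simp; linarith
    rw [this, h44]
    simp [h3]
    field_simp
    ring
  · rw [(n_entries 4).2.2.1, hg.row, hv3, hv4, hv5, h44]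
    simp [h3, hd]
    field_simp
    ring
  · rw [(n_entries 4).2.2.2.2.1, hv5, h44]
    field_simp
    ring
  · rw [(n_entries 5).1, hg.row, hs2]
    simp
    ring

/-- The cell is open in the stabiliser, so a continuous curve in the stabiliser starting in the cell
remains there for small time. -/
theorem mem_bigCell_iff (g : Mat) : g ∈ bigCell ↔ IsJacobi g ∧ IsPositive g := by
  constructor
  · rintro ⟨v, s, u, rfl⟩
    rw [mul_assoc]
    exact ⟨(isJacobi_gPlus v).mul ((isJacobi_kElt s).mul (isJacobi_gMinus u)),
      (isPositive_gPlus v).mul (isJacobi_gPlus v) s u⟩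
  · rintro ⟨h1, h2⟩
    obtain ⟨u, hu⟩ := exists_gauss h1 h2
    exact ⟨_, _, u, hu⟩

theorem mul_mem_bigCell {g : Mat} (hg : g ∈ bigCell) (s : Fin 3 → ℝ) (u : Fin 6 → ℝ) :
    g * (kElt s * gMinus u) ∈ bigCell := by
  rw [mem_bigCell_iff] at hg ⊢
  exact ⟨hg.1.mul ((isJacobi_kElt s).mul (isJacobi_gMinus u)), hg.2.mul hg.1 s u⟩

theorem gPlus_mem_bigCell (v : Coord) : gPlus v ∈ bigCell :=
  (mem_bigCell_iff _).mpr ⟨isJacobi_gPlus v, isPositive_gPlus v⟩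

/-! ### Right covariant functions and functions on `G⁺` -/

theorem Weight.char_add (Λ : Weight) (s s' : Fin 3 → ℝ) :
    Λ.char (s + s') = Λ.char s * Λ.char s' := by
  rw [Weight.char, Weight.char, Weight.char, ← Complex.exp_add]
  congr 1
  simp
  ring

/-- Covariance in Gauss coordinates. Bijectivity of restriction and all derivative computations rest
on this formula. -/
theorem CovFun.apply_of_mem {Λ : Weight} (F : CovFun Λ) {g : Mat} (hg : g ∈ bigCell) :
    (F : Mat → ℂ) g = Λ.char (sOf g) * (restrict Λ F : Coord → ℂ) (vOf g) := by
  obtain ⟨u, hu⟩ := exists_gauss ((mem_bigCell_iff g).mp hg).1 ((mem_bigCell_iff g).mp hg).2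
  have := F.2.2.1 _ (gPlus_mem_bigCell (vOf g)) (sOf g) u
  rw [← mul_assoc, ← hu] at this
  exact this

open Classical in
/-- The extension of a smooth function on `G⁺` to a right covariant function on the cell. -/
def extendFun (Λ : Weight) (f : SmoothFun) : CovFun Λ :=
  ⟨fun g => if g ∈ bigCell then Λ.char (sOf g) * (f : Coord → ℂ) (vOf g) else 0, by
    refine ⟨?_, ?_, fun g hg => if_neg hg⟩
    · have hf : ContDiff ℝ ∞ (f : Coord → ℂ) := f.2
      have : (fun p : Coord × (Fin 3 → ℝ) × (Fin 6 → ℝ) =>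
          if gPlus p.1 * kElt p.2.1 * gMinus p.2.2 ∈ bigCell then
            Λ.char (sOf (gPlus p.1 * kElt p.2.1 * gMinus p.2.2)) *
              (f : Coord → ℂ) (vOf (gPlus p.1 * kElt p.2.1 * gMinus p.2.2)) else 0) =
          fun p => Λ.char p.2.1 * (f : Coord → ℂ) p.1 := by
        funext p
        rw [mul_assoc, if_pos (mul_mem_bigCell (gPlus_mem_bigCell _) _ _),
          vOf_mul (isJacobi_gPlus _) (isPositive_gPlus _),
          sOf_mul (isJacobi_gPlus _) (isPositive_gPlus _), vOf_gPlus, sOf_gPlus, zero_add]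
      rw [this]
      refine ContDiff.mul ?_ (hf.comp contDiff_fst)
      have hc : ∀ i, ContDiff ℝ ∞ (fun p : Coord × (Fin 3 → ℝ) × (Fin 6 → ℝ) =>
          ((p.2.1 i : ℝ) : ℂ)) := fun i =>
        Complex.ofRealCLM.contDiff.comp
          ((contDiff_apply ℝ ℝ i).comp (contDiff_fst.comp contDiff_snd))
      exact (((contDiff_const.mul (hc 0)).add (contDiff_const.mul (hc 1))).add
        (contDiff_const.mul (hc 2))).cexp
    · intro g hg s u
      have h := (mem_bigCell_iff g).mp hg
      simp only [if_pos hg, if_pos (mul_mem_bigCell hg s u), vOf_mul h.1 h.2, sOf_mul h.1 h.2,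
        Weight.char_add]
      ring⟩

open Classical in
theorem restrict_extendFun (Λ : Weight) (f : SmoothFun) : restrict Λ (extendFun Λ f) = f := by
  apply Subtype.ext
  funext v
  show (if gPlus v ∈ bigCell then _ else _) = _
  rw [if_pos (gPlus_mem_bigCell v), sOf_gPlus, vOf_gPlus]
  simp [Weight.char]

theorem restrict_injective (Λ : Weight) : Function.Injective (restrict Λ) := by
  intro F F' h
  apply Subtype.ext
  funext g
  by_cases hg : g ∈ bigCell
  · rw [CovFun.apply_of_mem F hg, CovFun.apply_of_mem F' hg, h]
  · rw [F.2.2.2 g hg, F'.2.2.2 g hg]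

theorem restrict_bijective (Λ : Weight) : Function.Bijective (restrict Λ) :=
  ⟨restrict_injective Λ, fun f => ⟨_, restrict_extendFun Λ f⟩⟩

/-! ### Coordinates on the Jacobi algebra -/

def posC : Mat →ₗ[ℝ] (Fin 6 → ℝ) where
  toFun X := ![-X 0 3, -X 0 4, -X 1 3, -X 2 4, -2 * X 1 4, 2 * X 1 2]
  map_add' X Y := by funext i; fin_cases i <;> simp <;> ring
  map_smul' c X := by funext i; fin_cases i <;> simp <;> ring

def cartC : Mat →ₗ[ℝ] (Fin 3 → ℝ) where
  toFun X := ![2 * X 1 1, 2 * X 2 2, -(X 0 5) / 2]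
  map_add' X Y := by funext i; fin_cases i <;> simp <;> ring
  map_smul' c X := by funext i; fin_cases i <;> simp <;> ring

theorem posC_eq (y : Fin 6 → ℝ) (s : Fin 3 → ℝ) (u : Fin 6 → ℝ) :
    posC (posMat y + cartanMat s + negMat u) = y := by
  funext i; fin_cases i <;> simp [posC, posMat, cartanMat, negMat] <;> ring

theorem cartC_eq (y : Fin 6 → ℝ) (s : Fin 3 → ℝ) (u : Fin 6 → ℝ) :
    cartC (posMat y + cartanMat s + negMat u) = s := by
  funext i; fin_cases i <;> simp [cartC, posMat, cartanMat, negMat] <;> ring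

/-! ### The right action -/

/-- The right actions of the basis of `𝒢₂⁺`. -/
def rightOp : Fin 6 → Op := ![dξ₁, dξ₂, dη₁, dη₂, dζ, opD]

/-- The left invariant vector field belonging to an element of `𝒢₂⁺`. -/
def flow (v y : Coord) : Coord :=
  ![y 0 - v 1 / 2 * y 5, y 1, y 2 - v 4 / 2 * y 5, y 3, y 4 - v 3 * y 5, y 5]

theorem pd_apply (i : Fin 6) (f : SmoothFun) (v : Coord) :
    (pd i f : Coord → ℂ) v = fderiv ℝ (f : Coord → ℂ) v (Pi.single i 1) := rfl

theorem mulCoord_apply (i : Fin 6) (f : SmoothFun) (v : Coord) :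
    (mulCoord i f : Coord → ℂ) v = v i * (f : Coord → ℂ) v := rfl

theorem opD_apply (f : SmoothFun) (v : Coord) : (opD f : Coord → ℂ) v =
    (pd 5 f : Coord → ℂ) v - (1 / 2 : ℂ) * (v 1 * (pd 0 f : Coord → ℂ) v)
      - (1 / 2 : ℂ) * (v 4 * (pd 2 f : Coord → ℂ) v) - v 3 * (pd 4 f : Coord → ℂ) v := rfl

theorem fderiv_flow (f : SmoothFun) (v y : Coord) :
    fderiv ℝ (f : Coord → ℂ) v (flow v y) = ∑ i, (y i : ℂ) * (rightOp i f : Coord → ℂ) v := by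
  have h : flow v y = ∑ i, flow v y i • (Pi.single i (1 : ℝ) : Coord) := by
    funext j
    simp [Finset.sum_apply, Pi.single_apply]
  rw [h, map_sum]
  simp only [map_smul, Fin.sum_univ_six]
  simp [rightOp, opD_apply, dξ₁, dξ₂, dη₁, dη₂, dζ, pd_apply, flow]
  ring

/-- `vOf` is invariant under right translation by `K G⁻`, so only the `𝒢₂⁺`-part of the velocity
survives. Only entrywise derivatives at zero enter. -/
theorem hasDerivAt_vOf {M : ℝ → Mat} {v : Coord} {Y : Mat} (h0 : M 0 = gPlus v)
    (hM : ∀ i j, HasDerivAt (fun t => M t i j) ((gPlus v * Y) i j) 0) (hY : IsInfJacobi Y) :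
    HasDerivAt (fun t => vOf (M t)) (flow v (posC Y)) 0 := by
  obtain ⟨y, s, u, rfl⟩ := (isInfJacobi_iff Y).mp hY
  rw [posC_eq]
  have e33 : M 0 3 3 = 1 := by rw [h0, gPlus_eq]; simp [gPlusMat]
  have eD : minorDet (M 0) = 1 := by rw [h0, gPlus_eq]; simp [minorDet, gPlusMat]
  have eD' : minorDet (gPlusMat v) = 1 := by rw [← gPlus_eq, ← h0, eD]
  have n33 : M 0 3 3 ≠ 0 := by rw [e33]; exact one_ne_zero
  have nD : minorDet (M 0) ≠ 0 := by rw [eD]; exact one_ne_zero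
  have hD : HasDerivAt (fun t => minorDet (M t)) _ 0 :=
    ((hM 3 3).mul (hM 4 4)).sub ((hM 3 4).mul (hM 4 3))
  have d03 := (hM 0 3).div (hM 3 3) n33
  have d13 := (hM 1 3).div (hM 3 3) n33
  have d23 := (hM 2 3).div (hM 3 3) n33
  have d43 := (hM 4 3).div (hM 3 3) n33
  have d04 := (((hM 3 3).mul (hM 0 4)).sub ((hM 0 3).mul (hM 3 4))).div hD nD
  have d24 := (((hM 3 3).mul (hM 2 4)).sub ((hM 2 3).mul (hM 3 4))).div hD nD
  rw [hasDerivAt_pi]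
  have key : ∀ {f g : ℝ → ℝ} {a b : ℝ}, HasDerivAt f a 0 → f = g → a = b → HasDerivAt g b 0 := by
    rintro f g a b h rfl rfl; exact h
  intro i
  fin_cases i
  · refine key d03.neg (by funext t; simp [vOf]) ?_
    rw [h0, gPlus_eq]
    simp [Matrix.mul_apply, Fin.sum_univ_six, gPlusMat, posMat, cartanMat, negMat, flow]
    ring
  · refine key d04.neg (by funext t; simp [vOf]) ?_
    simp only [Pi.mul_apply, Pi.sub_apply, h0, gPlus_eq, eD']
    simp [Matrix.mul_apply, Fin.sum_univ_six, gPlusMat, posMat, cartanMat, negMat, flow]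
    ring
  · refine key (d13.neg.sub (d43.mul d23)) (by funext t; simp [vOf]) ?_
    simp only [Pi.div_apply, h0, gPlus_eq]
    simp [Matrix.mul_apply, Fin.sum_univ_six, gPlusMat, posMat, cartanMat, negMat, flow]
    ring
  · refine key d24.neg (by funext t; simp [vOf]) ?_
    simp only [Pi.mul_apply, Pi.sub_apply, h0, gPlus_eq, eD']
    simp [Matrix.mul_apply, Fin.sum_univ_six, gPlusMat, posMat, cartanMat, negMat, flow]
    ring
  · refine key (d23.const_mul (-2)) (by funext t; simp [vOf]) ?_
    rw [h0, gPlus_eq]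
    simp [Matrix.mul_apply, Fin.sum_univ_six, gPlusMat, posMat, cartanMat, negMat, flow]
    ring
  · refine key (d43.const_mul (-2)) (by funext t; simp [vOf]) ?_
    rw [h0, gPlus_eq]
    simp [Matrix.mul_apply, Fin.sum_univ_six, gPlusMat, posMat, cartanMat, negMat, flow]
    ring

/-- `sOf` is zero along `G⁺`, unaffected by `G⁻`, and additive under `K`. -/
theorem hasDerivAt_sOf {M : ℝ → Mat} {v : Coord} {Y : Mat} (h0 : M 0 = gPlus v)
    (hM : ∀ i j, HasDerivAt (fun t => M t i j) ((gPlus v * Y) i j) 0) (hY : IsInfJacobi Y) :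
    HasDerivAt (fun t => sOf (M t)) (cartC Y) 0 := by
  have hv := hasDerivAt_vOf h0 hM hY
  rw [hasDerivAt_pi] at hv
  obtain ⟨y, s, u, rfl⟩ := (isInfJacobi_iff Y).mp hY
  rw [posC_eq] at hv
  rw [cartC_eq]
  have e33 : M 0 3 3 = 1 := by rw [h0, gPlus_eq]; simp [gPlusMat]
  have eD : minorDet (M 0) = 1 := by rw [h0, gPlus_eq]; simp [minorDet, gPlusMat]
  have eD' : minorDet (gPlusMat v) = 1 := by rw [← gPlus_eq, ← h0, eD]
  have n33 : M 0 3 3 ≠ 0 := by rw [e33]; exact one_ne_zero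
  have hD : HasDerivAt (fun t => minorDet (M t)) _ 0 :=
    ((hM 3 3).mul (hM 4 4)).sub ((hM 3 4).mul (hM 4 3))
  have hq := hD.div (hM 3 3) n33
  have nq : (minorDet (M 0)) / M 0 3 3 ≠ 0 := by rw [eD, e33]; norm_num
  rw [hasDerivAt_pi]
  have key : ∀ {f g : ℝ → ℝ} {a b : ℝ}, HasDerivAt f a 0 → f = g → a = b → HasDerivAt g b 0 := by
    rintro f g a b h rfl rfl; exact h
  intro i
  fin_cases i
  · refine key (((hM 3 3).log n33).const_mul (-2)) (by funext t; simp [sOf]) ?_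
    rw [h0, gPlus_eq]
    simp [Matrix.mul_apply, Fin.sum_univ_six, gPlusMat, posMat, cartanMat, negMat]
    ring
  · refine key ((hq.log nq).const_mul (-2)) (by funext t; simp [sOf]) ?_
    simp only [Pi.div_apply, h0, gPlus_eq, eD']
    simp [Matrix.mul_apply, Fin.sum_univ_six, gPlusMat, posMat, cartanMat, negMat]
    ring
  · refine key ((((hM 0 5).add ((hv 0).mul (hM 3 5))).add
      ((hv 1).mul ((hM 4 5).add (((hv 5).div_const 2).mul (hM 3 5))))).const_mul (-(1 / 2)))
      (by funext t; simp [sOf]) ?_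
    have v0' : vOf (gPlusMat v) = v := by rw [← gPlus_eq, vOf_gPlus]
    simp only [Pi.mul_apply, Pi.add_apply, h0, gPlus_eq, v0']
    simp [Matrix.mul_apply, Fin.sum_univ_six, gPlusMat, posMat, cartanMat, negMat, flow]
    ring

/-- The value of a weight on the `K`-component of an element of the Jacobi algebra. -/
def Weight.val (Λ : Weight) : Mat →ₗ[ℝ] ℂ where
  toFun X := Λ.h₁ * (cartC X 0 : ℂ) + Λ.h₂ * (cartC X 1 : ℂ) + Λ.hat * (cartC X 2 : ℂ)
  map_add' X Y := by simp; ring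
  map_smul' c X := by simp; ring

/-- The action of an element of the Jacobi algebra on the jet of a right covariant function. -/
def jet (Λ : Weight) (Y : Mat) (f : SmoothFun) (v : Coord) : ℂ :=
  ∑ i, (posC Y i : ℂ) * (rightOp i f : Coord → ℂ) v + Λ.val Y * (f : Coord → ℂ) v

theorem eventually_mem_bigCell {M : ℝ → Mat} (hJ : ∀ t, IsJacobi (M t))
    (hM : ∀ i j, ContinuousAt (fun t => M t i j) 0) (h0 : IsPositive (M 0)) :
    ∀ᶠ t in nhds 0, M t ∈ bigCell := by
  have h1 : ∀ᶠ t in nhds 0, 0 < M t 3 3 := (hM 3 3).eventually_const_lt h0.1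
  have hD : ContinuousAt (fun t => minorDet (M t)) 0 :=
    ((hM 3 3).mul (hM 4 4)).sub ((hM 3 4).mul (hM 4 3))
  have h2 : ∀ᶠ t in nhds 0, 0 < minorDet (M t) := hD.eventually_const_lt h0.2
  filter_upwards [h1, h2] with t ht1 ht2
  exact (mem_bigCell_iff _).mpr ⟨hJ t, ht1, ht2⟩

/-- The chain rule in Gauss coordinates, for general curves: `g exp(tX)` gives the right action and
`exp(-tX) g` the left one. -/
theorem CovFun.hasDerivAt {Λ : Weight} (F : CovFun Λ) {M : ℝ → Mat} {v : Coord} {Y : Mat}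
    (hJ : ∀ t, IsJacobi (M t)) (h0 : M 0 = gPlus v)
    (hM : ∀ i j, HasDerivAt (fun t => M t i j) ((gPlus v * Y) i j) 0) (hY : IsInfJacobi Y) :
    HasDerivAt (fun t => (F : Mat → ℂ) (M t)) (jet Λ Y (restrict Λ F) v) 0 := by
  -- The product formula for `F` holds only on the cell, so the curve must first be confined to it.
  have hc := eventually_mem_bigCell hJ (fun i j => (hM i j).continuousAt)
    (h0 ▸ isPositive_gPlus v)
  have hv := hasDerivAt_vOf h0 hM hY
  have hs := hasDerivAt_pi.mp (hasDerivAt_sOf h0 hM hY)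
  set f := restrict Λ F
  have hf : ContDiff ℝ ∞ (f : Coord → ℂ) := f.2
  have v0 : vOf (M 0) = v := by rw [h0, vOf_gPlus]
  have s0 : sOf (M 0) = 0 := by rw [h0, sOf_gPlus]
  have hfd : HasFDerivAt (f : Coord → ℂ) (fderiv ℝ (f : Coord → ℂ) v) (vOf (M 0)) := by
    rw [v0]; exact (hf.differentiable (by simp) v).hasFDerivAt
  have d1 := hfd.comp_hasDerivAt (0 : ℝ) hv
  have hsc : ∀ i, HasDerivAt (fun t => ((sOf (M t) i : ℝ) : ℂ)) ((cartC Y i : ℝ) : ℂ) 0 :=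
    fun i => (hs i).ofReal_comp
  have d2 : HasDerivAt (fun t => Λ.char (sOf (M t))) _ 0 :=
    ((((hsc 0).const_mul Λ.h₁).add ((hsc 1).const_mul Λ.h₂)).add ((hsc 2).const_mul Λ.hat)).cexp
  have d3 := (d2.mul d1).congr_of_eventuallyEq
    (f₁ := fun t => (F : Mat → ℂ) (M t)) (by
      filter_upwards [hc] with t ht
      rw [CovFun.apply_of_mem F ht]; rfl)
  refine d3.congr_deriv ?_
  rw [fderiv_flow]
  simp [v0, s0, jet, Weight.char, Weight.val]
  ring

theorem hasDerivAt_exp_entry (X : Mat) (i j : Fin 6) :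
    HasDerivAt (fun t : ℝ => NormedSpace.exp (t • X) i j) (X i j) 0 := by
  let _ : NormedRing Mat := Matrix.linftyOpNormedRing
  let _ : NormedAlgebra ℝ Mat := Matrix.linftyOpNormedAlgebra
  have h := hasDerivAt_exp_smul_const (𝕂 := ℝ) X (0 : ℝ)
  rw [zero_smul, NormedSpace.exp_zero, one_mul] at h
  have := hasDerivAt_pi.mp (hasDerivAt_pi.mp h i) j
  exact this

theorem isRightAction_rightOp (i : Fin 6) : IsRightAction (posGen i) (rightOp i) := by
  intro Λ F v
  have e : posGen i = posMat (Pi.single i 1) := by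
    rw [← sum_posGen]; simp [Pi.single_apply]
  have hX : ∀ t : ℝ, IsInfJacobi (t • posGen i) := fun t => by
    have : t • posGen i = posMat (Pi.single i t) := by
      rw [← sum_posGen]; simp [Pi.single_apply]
    rw [this]; exact isInfJacobi_posMat _
  have h := CovFun.hasDerivAt F (M := fun t => gPlus v * NormedSpace.exp (t • posGen i)) (v := v)
    (Y := posGen i) (fun t => (isJacobi_gPlus v).mul (hX t).exp) (by simp) (fun a b => by
      simp only [Matrix.mul_apply]
      exact HasDerivAt.fun_sum fun k _ => (hasDerivAt_exp_entry _ k b).const_mul _)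
    (e ▸ isInfJacobi_posMat _)
  refine h.congr_deriv ?_
  have hp : posC (posGen i) = Pi.single i 1 := by
    rw [e]
    have := posC_eq (Pi.single i 1) 0 0
    rwa [← sum_cartanGen, ← sum_negGen, show (∑ j, (0 : Fin 3 → ℝ) j • cartanGen j) = 0 by simp,
      show (∑ j, (0 : Fin 6 → ℝ) j • negGen j) = 0 by simp, add_zero, add_zero] at this
  have hq : cartC (posGen i) = 0 := by
    rw [e]
    have := cartC_eq (Pi.single i 1) 0 0
    rwa [← sum_cartanGen, ← sum_negGen, show (∑ j, (0 : Fin 3 → ℝ) j • cartanGen j) = 0 by simp,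
      show (∑ j, (0 : Fin 6 → ℝ) j • negGen j) = 0 by simp, add_zero, add_zero] at this
  rw [jet, hp, Finset.sum_eq_single i (fun j _ hj => by simp [Pi.single_eq_of_ne hj]) (by simp)]
  simp [Weight.val, hq]

/-! ### The left action -/

theorem jet_add (Λ : Weight) (X Y : Mat) (f : SmoothFun) (v : Coord) :
    jet Λ (X + Y) f v = jet Λ X f v + jet Λ Y f v := by
  simp only [jet, map_add, Pi.add_apply, Complex.ofReal_add, add_mul, Finset.sum_add_distrib]
  ring

theorem jet_smul (Λ : Weight) (c : ℝ) (X : Mat) (f : SmoothFun) (v : Coord) :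
    jet Λ (c • X) f v = c * jet Λ X f v := by
  simp only [jet, map_smul, Pi.smul_apply, smul_eq_mul, Complex.ofReal_mul, mul_add,
    Finset.mul_sum, mul_assoc, Complex.real_smul]

theorem jet_neg (Λ : Weight) (X : Mat) (f : SmoothFun) (v : Coord) :
    jet Λ (-X) f v = -jet Λ X f v := by
  simpa using jet_smul Λ (-1) X f v

/-- The adjoint action of `g⁻¹` for `g ∈ G⁺`. -/
def adj (v : Coord) : Mat →ₗ[ℝ] Mat where
  toFun X := gPlusInv v * X * gPlus v
  map_add' X Y := by rw [mul_add, add_mul]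
  map_smul' c X := by simp

theorem adj_apply (v : Coord) (X : Mat) : adj v X = gPlusInv v * X * gPlus v := rfl

theorem adj_lie (v : Coord) (X Y : Mat) : adj v ⁅X, Y⁆ = ⁅adj v X, adj v Y⁆ := by
  have h : ∀ X Y : Mat, adj v X * adj v Y = adj v (X * Y) := fun X Y => by
    calc gPlusInv v * X * gPlus v * (gPlusInv v * Y * gPlus v)
        = gPlusInv v * X * (gPlus v * gPlusInv v) * Y * gPlus v := by simp only [mul_assoc]
      _ = gPlusInv v * (X * Y) * gPlus v := by rw [mul_gPlusInv, mul_one]; simp only [mul_assoc]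
  rw [Ring.lie_def, Ring.lie_def, map_sub, h, h]

theorem IsInfJacobi.adj {X : Mat} (hX : IsInfJacobi X) (v : Coord) : IsInfJacobi (adj v X) :=
  hX.conj (isJacobi_gPlus v) (gPlusInv_mul v)

theorem contDiff_gPlus (i j : Fin 6) : ContDiff ℝ ∞ (fun v : Coord => gPlus v i j) := by
  simp only [gPlus_eq]
  fin_cases i <;> fin_cases j <;> simp [gPlusMat] <;> fun_prop

theorem contDiff_gPlusInv (i j : Fin 6) : ContDiff ℝ ∞ (fun v : Coord => gPlusInv v i j) := by
  fin_cases i <;> fin_cases j <;> simp [gPlusInv] <;> fun_prop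

theorem contDiff_adj (X : Mat) (i j : Fin 6) : ContDiff ℝ ∞ (fun v : Coord => adj v X i j) := by
  simp only [adj_apply, Matrix.mul_apply]
  exact ContDiff.sum fun k _ => (ContDiff.sum fun l _ =>
    (contDiff_gPlusInv i l).mul contDiff_const).mul (contDiff_gPlus k j)

theorem contDiff_posC_adj (X : Mat) (i : Fin 6) :
    ContDiff ℝ ∞ (fun v : Coord => posC (adj v X) i) := by
  have h := contDiff_adj X
  fin_cases i
  exacts [(h 0 3).neg, (h 0 4).neg, (h 1 3).neg, (h 2 4).neg, contDiff_const.mul (h 1 4),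
    contDiff_const.mul (h 1 2)]

theorem contDiff_cartC_adj (X : Mat) (i : Fin 3) :
    ContDiff ℝ ∞ (fun v : Coord => cartC (adj v X) i) := by
  have h := contDiff_adj X
  fin_cases i
  exacts [contDiff_const.mul (h 1 1), contDiff_const.mul (h 2 2), (h 0 5).neg.div_const 2]

theorem contDiff_val_adj (Λ : Weight) (X : Mat) :
    ContDiff ℝ ∞ (fun v : Coord => Λ.val (adj v X)) := by
  have h := fun i => Complex.ofRealCLM.contDiff.comp (contDiff_cartC_adj X i)
  exact ((contDiff_const.mul (h 0)).add (contDiff_const.mul (h 1))).add (contDiff_const.mul (h 2))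

theorem contDiff_jet_adj (Λ : Weight) (X : Mat) (f : SmoothFun) :
    ContDiff ℝ ∞ (fun v : Coord => jet Λ (adj v X) f v) :=
  (ContDiff.sum fun i _ => (Complex.ofRealCLM.contDiff.comp (contDiff_posC_adj X i)).mul
    (rightOp i f).2).add ((contDiff_val_adj Λ X).mul f.2)

/-- The left action of an element of the Jacobi algebra in the coordinates of `G⁺`. -/
def leftOp (Λ : Weight) : Mat →ₗ[ℝ] Op where
  toFun X :=
    { toFun := fun f => ⟨fun v => -jet Λ (adj v X) f v, (contDiff_jet_adj Λ X f).neg⟩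
      map_add' := fun f g => by
        apply Subtype.ext
        funext v
        simp [jet, mul_add, Finset.sum_add_distrib]
        ring
      map_smul' := fun c f => by
        apply Subtype.ext
        funext v
        simp [jet, mul_add, Finset.mul_sum, mul_left_comm] }
  map_add' X Y := by
    ext f v
    simp [jet_add]
    ring
  map_smul' c X := by
    ext f v
    simp [jet_smul]

theorem leftOp_apply (Λ : Weight) (X : Mat) (f : SmoothFun) (v : Coord) :
    (leftOp Λ X f : Coord → ℂ) v = -jet Λ (adj v X) f v := rfl

/-- Restriction to `G⁺` as an isomorphism. -/
def restrictEquiv (Λ : Weight) : CovFun Λ ≃ₗ[ℂ] SmoothFun :=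
  LinearEquiv.ofBijective (restrict Λ) (restrict_bijective Λ)

theorem restrictEquiv_apply (Λ : Weight) (F : CovFun Λ) : restrictEquiv Λ F = restrict Λ F := rfl

/-- The left action on `𝒞_Λ`. -/
def leftRep (Λ : Weight) : jacobiAlgebra →ₗ[ℝ] Module.End ℂ (CovFun Λ) where
  toFun X := (restrictEquiv Λ).symm.toLinearMap ∘ₗ leftOp Λ X ∘ₗ (restrictEquiv Λ).toLinearMap
  map_add' X Y := by ext1 F; simp
  map_smul' c X := by
    ext1 F
    simp only [Submodule.coe_smul, map_smul, LinearMap.comp_apply, RingHom.id_apply,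
      LinearMap.smul_apply, LinearEquiv.coe_coe]
    rw [← Complex.coe_smul, ← Complex.coe_smul, map_smul]

theorem restrict_leftRep (Λ : Weight) (X : jacobiAlgebra) (F : CovFun Λ) :
    restrict Λ (leftRep Λ X F) = leftOp Λ X (restrict Λ F) := by
  rw [← restrictEquiv_apply]
  exact (restrictEquiv Λ).apply_symm_apply _

/-- At points of `G⁺` the velocity `-X g` is rewritten as `g Ad(g⁻¹)(-X)`. Covariance carries the
result to the whole cell. -/
theorem isLeftAction_leftRep (Λ : Weight) : IsLeftAction Λ (leftRep Λ) := by
  rintro ⟨X, hX⟩ F g ⟨v, s, u, rfl⟩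
  rw [mem_jacobiAlgebra_iff] at hX
  have hX' : ∀ t : ℝ, IsInfJacobi (t • -X) := fun t => by
    rw [← mem_jacobiAlgebra_iff] at hX ⊢
    exact Submodule.smul_mem _ _ (Submodule.neg_mem _ hX)
  have e : gPlus v * adj v (-X) = -X * gPlus v := by
    rw [adj_apply, mul_assoc, ← mul_assoc, mul_gPlusInv, one_mul]
  have hJ : ∀ t : ℝ, IsJacobi (NormedSpace.exp (t • -X) * gPlus v) :=
    fun t => (hX' t).exp.mul (isJacobi_gPlus v)
  have hM : ∀ i j, HasDerivAt (fun t : ℝ => (NormedSpace.exp (t • -X) * gPlus v) i j)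
      ((gPlus v * adj v (-X)) i j) 0 := fun i j => by
    rw [e]
    simp only [Matrix.mul_apply]
    exact HasDerivAt.fun_sum fun k _ => (hasDerivAt_exp_entry _ i k).mul_const _
  have h0 : NormedSpace.exp ((0 : ℝ) • -X) * gPlus v = gPlus v := by simp
  have h := (CovFun.hasDerivAt F hJ h0 hM
    (by have := (hX' 1).adj v; rwa [one_smul] at this)).const_mul (Λ.char s)
  have hc := eventually_mem_bigCell hJ (fun i j => (hM i j).continuousAt)
    (by rw [h0]; exact isPositive_gPlus v)
  refine (h.congr_of_eventuallyEq ?_).congr_deriv ?_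
  · filter_upwards [hc] with t ht
    have := F.2.2.1 _ ht s u
    rw [← this]
    simp only [smul_neg, mul_assoc]
  · have h1 := (leftRep Λ ⟨X, (mem_jacobiAlgebra_iff X).mpr hX⟩ F).2.2.1 _ (gPlus_mem_bigCell v) s u
    rw [← mul_assoc] at h1
    rw [h1]
    have h2 := congrArg (fun f : SmoothFun => (f : Coord → ℂ) v)
      (restrict_leftRep Λ ⟨X, (mem_jacobiAlgebra_iff X).mpr hX⟩ F)
    change (leftRep Λ ⟨X, (mem_jacobiAlgebra_iff X).mpr hX⟩ F : Mat → ℂ) (gPlus v) = _ at h2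
    rw [h2, leftOp_apply, map_neg, jet_neg]

/-! ### Commutators -/

theorem hasDerivAt_quadratic (a b c : ℝ) :
    HasDerivAt (fun t : ℝ => a + t * b + t ^ 2 * c) b 0 := by
  have h := (((hasDerivAt_id (0 : ℝ)).mul_const b).const_add a).add
    (((hasDerivAt_id (0 : ℝ)).pow 2).mul_const c)
  refine (h.congr_deriv ?_)
  simp

/-- The straight line need not be a translated one-parameter subgroup, but it is tangent to one at
time zero; the explicit `t ^ 2` matrix is the whole remainder. -/
theorem hasDerivAt_gPlus (v y : Coord) (i j : Fin 6) :
    HasDerivAt (fun t : ℝ => gPlus (v + t • flow v y) i j) ((gPlus v * posMat y) i j) 0 := by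
  have h : ∀ t : ℝ, gPlus (v + t • flow v y) i j = gPlus v i j + t * (gPlus v * posMat y) i j +
      t ^ 2 * (!![0, 0, 0, 0, 0, 0;
        0, 0, 0, -y 5 * flow v y 4 / 4, -y 5 * y 3 / 2, -y 5 * y 1 / 2;
        0, 0, 0, 0, 0, 0; 0, 0, 0, 0, 0, 0; 0, 0, 0, 0, 0, 0; 0, 0, 0, 0, 0, 0] : Mat) i j := by
    intro t
    rw [gPlus_eq, gPlus_eq, Matrix.mul_apply, Fin.sum_univ_six]
    fin_cases i <;> fin_cases j <;> simp [gPlusMat, posMat, flow] <;> ring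
  simp only [h]
  exact hasDerivAt_quadratic _ _ _

theorem hasDerivAt_gPlusInv (v y : Coord) (i j : Fin 6) :
    HasDerivAt (fun t : ℝ => gPlusInv (v + t • flow v y) i j) (-(posMat y * gPlusInv v) i j) 0 := by
  have h : ∀ t : ℝ, gPlusInv (v + t • flow v y) i j =
      gPlusInv v i j + t * -(posMat y * gPlusInv v) i j +
      t ^ 2 * (!![0, 0, 0, y 5 * y 1 / 2, 0, 0; 0, 0, 0, y 5 * flow v y 4 / 4, 0, 0;
        0, 0, 0, y 5 * y 3 / 2, 0, 0;
        0, 0, 0, 0, 0, 0; 0, 0, 0, 0, 0, 0; 0, 0, 0, 0, 0, 0] : Mat) i j := by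
    intro t
    rw [Matrix.mul_apply, Fin.sum_univ_six]
    fin_cases i <;> fin_cases j <;> simp [gPlusInv, posMat, flow, -mul_eq_mul_left_iff] <;> ring
  simp only [h]
  exact hasDerivAt_quadratic _ _ _

theorem hasDerivAt_adj (X : Mat) (v y : Coord) (i j : Fin 6) :
    HasDerivAt (fun t : ℝ => adj (v + t • flow v y) X i j) (⁅adj v X, posMat y⁆ i j) 0 := by
  have h : HasDerivAt (fun t : ℝ => ∑ k, (∑ l, gPlusInv (v + t • flow v y) i l * X l k) *
      gPlus (v + t • flow v y) k j) _ 0 :=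
    HasDerivAt.fun_sum fun k _ => (HasDerivAt.fun_sum fun l _ =>
      (hasDerivAt_gPlusInv v y i l).mul_const (X l k)).mul (hasDerivAt_gPlus v y k j)
  simp only [adj_apply, Matrix.mul_apply]
  refine h.congr_deriv ?_
  have e : ⁅adj v X, posMat y⁆ = -(posMat y * gPlusInv v) * X * gPlus v +
      gPlusInv v * X * (gPlus v * posMat y) := by
    rw [Ring.lie_def, adj_apply]
    noncomm_ring
  simp only [adj_apply] at e
  rw [e]
  simp only [zero_smul, add_zero, Finset.sum_add_distrib, Matrix.add_apply, Matrix.mul_apply,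
    Matrix.neg_apply]

theorem hasDerivAt_posC {A : ℝ → Mat} {B : Mat} (h : ∀ i j, HasDerivAt (fun t => A t i j) (B i j) 0)
    (i : Fin 6) : HasDerivAt (fun t => posC (A t) i) (posC B i) 0 := by
  fin_cases i
  exacts [(h 0 3).neg, (h 0 4).neg, (h 1 3).neg, (h 2 4).neg, (h 1 4).const_mul _,
    (h 1 2).const_mul _]

theorem hasDerivAt_val {A : ℝ → Mat} {B : Mat} (h : ∀ i j, HasDerivAt (fun t => A t i j) (B i j) 0)
    (Λ : Weight) : HasDerivAt (fun t => Λ.val (A t)) (Λ.val B) 0 := by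
  have h0 : HasDerivAt (fun t => cartC (A t) 0) (cartC B 0) 0 := (h 1 1).const_mul _
  have h1 : HasDerivAt (fun t => cartC (A t) 1) (cartC B 1) 0 := (h 2 2).const_mul _
  have h2 : HasDerivAt (fun t => cartC (A t) 2) (cartC B 2) 0 := (h 0 5).neg.div_const _
  exact ((h0.ofReal_comp.const_mul _).add (h1.ofReal_comp.const_mul _)).add
    (h2.ofReal_comp.const_mul _)

theorem hasDerivAt_line (f : SmoothFun) (v w : Coord) :
    HasDerivAt (fun t : ℝ => (f : Coord → ℂ) (v + t • w)) (fderiv ℝ (f : Coord → ℂ) v w) 0 := by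
  have hf : ContDiff ℝ ∞ (f : Coord → ℂ) := f.2
  have h1 : HasDerivAt (fun t : ℝ => v + t • w) w 0 := by
    simpa using ((hasDerivAt_id (0 : ℝ)).smul_const w).const_add v
  have h2 : HasFDerivAt (f : Coord → ℂ) (fderiv ℝ (f : Coord → ℂ) v) (v + (0 : ℝ) • w) := by
    simpa using (hf.differentiable (by simp) v).hasFDerivAt
  exact h2.comp_hasDerivAt (0 : ℝ) h1

/-- Leibniz rule: the derivative falls either on `Ad(g⁻¹)X`, giving a bracket, or on the function.
It serves the bracket relation of the left operators and their commutation with the right ones. -/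
theorem sum_rightOp_leftOp (Λ : Weight) (X : Mat) (f : SmoothFun) (v y : Coord) :
    ∑ j, (y j : ℂ) * (rightOp j (leftOp Λ X f) : Coord → ℂ) v =
      jet Λ ⁅posMat y, adj v X⁆ f v -
      (∑ i, (posC (adj v X) i : ℂ) * ∑ j, (y j : ℂ) * (rightOp j (rightOp i f) : Coord → ℂ) v +
        Λ.val (adj v X) * ∑ j, (y j : ℂ) * (rightOp j f : Coord → ℂ) v) := by
  have hA := hasDerivAt_adj X v y
  have h1 := hasDerivAt_line (leftOp Λ X f) v (flow v y)
  have h2 : HasDerivAt (fun t : ℝ => -(∑ i, (posC (adj (v + t • flow v y) X) i : ℂ) *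
      (rightOp i f : Coord → ℂ) (v + t • flow v y) +
      Λ.val (adj (v + t • flow v y) X) * (f : Coord → ℂ) (v + t • flow v y))) _ 0 :=
    ((HasDerivAt.fun_sum fun i _ => (hasDerivAt_posC hA i).ofReal_comp.mul
      (hasDerivAt_line (rightOp i f) v (flow v y))).add
      ((hasDerivAt_val hA Λ).mul (hasDerivAt_line f v (flow v y)))).neg
  -- The same curve is differentiated through `fderiv` and through the product rule; uniqueness
  -- equates the results.
  have h3 := h1.unique h2
  rw [fderiv_flow] at h3
  rw [h3]
  have e : ⁅posMat y, adj v X⁆ = -⁅adj v X, posMat y⁆ := by rw [Ring.lie_def, Ring.lie_def, neg_sub]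
  rw [e, jet_neg, jet]
  simp only [zero_smul, add_zero, fderiv_flow, Finset.sum_add_distrib]
  ring

theorem pd_comm (i j : Fin 6) (f : SmoothFun) (v : Coord) :
    (pd i (pd j f) : Coord → ℂ) v = (pd j (pd i f) : Coord → ℂ) v := by
  have hf : ContDiff ℝ ∞ (f : Coord → ℂ) := f.2
  have h2 : DifferentiableAt ℝ (fderiv ℝ (f : Coord → ℂ)) v :=
    (hf.fderiv_right (m := ∞) (by simp)).differentiable (by simp) v
  have key : ∀ a b : Coord, fderiv ℝ (fun w => fderiv ℝ (f : Coord → ℂ) w a) v b =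
      fderiv ℝ (fderiv ℝ (f : Coord → ℂ)) v b a := fun a b => by
    rw [fderiv_clm_apply h2 (differentiableAt_const _)]
    simp
  have hs : IsSymmSndFDerivAt ℝ (f : Coord → ℂ) v :=
    hf.contDiffAt.isSymmSndFDerivAt (by
      simp only [minSmoothness_of_isRCLikeNormedField]
      exact WithTop.coe_le_coe.mpr le_top)
  change fderiv ℝ (fun w => fderiv ℝ (f : Coord → ℂ) w _) v _ =
    fderiv ℝ (fun w => fderiv ℝ (f : Coord → ℂ) w _) v _
  rw [key, key]
  exact hs _ _

theorem pd_mulCoord (i j : Fin 6) (f : SmoothFun) (v : Coord) :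
    (pd i (mulCoord j f) : Coord → ℂ) v =
      v j * (pd i f : Coord → ℂ) v + (if j = i then 1 else 0) * (f : Coord → ℂ) v := by
  have hf : ContDiff ℝ ∞ (f : Coord → ℂ) := f.2
  have h1 : HasFDerivAt (fun w : Coord => ((w j : ℝ) : ℂ))
      (Complex.ofRealCLM.comp
        (ContinuousLinearMap.proj j : Coord →L[ℝ] ℝ)) v :=
    (Complex.ofRealCLM.comp
      (ContinuousLinearMap.proj j : Coord →L[ℝ] ℝ)).hasFDerivAt
  have h := h1.mul (hf.differentiable (by simp) v).hasFDerivAt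
  change fderiv ℝ ((fun w : Coord => ((w j : ℝ) : ℂ)) * (f : Coord → ℂ)) v _ = _
  rw [h.fderiv]
  simp [pd_apply, Pi.single_apply, apply_ite Complex.ofReal, mul_comm]

theorem coe_sub_apply (f g : SmoothFun) (v : Coord) :
    ((f - g : SmoothFun) : Coord → ℂ) v = (f : Coord → ℂ) v - (g : Coord → ℂ) v := rfl

theorem opD_eq (f : SmoothFun) : opD f = pd 5 f - (1 / 2 : ℂ) • mulCoord 1 (pd 0 f)
    - (1 / 2 : ℂ) • mulCoord 4 (pd 2 f) - mulCoord 3 (pd 4 f) := rfl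

theorem opD_pd (i : Fin 6) (f : SmoothFun) (v : Coord) :
    (opD (pd i f) : Coord → ℂ) v = (pd i (opD f) : Coord → ℂ) v +
      (if i = 1 then 1 / 2 else 0) * (pd 0 f : Coord → ℂ) v +
      (if i = 4 then 1 / 2 else 0) * (pd 2 f : Coord → ℂ) v +
      (if i = 3 then 1 else 0) * (pd 4 f : Coord → ℂ) v := by
  rw [opD_apply, opD_eq]
  simp only [map_sub, map_smul, coe_sub_apply, Submodule.coe_smul, Pi.smul_apply, smul_eq_mul,
    pd_mulCoord, pd_comm _ i, eq_comm (b := i)]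
  split_ifs <;> ring

theorem posC_lie_posMat (x y : Fin 6 → ℝ) : posC ⁅posMat x, posMat y⁆ =
    ![(x 5 * y 1 - x 1 * y 5) / 2, 0, (x 5 * y 4 - x 4 * y 5) / 2, 0, x 5 * y 3 - x 3 * y 5, 0] := by
  funext i
  rw [Ring.lie_def]
  fin_cases i <;>
    simp [posC, posMat] <;> ring

theorem cartC_lie_posMat (x y : Fin 6 → ℝ) : cartC ⁅posMat x, posMat y⁆ = 0 := by
  funext i
  rw [Ring.lie_def]
  fin_cases i <;>
    simp [cartC, posMat]

/-- Symmetry of second derivatives leaves only the brackets with `d⁺`. The weight is irrelevant,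
since brackets inside `𝒢₂⁺` have no component in `𝒦₂`. -/
theorem sum_rightOp_comm (Λ : Weight) (x y : Fin 6 → ℝ) (f : SmoothFun) (v : Coord) :
    ∑ i, (x i : ℂ) * ∑ j, (y j : ℂ) * (rightOp j (rightOp i f) : Coord → ℂ) v =
      ∑ j, (y j : ℂ) * ∑ i, (x i : ℂ) * (rightOp i (rightOp j f) : Coord → ℂ) v -
        jet Λ ⁅posMat x, posMat y⁆ f v := by
  have hv : Λ.val ⁅posMat x, posMat y⁆ = 0 := by simp [Weight.val, cartC_lie_posMat]
  rw [jet, hv, posC_lie_posMat]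
  simp only [Fin.sum_univ_six]
  simp [rightOp, dξ₁, dξ₂, dη₁, dη₂, dζ, opD_pd]
  have c := fun i j => pd_comm i j f v
  rw [c 0 1, c 0 2, c 0 3, c 0 4, c 1 2, c 1 3, c 1 4, c 2 3, c 2 4, c 3 4]
  ring

/-- `Λ`, extended by zero on `𝒢₂⁻`, is a character of `𝒦₂ + 𝒢₂⁻`: brackets there land in `𝒢₂⁻`. -/
theorem jet_lie_lower (Λ : Weight) (s s' : Fin 3 → ℝ) (u u' : Fin 6 → ℝ) (f : SmoothFun)
    (v : Coord) : jet Λ ⁅cartanMat s + negMat u, cartanMat s' + negMat u'⁆ f v = 0 := by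
  have h1 : posC ⁅cartanMat s + negMat u, cartanMat s' + negMat u'⁆ = 0 := by
    funext i
    rw [Ring.lie_def]
    fin_cases i <;>
      simp [posC, cartanMat, negMat]
  have h2 : cartC ⁅cartanMat s + negMat u, cartanMat s' + negMat u'⁆ = 0 := by
    funext i
    rw [Ring.lie_def]
    fin_cases i <;>
      simp [cartC, cartanMat, negMat] <;> ring
  simp [jet, Weight.val, h1, h2]

theorem leftOp_lie_apply (Λ : Weight) {X Y : Mat} (hX : IsInfJacobi X) (hY : IsInfJacobi Y)
    (f : SmoothFun) (v : Coord) :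
    (leftOp Λ X (leftOp Λ Y f) : Coord → ℂ) v - (leftOp Λ Y (leftOp Λ X f) : Coord → ℂ) v =
      (leftOp Λ ⁅X, Y⁆ f : Coord → ℂ) v := by
  rw [leftOp_apply Λ X, leftOp_apply Λ Y, leftOp_apply Λ ⁅X, Y⁆, adj_lie, jet, jet,
    sum_rightOp_leftOp, sum_rightOp_leftOp, leftOp_apply, leftOp_apply]
  have h := sum_rightOp_comm Λ (posC (adj v Y)) (posC (adj v X)) f v
  -- Split each argument into its positive and lower parts. The bracket of the two positive parts is
  -- counted twice in the first two terms, which the third corrects; the bracket of the lower parts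
  -- contributes nothing.
  have e : jet Λ ⁅adj v X, adj v Y⁆ f v = jet Λ ⁅posMat (posC (adj v X)), adj v Y⁆ f v -
      jet Λ ⁅posMat (posC (adj v Y)), adj v X⁆ f v +
      jet Λ ⁅posMat (posC (adj v Y)), posMat (posC (adj v X))⁆ f v := by
    obtain ⟨x, s, u, hx⟩ := (isInfJacobi_iff _).mp (hX.adj v)
    obtain ⟨y, s', u', hy⟩ := (isInfJacobi_iff _).mp (hY.adj v)
    have e1 : posC (adj v X) = x := by rw [hx, posC_eq]
    have e2 : posC (adj v Y) = y := by rw [hy, posC_eq]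
    rw [e1, e2, hx, hy, sub_eq_add_neg, ← jet_neg, ← jet_add, ← jet_add]
    have := jet_lie_lower Λ s s' u u' f v
    rw [← add_zero (jet Λ (_ + _) f v), ← this, ← jet_add]
    congr 1
    simp only [Ring.lie_def]
    noncomm_ring
  simp only [jet] at e h ⊢
  linear_combination e + h

theorem leftOp_lie (Λ : Weight) {X Y : Mat} (hX : IsInfJacobi X) (hY : IsInfJacobi Y) :
    leftOp Λ X * leftOp Λ Y - leftOp Λ Y * leftOp Λ X = leftOp Λ ⁅X, Y⁆ := by
  ext f v
  exact leftOp_lie_apply Λ hX hY f v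

/-! ### Left and right translations on `G⁺` -/

theorem adj_posMat (v : Coord) (y : Fin 6 → ℝ) : adj v (posMat y) =
    posMat ![y 0 - v 5 / 2 * y 1 + v 1 / 2 * y 5, y 1,
      y 2 - v 5 / 2 * y 4 + v 5 ^ 2 / 4 * y 3 + v 4 / 2 * y 5, y 3,
      y 4 - v 5 * y 3 + v 3 * y 5, y 5] := by
  rw [adj_apply, gPlus_eq]
  ext i j
  rw [Matrix.mul_apply, Fin.sum_univ_six]
  simp only [Matrix.mul_apply, Fin.sum_univ_six]
  fin_cases i <;> fin_cases j <;> simp [posMat, gPlusInv, gPlusMat] <;> ring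

theorem exists_adj_posMat (v : Coord) (y : Fin 6 → ℝ) : ∃ y', adj v (posMat y') = posMat y := by
  refine ⟨![y 0 + v 5 / 2 * y 1 - v 1 / 2 * y 5, y 1,
    y 2 + v 5 / 2 * (y 4 + v 5 * y 3 - v 3 * y 5) - v 5 ^ 2 / 4 * y 3 - v 4 / 2 * y 5, y 3,
    y 4 + v 5 * y 3 - v 3 * y 5, y 5], ?_⟩
  rw [adj_posMat]
  congr 1
  funext i
  fin_cases i <;> simp <;> ring

/-- As `G⁺` normalises `𝒢₂⁺`, the left field is a combination of right operators with variable
coefficients. The derivative of the coefficients cancels the commutator of the right operators. -/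
theorem rightOp_leftOp_comm (Λ : Weight) (y : Fin 6 → ℝ) (j : Fin 6) :
    rightOp j * leftOp Λ (posMat y) = leftOp Λ (posMat y) * rightOp j := by
  ext f v
  have h := sum_rightOp_leftOp Λ (posMat y) f v (Pi.single j 1)
  rw [adj_posMat] at h
  set y' := ![y 0 - v 5 / 2 * y 1 + v 1 / 2 * y 5, y 1,
      y 2 - v 5 / 2 * y 4 + v 5 ^ 2 / 4 * y 3 + v 4 / 2 * y 5, y 3,
      y 4 - v 5 * y 3 + v 3 * y 5, y 5] with hy'
  have c := sum_rightOp_comm Λ y' (Pi.single j 1) f v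
  have hs : ∀ r : Fin 6 → ℂ, ∑ i, ((Pi.single j (1 : ℝ) : Fin 6 → ℝ) i : ℂ) * r i = r j := by
    intro r
    rw [Finset.sum_eq_single j (fun i _ hi => by simp [Pi.single_eq_of_ne hi]) (by simp)]
    simp
  have e : ⁅posMat (Pi.single j 1), posMat y'⁆ = -⁅posMat y', posMat (Pi.single j 1)⁆ := by
    rw [Ring.lie_def, Ring.lie_def, neg_sub]
  have hp := posC_eq y' 0 0
  have hq := cartC_eq y' 0 0
  have z1 : cartanMat 0 = 0 := by rw [← sum_cartanGen]; simp
  have z2 : negMat 0 = 0 := by rw [← sum_negGen]; simp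
  rw [z1, z2, add_zero, add_zero] at hp hq
  have hval : Λ.val (posMat y') = 0 := by simp [Weight.val, hq]
  rw [hval, zero_mul, add_zero, hp, c, e, jet_neg] at h
  simp only [hs] at h
  change (rightOp j (leftOp Λ (posMat y) f) : Coord → ℂ) v =
    (leftOp Λ (posMat y) (rightOp j f) : Coord → ℂ) v
  have hj : jet Λ (posMat y') (rightOp j f) v =
      ∑ i, (y' i : ℂ) * (rightOp i (rightOp j f) : Coord → ℂ) v := by
    rw [jet, hp, hval, zero_mul, add_zero]
  rw [h, leftOp_apply, adj_posMat, ← hy', hj]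
  ring

/-! ### Singular vectors -/

/-- The maps need to be inverse only on the supports, so an index shift may leave the region where
the term vanishes. -/
theorem sum_reindex {M : Type*} [AddCommMonoid M] {R T : Finset (ℕ × ℕ)}
    (a b : ℕ × ℕ → M) (i j : ℕ × ℕ → ℕ × ℕ)
    (hi : ∀ x ∈ R, a x ≠ 0 → i x ∈ T ∧ j (i x) = x ∧ a x = b (i x))
    (hj : ∀ y ∈ T, b y ≠ 0 → j y ∈ R ∧ i (j y) = y ∧ a (j y) = b y) :
    ∑ x ∈ R, a x = ∑ y ∈ T, b y := by
  refine Finset.sum_bij_ne_zero (fun x _ _ => i x) (fun x hx h => (hi x hx h).1) ?_ ?_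
    (fun x hx h => (hi x hx h).2.2)
  · intro x hx h x' hx' h' e
    rw [← (hi x hx h).2.1, ← (hi x' hx' h').2.1, e]
  · intro y hy h
    obtain ⟨h1, h2, h3⟩ := hj y hy h
    exact ⟨j y, h1, by rwa [h3], h2⟩

section Singular

variable {M : Type*} [AddCommGroup M] [Module ℂ M]

theorem weight_pow {h x : Module.End ℂ M} {c w : ℂ} {u : M} (hx : h * x = x * h + c • x)
    (hu : h u = w • u) (k : ℕ) : h ((x ^ k) u) = (w + k * c) • (x ^ k) u := by
  induction k with
  | zero => simp [hu]
  | succ k ih =>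
    have e := LinearMap.congr_fun hx ((x ^ k) u)
    simp only [Module.End.mul_apply, LinearMap.add_apply, LinearMap.smul_apply, ih, map_smul] at e
    rw [pow_succ', Module.End.mul_apply, e]
    push_cast
    module

/-- Power rule for the derivation `[a, ·]`, valid since `[a, x]` commutes with `x`. The truncated
exponent at `k = 0` carries coefficient zero. -/
theorem mul_pow_of_commutator {A : Type*} [Ring A] [Algebra ℂ A] {a x y : A}
    (h : a * x = x * a + y) (hxy : x * y = y * x) (k : ℕ) :
    a * x ^ k = x ^ k * a + (k : ℂ) • (x ^ (k - 1) * y) := by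
  induction k with
  | zero => simp
  | succ k ih =>
    have h1 : (k : ℂ) • (x ^ (k - 1) * y * x) = (k : ℂ) • (x ^ k * y) := by
      rcases k with _ | k
      · simp
      · rw [Nat.add_sub_cancel, mul_assoc, ← hxy, ← mul_assoc, ← pow_succ]
    rw [pow_succ, ← mul_assoc, ih, add_mul, smul_mul_assoc, h1, mul_assoc, h, mul_add,
      Nat.add_sub_cancel, ← mul_assoc]
    push_cast
    module

/-- Operators `N, B, m, h₁, h₂, D` with the commutation relations of `d⁻, b₂⁻, a₂⁻, h₁, h₂, d⁺`, and
a vector of weight `(λ₁, λ₂)` annihilated by the first three. -/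
structure RaisingData (M : Type*) [AddCommGroup M] [Module ℂ M] where
  (N B m h₁ h₂ D : Module.End ℂ M)
  (vac : M)
  (w₁ w₂ : ℂ)
  N_D : N * D = D * N + (1 / 2 : ℂ) • (h₂ - h₁)
  B_D : B * D = D * B
  m_D : m * D = D * m
  h₁_D : h₁ * D = D * h₁ + (1 / 2 : ℂ) • D
  h₂_D : h₂ * D = D * h₂ + (-1 / 2 : ℂ) • D
  N_vac : N vac = 0
  B_vac : B vac = 0
  m_vac : m vac = 0
  h₁_vac : h₁ vac = w₁ • vac
  h₂_vac : h₂ vac = w₂ • vac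

namespace RaisingData

variable (S : RaisingData M)

theorem h₁_pow (k : ℕ) : S.h₁ ((S.D ^ k) S.vac) = (S.w₁ + k / 2) • (S.D ^ k) S.vac := by
  rw [weight_pow S.h₁_D S.h₁_vac]; congr 1; ring

theorem h₂_pow (k : ℕ) : S.h₂ ((S.D ^ k) S.vac) = (S.w₂ - k / 2) • (S.D ^ k) S.vac := by
  rw [weight_pow S.h₂_D S.h₂_vac]; congr 1; ring

theorem comm_pow {a x : Module.End ℂ M} (h : a * x = x * a) {u : M} (hu : a u = 0) (k : ℕ) :
    a ((x ^ k) u) = 0 := by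
  have := (show Commute a x from h).pow_right k
  rw [← Module.End.mul_apply, this.eq, Module.End.mul_apply, hu, map_zero]

/-- The `sl₂` string of `d⁺`, `d⁻`; the vanishing of this scalar at `k = p` is the weight condition
of case (i). -/
theorem N_pow (k : ℕ) : S.N ((S.D ^ k) S.vac) =
    ((k : ℂ) / 2 * (S.w₂ - S.w₁ - (k - 1) / 2)) • (S.D ^ (k - 1)) S.vac := by
  induction k with
  | zero => simp [S.N_vac]
  | succ k ih =>
    have e := LinearMap.congr_fun S.N_D ((S.D ^ k) S.vac)
    simp only [Module.End.mul_apply, LinearMap.add_apply, LinearMap.smul_apply,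
      LinearMap.sub_apply, ih, map_smul, h₁_pow, h₂_pow] at e
    rw [pow_succ', Module.End.mul_apply, e, Nat.add_sub_cancel]
    rcases k with _ | k
    · simp only [Nat.cast_zero, zero_div, zero_mul, zero_smul, pow_zero, Module.End.one_apply]
      push_cast
      module
    · rw [Nat.add_sub_cancel, ← Module.End.mul_apply, ← pow_succ']
      push_cast
      module

end RaisingData

/-- The operators of `RaisingData` together with operators with the commutation relations of
`b̂₁⁺, b̂₂⁺, ĉ⁺` and of `a₁⁺, a₂⁺`. -/
structure HatData (M : Type*) [AddCommGroup M] [Module ℂ M] extends RaisingData M where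
  (A₁ A₂ B₁ B₂ C : Module.End ℂ M)
  B₁_B₂ : B₁ * B₂ = B₂ * B₁
  B₁_C : B₁ * C = C * B₁
  B₂_C : B₂ * C = C * B₂
  D_C : D * C = C * D + (1 / 2 : ℂ) • B₁
  N_B₁ : N * B₁ = B₁ * N + C
  N_B₂ : N * B₂ = B₂ * N
  N_C : N * C = C * N + (1 / 2 : ℂ) • B₂
  B_B₁ : B * B₁ = B₁ * B
  B_B₂ : B * B₂ = B₂ * B + ((2 : ℂ) • h₂ - (1 / 2 : ℂ) • 1 - A₂ * m)
  B_C : B * C = C * B + (D - (1 / 2 : ℂ) • (A₁ * m))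
  m_B₁ : m * B₁ = B₁ * m
  m_B₂ : m * B₂ = B₂ * m
  m_C : m * C = C * m
  h₁_B₁ : h₁ * B₁ = B₁ * h₁ + (1 : ℂ) • B₁
  h₁_B₂ : h₁ * B₂ = B₂ * h₁ + (0 : ℂ) • B₂
  h₁_C : h₁ * C = C * h₁ + (1 / 2 : ℂ) • C
  h₂_B₁ : h₂ * B₁ = B₁ * h₂ + (0 : ℂ) • B₁
  h₂_B₂ : h₂ * B₂ = B₂ * h₂ + (1 : ℂ) • B₂
  h₂_C : h₂ * C = C * h₂ + (1 / 2 : ℂ) • C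

namespace HatData

variable (S : HatData M)

/-- The vectors `(b̂₁⁺)^k (b̂₂⁺)^l (ĉ⁺)^n (d⁺)^m v`. -/
def word (k l n m : ℕ) : M := (S.B₁ ^ k) ((S.B₂ ^ l) ((S.C ^ n) ((S.D ^ m) S.vac)))

/-- The purpose of the hats: every letter commutes with `a₂⁻`, so the Heisenberg part drops out of
all later computations. -/
theorem m_word (k l n m : ℕ) : S.m (S.word k l n m) = 0 :=
  RaisingData.comm_pow S.m_B₁ (RaisingData.comm_pow S.m_B₂ (RaisingData.comm_pow S.m_C
    (RaisingData.comm_pow S.m_D S.m_vac m) n) l) k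

theorem h₁_word (k l n m : ℕ) :
    S.h₁ (S.word k l n m) = (S.w₁ + m / 2 + n / 2 + k) • S.word k l n m := by
  rw [word, weight_pow S.h₁_B₁ (weight_pow S.h₁_B₂ (weight_pow S.h₁_C (S.h₁_pow m) n) l) k]
  congr 1
  ring

theorem h₂_word (k l n m : ℕ) :
    S.h₂ (S.word k l n m) = (S.w₂ - m / 2 + n / 2 + l) • S.word k l n m := by
  rw [word, weight_pow S.h₂_B₁ (weight_pow S.h₂_B₂ (weight_pow S.h₂_C (S.h₂_pow m) n) l) k]
  congr 1
  ring

theorem swap {x y : Module.End ℂ M} (h : x * y = y * x) (k : ℕ) (u : M) :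
    y ((x ^ k) u) = (x ^ k) (y u) := by
  rw [← Module.End.mul_apply, ((show Commute y x from h.symm).pow_right k).eq,
    Module.End.mul_apply]

theorem N_word (k l n m : ℕ) : S.N (S.word k l n m) =
    (k : ℂ) • S.word (k - 1) l (n + 1) m + ((n : ℂ) / 2) • S.word k (l + 1) (n - 1) m +
      ((m : ℂ) / 2 * (S.w₂ - S.w₁ - (m - 1) / 2)) • S.word k l n (m - 1) := by
  have e1 := LinearMap.congr_fun (mul_pow_of_commutator S.N_B₁ S.B₁_C k)
    ((S.B₂ ^ l) ((S.C ^ n) ((S.D ^ m) S.vac)))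
  have e2 := LinearMap.congr_fun (mul_pow_of_commutator S.N_C
    (show S.C * ((1 / 2 : ℂ) • S.B₂) = ((1 / 2 : ℂ) • S.B₂) * S.C by
      rw [mul_smul_comm, smul_mul_assoc, S.B₂_C]) n) ((S.D ^ m) S.vac)
  simp only [Module.End.mul_apply, LinearMap.add_apply, LinearMap.smul_apply] at e1 e2
  rw [word, e1, swap S.N_B₂.symm, swap S.B₂_C, e2, S.N_pow]
  simp only [map_add, map_smul, word]
  rw [pow_succ' S.C, pow_succ S.B₂, Module.End.mul_apply, Module.End.mul_apply, swap S.B₂_C.symm]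
  module

theorem D_C_pow (n : ℕ) (u : M) : S.D ((S.C ^ n) u) =
    (S.C ^ n) (S.D u) + ((n : ℂ) / 2) • S.B₁ ((S.C ^ (n - 1)) u) := by
  have e := LinearMap.congr_fun (mul_pow_of_commutator S.D_C
    (show S.C * ((1 / 2 : ℂ) • S.B₁) = ((1 / 2 : ℂ) • S.B₁) * S.C by
      rw [mul_smul_comm, smul_mul_assoc, S.B₁_C]) n) u
  simp only [Module.End.mul_apply, LinearMap.add_apply, LinearMap.smul_apply, map_smul] at e
  rw [e, swap S.B₁_C.symm]
  module

/-- Each `C` met by `B` becomes a `D`, as the term with `m` dies. Moving that `D` past the remaining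
`C`s costs a `B₁`, whence the term quadratic in `n`. -/
theorem B_C_pow (n m : ℕ) : S.B ((S.C ^ n) ((S.D ^ m) S.vac)) =
    (n : ℂ) • (S.C ^ (n - 1)) ((S.D ^ (m + 1)) S.vac) +
      ((n : ℂ) * (n - 1) / 4) • S.B₁ ((S.C ^ (n - 2)) ((S.D ^ m) S.vac)) := by
  induction n with
  | zero =>
    have := RaisingData.comm_pow S.B_D S.B_vac m
    simp [this]
  | succ n ih =>
    have e := LinearMap.congr_fun S.B_C ((S.C ^ n) ((S.D ^ m) S.vac))
    have hm : S.m ((S.C ^ n) ((S.D ^ m) S.vac)) = 0 := S.m_word 0 0 n m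
    simp only [Module.End.mul_apply, LinearMap.add_apply, LinearMap.smul_apply,
      LinearMap.sub_apply, hm, ih, map_add, map_smul, map_zero, smul_zero, sub_zero] at e
    rw [pow_succ', Module.End.mul_apply, e, D_C_pow, ← Module.End.mul_apply S.D, ← pow_succ']
    have c1 : (n : ℂ) • S.C ((S.C ^ (n - 1)) ((S.D ^ (m + 1)) S.vac)) =
        (n : ℂ) • (S.C ^ n) ((S.D ^ (m + 1)) S.vac) := by
      rcases n with _ | n
      · simp
      · rw [Nat.add_sub_cancel, ← Module.End.mul_apply, ← pow_succ']
    have c2 : ((n : ℂ) * (n - 1) / 4) • S.C (S.B₁ ((S.C ^ (n - 2)) ((S.D ^ m) S.vac))) =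
        ((n : ℂ) * (n - 1) / 4) • S.B₁ ((S.C ^ (n - 1)) ((S.D ^ m) S.vac)) := by
      rcases n with _ | _ | n
      · simp
      · simp
      · have := LinearMap.congr_fun S.B₁_C ((S.C ^ n) ((S.D ^ m) S.vac))
        simp only [Module.End.mul_apply] at this
        rw [show n + 1 + 1 - 2 = n by omega, show n + 1 + 1 - 1 = n + 1 by omega, ← this,
          ← Module.End.mul_apply S.C, ← pow_succ']
    rw [c1, c2, Nat.add_sub_cancel, show n + 1 - 2 = n - 1 by omega]
    push_cast
    module

theorem B_word (k l n m : ℕ) : S.B (S.word k l n m) =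
    ((l : ℂ) * (2 * S.w₂ - 3 / 2 + l + n - m)) • S.word k (l - 1) n m +
      (n : ℂ) • S.word k l (n - 1) (m + 1) +
      ((n : ℂ) * (n - 1) / 4) • S.word (k + 1) l (n - 2) m := by
  rw [word, swap S.B_B₁.symm]
  -- Every `B₂` contributes twice the current `h₂`-weight minus one half; summing this arithmetic
  -- progression over `l` letters gives the scalar.
  have key : S.B ((S.B₂ ^ l) ((S.C ^ n) ((S.D ^ m) S.vac))) =
      ((l : ℂ) * (2 * S.w₂ - 3 / 2 + l + n - m)) •
        (S.B₂ ^ (l - 1)) ((S.C ^ n) ((S.D ^ m) S.vac)) +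
      (S.B₂ ^ l) (S.B ((S.C ^ n) ((S.D ^ m) S.vac))) := by
    induction l with
    | zero => simp
    | succ l ih =>
      have e := LinearMap.congr_fun S.B_B₂ ((S.B₂ ^ l) ((S.C ^ n) ((S.D ^ m) S.vac)))
      have hm : S.m ((S.B₂ ^ l) ((S.C ^ n) ((S.D ^ m) S.vac))) = 0 := S.m_word 0 l n m
      have hh : S.h₂ ((S.B₂ ^ l) ((S.C ^ n) ((S.D ^ m) S.vac))) =
          (S.w₂ - m / 2 + n / 2 + l) • (S.B₂ ^ l) ((S.C ^ n) ((S.D ^ m) S.vac)) :=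
        S.h₂_word 0 l n m
      simp only [Module.End.mul_apply, LinearMap.add_apply, LinearMap.smul_apply,
        LinearMap.sub_apply, hm, hh, ih, map_add, map_smul, map_zero, sub_zero,
        Module.End.one_apply] at e
      have c1 : ((l : ℂ) * (2 * S.w₂ - 3 / 2 + l + n - m)) •
          S.B₂ ((S.B₂ ^ (l - 1)) ((S.C ^ n) ((S.D ^ m) S.vac))) =
          ((l : ℂ) * (2 * S.w₂ - 3 / 2 + l + n - m)) •
          (S.B₂ ^ l) ((S.C ^ n) ((S.D ^ m) S.vac)) := by
        rcases l with _ | l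
        · simp
        · rw [Nat.add_sub_cancel, ← Module.End.mul_apply, ← pow_succ']
      rw [c1] at e
      rw [pow_succ', Module.End.mul_apply, e, Nat.add_sub_cancel, Module.End.mul_apply]
      push_cast
      module
  rw [key, B_C_pow]
  simp only [map_add, map_smul, word]
  rw [pow_succ S.B₁, Module.End.mul_apply, swap S.B₁_B₂.symm]
  module

end HatData

/-! ### Double sums -/

/-- The set of the pairs `(k, n)` which occur in a double sum. -/
def region (l₀ m₀ : ℕ) : Finset (ℕ × ℕ) :=
  (Finset.range (l₀ + 1) ×ˢ Finset.range (l₀ + 1)).filter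
    fun x => x.1 + x.2 ≤ l₀ ∧ 2 * x.1 + x.2 ≤ m₀

theorem mem_region {l₀ m₀ : ℕ} {x : ℕ × ℕ} :
    x ∈ region l₀ m₀ ↔ x.1 + x.2 ≤ l₀ ∧ 2 * x.1 + x.2 ≤ m₀ := by
  simp only [region, Finset.mem_filter, Finset.mem_product, Finset.mem_range]
  omega

namespace HatData

variable (S : HatData M)

/-- The vector belonging to a double sum of words. -/
def vec (l₀ m₀ : ℕ) (κ : ℕ → ℕ → ℂ) : M :=
  ∑ x ∈ region l₀ m₀, κ x.1 x.2 • S.word x.1 (l₀ - x.1 - x.2) x.2 (m₀ - 2 * x.1 - x.2)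

theorem m_vec (l₀ m₀ : ℕ) (κ : ℕ → ℕ → ℂ) : S.m (S.vec l₀ m₀ κ) = 0 := by
  simp [vec, map_sum, m_word]

theorem h₁_vec (l₀ m₀ : ℕ) (κ : ℕ → ℕ → ℂ) :
    S.h₁ (S.vec l₀ m₀ κ) = (S.w₁ + m₀ / 2) • S.vec l₀ m₀ κ := by
  rw [vec, map_sum, Finset.smul_sum]
  refine Finset.sum_congr rfl fun x hx => ?_
  rw [map_smul, h₁_word, smul_comm]
  congr 1
  obtain ⟨h1, h2⟩ := mem_region.mp hx
  rw [Nat.sub_sub, Nat.cast_sub h2]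
  push_cast
  ring

theorem h₂_vec (l₀ m₀ : ℕ) (κ : ℕ → ℕ → ℂ) :
    S.h₂ (S.vec l₀ m₀ κ) = (S.w₂ + l₀ - m₀ / 2) • S.vec l₀ m₀ κ := by
  rw [vec, map_sum, Finset.smul_sum]
  refine Finset.sum_congr rfl fun x hx => ?_
  rw [map_smul, h₂_word, smul_comm]
  congr 2
  obtain ⟨h1, h2⟩ := mem_region.mp hx
  rw [Nat.sub_sub, Nat.sub_sub, Nat.cast_sub h2, Nat.cast_sub h1]
  push_cast
  ring

/-- A word with one `D` fewer arises from at most three terms of the sum, and `hκ` is the vanishing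
of its total coefficient. -/
theorem N_vec (l₀ m₀ : ℕ) (κ : ℕ → ℕ → ℂ)
    (hout : ∀ k n, l₀ < k + n ∨ m₀ < 2 * k + n → κ k n = 0)
    (hκ : ∀ k n, k + n ≤ l₀ → 2 * k + n + 1 ≤ m₀ →
      (if n = 0 then 0 else ((k : ℂ) + 1) * κ (k + 1) (n - 1)) +
        ((n : ℂ) + 1) / 2 * κ k (n + 1) +
        ((m₀ : ℂ) - 2 * k - n) / 2 * (S.w₂ - S.w₁ - (m₀ - 2 * k - n - 1) / 2) * κ k n = 0) :
    S.N (S.vec l₀ m₀ κ) = 0 := by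
  set T := (region l₀ m₀).filter fun x => 2 * x.1 + x.2 + 1 ≤ m₀ with hT
  have memT : ∀ x, x ∈ T ↔ x.1 + x.2 ≤ l₀ ∧ 2 * x.1 + x.2 + 1 ≤ m₀ := by
    intro x
    rw [hT, Finset.mem_filter, mem_region]
    omega
  set G : ℕ × ℕ → M := fun x => S.word x.1 (l₀ - x.1 - x.2) x.2 (m₀ - 1 - 2 * x.1 - x.2) with hG
  have s1 : ∑ x ∈ region l₀ m₀, (κ x.1 x.2 * x.1) •
      S.word (x.1 - 1) (l₀ - x.1 - x.2) (x.2 + 1) (m₀ - 2 * x.1 - x.2) =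
      ∑ y ∈ T, (if y.2 = 0 then 0 else ((y.1 : ℂ) + 1) * κ (y.1 + 1) (y.2 - 1)) • G y := by
    refine sum_reindex _ _ (fun x => (x.1 - 1, x.2 + 1)) (fun y => (y.1 + 1, y.2 - 1)) ?_ ?_
    · rintro ⟨k, n⟩ hx h
      rw [mem_region] at hx
      rcases k with _ | k
      · simp at h
      · simp only [memT, hG] at hx ⊢
        refine ⟨by omega, by simp, ?_⟩
        simp only [Nat.add_sub_cancel, Nat.succ_ne_zero, if_false]
        rw [show l₀ - (k + 1) - n = l₀ - k - (n + 1) by omega,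
          show m₀ - 2 * (k + 1) - n = m₀ - 1 - 2 * k - (n + 1) by omega]
        push_cast
        rw [mul_comm]
    · rintro ⟨k, n⟩ hy h
      rw [memT] at hy
      rcases n with _ | n
      · simp at h
      · simp only [mem_region, hG] at hy ⊢
        refine ⟨by omega, by simp, ?_⟩
        simp only [Nat.add_sub_cancel, Nat.succ_ne_zero, if_false]
        rw [show l₀ - (k + 1) - n = l₀ - k - (n + 1) by omega,
          show m₀ - 2 * (k + 1) - n = m₀ - 1 - 2 * k - (n + 1) by omega]
        push_cast
        rw [mul_comm]
  have s2 : ∑ x ∈ region l₀ m₀, (κ x.1 x.2 * ((x.2 : ℂ) / 2)) •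
      S.word x.1 (l₀ - x.1 - x.2 + 1) (x.2 - 1) (m₀ - 2 * x.1 - x.2) =
      ∑ y ∈ T, (((y.2 : ℂ) + 1) / 2 * κ y.1 (y.2 + 1)) • G y := by
    refine sum_reindex _ _ (fun x => (x.1, x.2 - 1)) (fun y => (y.1, y.2 + 1)) ?_ ?_
    · rintro ⟨k, n⟩ hx h
      rw [mem_region] at hx
      rcases n with _ | n
      · simp at h
      · simp only [memT, hG] at hx ⊢
        refine ⟨by omega, by simp, ?_⟩
        simp only [Nat.add_sub_cancel]
        rw [show l₀ - k - (n + 1) + 1 = l₀ - k - n by omega,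
          show m₀ - 2 * k - (n + 1) = m₀ - 1 - 2 * k - n by omega]
        push_cast
        rw [mul_comm]
    · rintro ⟨k, n⟩ hy h
      rw [memT] at hy
      -- On the edge `k + n = l₀` the shifted index leaves the region; there `hout` removes the
      -- coefficient.
      have hl : k + (n + 1) ≤ l₀ := by
        by_contra hl
        exact h (by simp only; rw [hout k (n + 1) (Or.inl (by omega)), mul_zero, zero_smul])
      simp only [mem_region, hG] at hy ⊢
      refine ⟨by omega, by simp, ?_⟩
      simp only [Nat.add_sub_cancel]
      rw [show l₀ - k - (n + 1) + 1 = l₀ - k - n by omega,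
        show m₀ - 2 * k - (n + 1) = m₀ - 1 - 2 * k - n by omega]
      push_cast
      rw [mul_comm]
  have s3 : ∑ x ∈ region l₀ m₀, (κ x.1 x.2 * (((m₀ - 2 * x.1 - x.2 : ℕ) : ℂ) / 2 *
      (S.w₂ - S.w₁ - (((m₀ - 2 * x.1 - x.2 : ℕ) : ℂ) - 1) / 2))) •
      S.word x.1 (l₀ - x.1 - x.2) x.2 (m₀ - 2 * x.1 - x.2 - 1) =
      ∑ y ∈ T, (((m₀ : ℂ) - 2 * y.1 - y.2) / 2 *
        (S.w₂ - S.w₁ - (m₀ - 2 * y.1 - y.2 - 1) / 2) * κ y.1 y.2) • G y := by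
    have cst : ∀ k n : ℕ, 2 * k + n ≤ m₀ →
        ((m₀ - 2 * k - n : ℕ) : ℂ) = (m₀ : ℂ) - 2 * k - n := fun k n h => by
      rw [Nat.sub_sub, Nat.cast_sub h]; push_cast; ring
    refine sum_reindex _ _ id id ?_ ?_
    · rintro ⟨k, n⟩ hx h
      rw [mem_region] at hx
      have hm : m₀ - 2 * k - n ≠ 0 := by
        intro hm
        simp [hm] at h
      simp only [memT, hG, id] at hx ⊢
      refine ⟨by omega, trivial, ?_⟩
      rw [cst k n hx.2, show m₀ - 2 * k - n - 1 = m₀ - 1 - 2 * k - n by omega, mul_comm]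
    · rintro ⟨k, n⟩ hy h
      rw [memT] at hy
      simp only [mem_region, hG, id] at hy ⊢
      refine ⟨by omega, trivial, ?_⟩
      rw [cst k n (by omega), show m₀ - 2 * k - n - 1 = m₀ - 1 - 2 * k - n by omega, mul_comm]
  rw [vec, map_sum]
  simp only [map_smul, N_word, smul_add, Finset.sum_add_distrib, smul_smul]
  rw [s1, s2, s3, ← Finset.sum_add_distrib, ← Finset.sum_add_distrib]
  refine Finset.sum_eq_zero fun y hy => ?_
  rw [← add_smul, ← add_smul, hκ y.1 y.2 ((memT y).mp hy).1 ((memT y).mp hy).2, zero_smul]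

/-- The same bookkeeping for words with one `B₂` fewer; now the edge `2 * k + n = m₀` needs `hout`.
-/
theorem B_vec (l₀ m₀ : ℕ) (κ : ℕ → ℕ → ℂ)
    (hout : ∀ k n, l₀ < k + n ∨ m₀ < 2 * k + n → κ k n = 0)
    (hκ : ∀ k n, k + n + 1 ≤ l₀ → 2 * k + n ≤ m₀ →
      ((l₀ : ℂ) - k - n) * (2 * S.w₂ - 3 / 2 + (l₀ - k - n) + n - (m₀ - 2 * k - n)) * κ k n +
        ((n : ℂ) + 1) * κ k (n + 1) +
        (if k = 0 then 0 else ((n : ℂ) + 2) * (n + 1) / 4 * κ (k - 1) (n + 2)) = 0) :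
    S.B (S.vec l₀ m₀ κ) = 0 := by
  set T := (region l₀ m₀).filter fun x => x.1 + x.2 + 1 ≤ l₀ with hT
  have memT : ∀ x, x ∈ T ↔ x.1 + x.2 + 1 ≤ l₀ ∧ 2 * x.1 + x.2 ≤ m₀ := by
    intro x
    rw [hT, Finset.mem_filter, mem_region]
    omega
  set G : ℕ × ℕ → M := fun x => S.word x.1 (l₀ - 1 - x.1 - x.2) x.2 (m₀ - 2 * x.1 - x.2) with hG
  have s1 : ∑ x ∈ region l₀ m₀, (κ x.1 x.2 * (((l₀ - x.1 - x.2 : ℕ) : ℂ) *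
      (2 * S.w₂ - 3 / 2 + ((l₀ - x.1 - x.2 : ℕ) : ℂ) + x.2 - ((m₀ - 2 * x.1 - x.2 : ℕ) : ℂ)))) •
      S.word x.1 (l₀ - x.1 - x.2 - 1) x.2 (m₀ - 2 * x.1 - x.2) =
      ∑ y ∈ T, (((l₀ : ℂ) - y.1 - y.2) *
        (2 * S.w₂ - 3 / 2 + (l₀ - y.1 - y.2) + y.2 - (m₀ - 2 * y.1 - y.2)) * κ y.1 y.2) • G y := by
    have cst : ∀ k n : ℕ, 2 * k + n ≤ m₀ →
        ((m₀ - 2 * k - n : ℕ) : ℂ) = (m₀ : ℂ) - 2 * k - n := fun k n h => by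
      rw [Nat.sub_sub, Nat.cast_sub h]; push_cast; ring
    have cst' : ∀ k n : ℕ, k + n ≤ l₀ →
        ((l₀ - k - n : ℕ) : ℂ) = (l₀ : ℂ) - k - n := fun k n h => by
      rw [Nat.sub_sub, Nat.cast_sub h]; push_cast; ring
    refine sum_reindex _ _ id id ?_ ?_
    · rintro ⟨k, n⟩ hx h
      rw [mem_region] at hx
      have hl : l₀ - k - n ≠ 0 := by
        intro hl
        simp [hl] at h
      simp only [memT, hG, id] at hx ⊢
      refine ⟨by omega, trivial, ?_⟩
      rw [cst k n hx.2, cst' k n hx.1, show l₀ - k - n - 1 = l₀ - 1 - k - n by omega, mul_comm]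
    · rintro ⟨k, n⟩ hy h
      rw [memT] at hy
      simp only [mem_region, hG, id] at hy ⊢
      refine ⟨by omega, trivial, ?_⟩
      rw [cst k n (by omega), cst' k n (by omega),
        show l₀ - k - n - 1 = l₀ - 1 - k - n by omega, mul_comm]
  have s2 : ∑ x ∈ region l₀ m₀, (κ x.1 x.2 * (x.2 : ℂ)) •
      S.word x.1 (l₀ - x.1 - x.2) (x.2 - 1) (m₀ - 2 * x.1 - x.2 + 1) =
      ∑ y ∈ T, (((y.2 : ℂ) + 1) * κ y.1 (y.2 + 1)) • G y := by
    refine sum_reindex _ _ (fun x => (x.1, x.2 - 1)) (fun y => (y.1, y.2 + 1)) ?_ ?_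
    · rintro ⟨k, n⟩ hx h
      rw [mem_region] at hx
      rcases n with _ | n
      · simp at h
      · simp only [memT, hG] at hx ⊢
        refine ⟨by omega, by simp, ?_⟩
        simp only [Nat.add_sub_cancel]
        rw [show l₀ - k - (n + 1) = l₀ - 1 - k - n by omega,
          show m₀ - 2 * k - (n + 1) + 1 = m₀ - 2 * k - n by omega]
        push_cast
        rw [mul_comm]
    · rintro ⟨k, n⟩ hy h
      rw [memT] at hy
      have hl : 2 * k + (n + 1) ≤ m₀ := by
        by_contra hl
        exact h (by simp only; rw [hout k (n + 1) (Or.inr (by omega)), mul_zero, zero_smul])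
      simp only [mem_region, hG] at hy ⊢
      refine ⟨by omega, by simp, ?_⟩
      simp only [Nat.add_sub_cancel]
      rw [show l₀ - k - (n + 1) = l₀ - 1 - k - n by omega,
        show m₀ - 2 * k - (n + 1) + 1 = m₀ - 2 * k - n by omega]
      push_cast
      rw [mul_comm]
  have s3 : ∑ x ∈ region l₀ m₀, (κ x.1 x.2 * ((x.2 : ℂ) * (x.2 - 1) / 4)) •
      S.word (x.1 + 1) (l₀ - x.1 - x.2) (x.2 - 2) (m₀ - 2 * x.1 - x.2) =
      ∑ y ∈ T, (if y.1 = 0 then 0 else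
        ((y.2 : ℂ) + 2) * (y.2 + 1) / 4 * κ (y.1 - 1) (y.2 + 2)) • G y := by
    refine sum_reindex _ _ (fun x => (x.1 + 1, x.2 - 2)) (fun y => (y.1 - 1, y.2 + 2)) ?_ ?_
    · rintro ⟨k, n⟩ hx h
      rw [mem_region] at hx
      rcases n with _ | _ | n
      · simp at h
      · simp at h
      · simp only [memT, hG] at hx ⊢
        refine ⟨by omega, by simp, ?_⟩
        simp only [Nat.add_sub_cancel, Nat.succ_ne_zero, if_false,
          show n + 1 + 1 - 2 = n by omega]
        rw [show l₀ - k - (n + 1 + 1) = l₀ - 1 - (k + 1) - n by omega,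
          show m₀ - 2 * k - (n + 1 + 1) = m₀ - 2 * (k + 1) - n by omega]
        push_cast
        rw [mul_comm]
        congr 2
        ring
    · rintro ⟨k, n⟩ hy h
      rw [memT] at hy
      rcases k with _ | k
      · simp at h
      · simp only [mem_region, hG] at hy ⊢
        refine ⟨by omega, by simp, ?_⟩
        simp only [Nat.add_sub_cancel, Nat.succ_ne_zero, if_false]
        rw [show l₀ - k - (n + 2) = l₀ - 1 - (k + 1) - n by omega,
          show m₀ - 2 * k - (n + 2) = m₀ - 2 * (k + 1) - n by omega]
        push_cast
        rw [mul_comm]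
        congr 2
        ring
  rw [vec, map_sum]
  simp only [map_smul, B_word, smul_add, Finset.sum_add_distrib, smul_smul]
  rw [s1, s2, s3, ← Finset.sum_add_distrib, ← Finset.sum_add_distrib]
  refine Finset.sum_eq_zero fun y hy => ?_
  rw [← add_smul, ← add_smul, hκ y.1 y.2 ((memT y).mp hy).1 ((memT y).mp hy).2, zero_smul]

end HatData

end Singular

/-! ### Representations of the Jacobi algebra -/

theorem lie_dMinus : ⁅negGen 5, posGen 0⁆ = (1 / 2 : ℝ) • posGen 1 ∧ ⁅negGen 5, posGen 1⁆ = 0 ∧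
    ⁅negGen 5, posGen 2⁆ = posGen 4 ∧ ⁅negGen 5, posGen 3⁆ = 0 ∧
    ⁅negGen 5, posGen 4⁆ = (1 / 2 : ℝ) • posGen 3 ∧
    ⁅negGen 5, posGen 5⁆ = (1 / 2 : ℝ) • (cartanGen 1 - cartanGen 0) := by
  refine ⟨?_, ?_, ?_, ?_, ?_, ?_⟩ <;>
    simp [Ring.lie_def, negGen, posGen, cartanGen, aPlus, KPlus, KZero, up, dn, mul_sub, sub_mul,
      mul_add, add_mul, unitMat_mul] <;> module

theorem lie_bMinus : ⁅negGen 3, posGen 0⁆ = 0 ∧ ⁅negGen 3, posGen 1⁆ = negGen 1 ∧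
    ⁅negGen 3, posGen 2⁆ = 0 ∧ ⁅negGen 3, posGen 3⁆ = (2 : ℝ) • cartanGen 1 ∧
    ⁅negGen 3, posGen 4⁆ = posGen 5 ∧ ⁅negGen 3, posGen 5⁆ = 0 := by
  refine ⟨?_, ?_, ?_, ?_, ?_, ?_⟩ <;>
    simp [Ring.lie_def, negGen, posGen, cartanGen, aPlus, aMinus, KPlus, KMinus, KZero, up, dn,
      mul_sub, sub_mul, mul_add, add_mul, unitMat_mul] <;> module

theorem lie_aMinus : ⁅negGen 1, posGen 0⁆ = 0 ∧ ⁅negGen 1, posGen 1⁆ = cartanGen 2 ∧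
    ⁅negGen 1, posGen 2⁆ = 0 ∧ ⁅negGen 1, posGen 3⁆ = posGen 1 ∧
    ⁅negGen 1, posGen 4⁆ = (1 / 2 : ℝ) • posGen 0 ∧ ⁅negGen 1, posGen 5⁆ = 0 := by
  refine ⟨?_, ?_, ?_, ?_, ?_, ?_⟩ <;>
    simp [Ring.lie_def, negGen, posGen, cartanGen, aPlus, aMinus, KPlus, KZero, central, up, dn,
      mul_sub, sub_mul, mul_add, add_mul, unitMat_mul] <;> module

theorem lie_cartan_zero : ⁅cartanGen 0, posGen 0⁆ = (1 / 2 : ℝ) • posGen 0 ∧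
    ⁅cartanGen 0, posGen 1⁆ = 0 ∧ ⁅cartanGen 0, posGen 2⁆ = posGen 2 ∧
    ⁅cartanGen 0, posGen 3⁆ = 0 ∧ ⁅cartanGen 0, posGen 4⁆ = (1 / 2 : ℝ) • posGen 4 ∧
    ⁅cartanGen 0, posGen 5⁆ = (1 / 2 : ℝ) • posGen 5 := by
  refine ⟨?_, ?_, ?_, ?_, ?_, ?_⟩ <;>
    simp [Ring.lie_def, posGen, cartanGen, aPlus, KPlus, KZero, up, dn,
      mul_sub, sub_mul, mul_add, add_mul, unitMat_mul] <;> module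

theorem lie_cartan_one : ⁅cartanGen 1, posGen 0⁆ = 0 ∧
    ⁅cartanGen 1, posGen 1⁆ = (1 / 2 : ℝ) • posGen 1 ∧ ⁅cartanGen 1, posGen 2⁆ = 0 ∧
    ⁅cartanGen 1, posGen 3⁆ = posGen 3 ∧ ⁅cartanGen 1, posGen 4⁆ = (1 / 2 : ℝ) • posGen 4 ∧
    ⁅cartanGen 1, posGen 5⁆ = (-1 / 2 : ℝ) • posGen 5 := by
  refine ⟨?_, ?_, ?_, ?_, ?_, ?_⟩ <;>
    simp [Ring.lie_def, posGen, cartanGen, aPlus, KPlus, KZero, up, dn,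
      mul_sub, sub_mul, mul_add, add_mul, unitMat_mul] <;> module

theorem lie_dPlus : ⁅posGen 5, posGen 0⁆ = 0 ∧ ⁅posGen 5, posGen 1⁆ = (1 / 2 : ℝ) • posGen 0 ∧
    ⁅posGen 5, posGen 4⁆ = (1 / 2 : ℝ) • posGen 2 := by
  refine ⟨?_, ?_, ?_⟩ <;>
    simp [Ring.lie_def, posGen, aPlus, KPlus, KZero, up, dn,
      mul_sub, sub_mul, mul_add, add_mul, unitMat_mul] <;> module

theorem lie_neg : ⁅negGen 1, negGen 5⁆ = (1 / 2 : ℝ) • negGen 0 ∧ ⁅negGen 3, negGen 5⁆ = negGen 4 ∧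
    ⁅negGen 4, negGen 5⁆ = (1 / 2 : ℝ) • negGen 2 := by
  refine ⟨?_, ?_, ?_⟩ <;>
    simp [Ring.lie_def, negGen, aMinus, KMinus, KZero, up, dn,
      mul_sub, sub_mul, mul_add, add_mul, unitMat_mul] <;> module

theorem lie_posGen_abelian (i j : Fin 6) (hi : i ≠ 5) (hj : j ≠ 5) : ⁅posGen i, posGen j⁆ = 0 := by
  fin_cases i <;> fin_cases j <;> first
    | contradiction
    | simp [Ring.lie_def, posGen, aPlus, KPlus, up, dn, mul_sub, sub_mul, mul_add, add_mul,
        unitMat_mul]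

theorem isInfJacobi_posGen (i : Fin 6) : IsInfJacobi (posGen i) :=
  (mem_jacobiAlgebra_iff _).mp (Submodule.subset_span (Or.inl (Or.inl ⟨i, rfl⟩)))

theorem isInfJacobi_cartanGen (i : Fin 3) : IsInfJacobi (cartanGen i) :=
  (mem_jacobiAlgebra_iff _).mp (Submodule.subset_span (Or.inl (Or.inr ⟨i, rfl⟩)))

theorem isInfJacobi_negGen (i : Fin 6) : IsInfJacobi (negGen i) :=
  (mem_jacobiAlgebra_iff _).mp (Submodule.subset_span (Or.inr ⟨i, rfl⟩))

section HatAlgebra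

variable {A : Type*} [Ring A] [Algebra ℂ A]

theorem commutator_hat {a b x y u p q : A} (hb : a * b = b * a + u) (hx : a * x = x * a + p)
    (hy : a * y = y * a + q) : a * (b - (1 / 2 : ℂ) • (x * y)) =
      (b - (1 / 2 : ℂ) • (x * y)) * a + (u - (1 / 2 : ℂ) • (p * y + x * q)) := by
  have h : a * (x * y) = x * y * a + (p * y + x * q) := by
    rw [← mul_assoc, hx, add_mul, mul_assoc x a y, hy, mul_add, ← mul_assoc]
    abel
  rw [mul_sub, mul_smul_comm, h, hb, sub_mul, smul_mul_assoc]
  module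

theorem commute_hat {a b x y : A} (hb : Commute a b) (hx : Commute a x) (hy : Commute a y) :
    Commute a (b - (1 / 2 : ℂ) • (x * y)) :=
  hb.sub_right ((hx.mul_right hy).smul_right _)

end HatAlgebra

section Rep

variable {M : Type*} [AddCommGroup M] [Module ℂ M]

/-- `E` represents the Jacobi algebra. -/
structure IsRep (E : Mat → Module.End ℂ M) : Prop where
  add : ∀ X Y, E (X + Y) = E X + E Y
  smul : ∀ (c : ℝ) X, E (c • X) = (c : ℂ) • E X
  lie : ∀ X Y, IsInfJacobi X → IsInfJacobi Y → E X * E Y = E Y * E X + E ⁅X, Y⁆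

/-- `μ` is a vector of weight `Λ` annihilated by `𝒢₂⁻`. -/
structure IsSingular (E : Mat → Module.End ℂ M) (Λ : Weight) (μ : M) : Prop where
  neg : ∀ i, E (negGen i) μ = 0
  h₁ : E (cartanGen 0) μ = Λ.h₁ • μ
  h₂ : E (cartanGen 1) μ = Λ.h₂ • μ
  hat : E (cartanGen 2) μ = Λ.hat • μ

namespace IsRep

variable {E : Mat → Module.End ℂ M}

theorem zero (hE : IsRep E) : E 0 = 0 := by simpa using hE.smul 0 0

theorem lie_eq (hE : IsRep E) {X Y Z : Mat} (hX : IsInfJacobi X) (hY : IsInfJacobi Y)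
    (h : ⁅X, Y⁆ = Z) : E X * E Y = E Y * E X + E Z := h ▸ hE.lie X Y hX hY

theorem commute (hE : IsRep E) {X Y : Mat} (hX : IsInfJacobi X) (hY : IsInfJacobi Y)
    (h : ⁅X, Y⁆ = 0) : Commute (E X) (E Y) := by
  rw [Commute, SemiconjBy, hE.lie_eq hX hY h, hE.zero, add_zero]

theorem lie_smul (hE : IsRep E) {X Y Z : Mat} {c : ℝ} (hX : IsInfJacobi X) (hY : IsInfJacobi Y)
    (h : ⁅X, Y⁆ = c • Z) : E X * E Y = E Y * E X + (c : ℂ) • E Z := by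
  rw [hE.lie_eq hX hY h, hE.smul]

/-- The raising data of a vector annihilated by `𝒢₂⁻`. -/
def raisingData (hE : IsRep E) {Λ : Weight} {μ : M} (hμ : IsSingular E Λ μ) : RaisingData M where
  N := E (negGen 5)
  B := E (negGen 3)
  m := E (negGen 1)
  h₁ := E (cartanGen 0)
  h₂ := E (cartanGen 1)
  D := E (posGen 5)
  vac := μ
  w₁ := Λ.h₁
  w₂ := Λ.h₂
  N_D := by
    rw [hE.lie_smul (isInfJacobi_negGen 5) (isInfJacobi_posGen 5) lie_dMinus.2.2.2.2.2,
      sub_eq_add_neg, hE.add, ← neg_one_smul ℝ, hE.smul]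
    push_cast
    module
  B_D := hE.commute (isInfJacobi_negGen 3) (isInfJacobi_posGen 5) lie_bMinus.2.2.2.2.2
  m_D := hE.commute (isInfJacobi_negGen 1) (isInfJacobi_posGen 5) lie_aMinus.2.2.2.2.2
  h₁_D := by
    rw [hE.lie_smul (isInfJacobi_cartanGen 0) (isInfJacobi_posGen 5) lie_cartan_zero.2.2.2.2.2]
    norm_num
  h₂_D := by
    rw [hE.lie_smul (isInfJacobi_cartanGen 1) (isInfJacobi_posGen 5) lie_cartan_one.2.2.2.2.2]
    norm_num
  N_vac := hμ.neg 5
  B_vac := hμ.neg 3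
  m_vac := hμ.neg 1
  h₁_vac := hμ.h₁
  h₂_vac := hμ.h₂

/-- The data of a vector annihilated by `𝒢₂⁻` on which the central element acts by `1`. -/
def hatData (hE : IsRep E) (hz : E (cartanGen 2) = 1) {Λ : Weight} {μ : M}
    (hμ : IsSingular E Λ μ) : HatData M where
  toRaisingData := hE.raisingData hμ
  A₁ := E (posGen 0)
  A₂ := E (posGen 1)
  B₁ := E (posGen 2) - (1 / 2 : ℂ) • E (posGen 0) ^ 2
  B₂ := E (posGen 3) - (1 / 2 : ℂ) • E (posGen 1) ^ 2
  C := E (posGen 4) - (1 / 2 : ℂ) • (E (posGen 0) * E (posGen 1))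
  B₁_B₂ := by
    have h := fun i j hi hj => hE.commute (isInfJacobi_posGen i) (isInfJacobi_posGen j)
      (lie_posGen_abelian i j hi hj)
    have e : ∀ i, i ≠ 5 → Commute (E (posGen i)) (E (posGen 3) - (1 / 2 : ℂ) •
      (E (posGen 1) * E (posGen 1))) := fun i hi => commute_hat (h i 3 hi (by decide))
        (h i 1 hi (by decide)) (h i 1 hi (by decide))
    rw [pow_two, pow_two]
    exact (commute_hat (e 2 (by decide)).symm (e 0 (by decide)).symm (e 0 (by decide)).symm).symm
  B₁_C := by
    have h := fun i j hi hj => hE.commute (isInfJacobi_posGen i) (isInfJacobi_posGen j)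
      (lie_posGen_abelian i j hi hj)
    have e : ∀ i, i ≠ 5 → Commute (E (posGen i)) (E (posGen 4) - (1 / 2 : ℂ) •
      (E (posGen 0) * E (posGen 1))) := fun i hi => commute_hat (h i 4 hi (by decide))
        (h i 0 hi (by decide)) (h i 1 hi (by decide))
    rw [pow_two]
    exact (commute_hat (e 2 (by decide)).symm (e 0 (by decide)).symm (e 0 (by decide)).symm).symm
  B₂_C := by
    have h := fun i j hi hj => hE.commute (isInfJacobi_posGen i) (isInfJacobi_posGen j)
      (lie_posGen_abelian i j hi hj)
    have e : ∀ i, i ≠ 5 → Commute (E (posGen i)) (E (posGen 4) - (1 / 2 : ℂ) •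
      (E (posGen 0) * E (posGen 1))) := fun i hi => commute_hat (h i 4 hi (by decide))
        (h i 0 hi (by decide)) (h i 1 hi (by decide))
    rw [pow_two]
    exact (commute_hat (e 3 (by decide)).symm (e 1 (by decide)).symm (e 1 (by decide)).symm).symm
  D_C := by
    have J := isInfJacobi_posGen
    refine (commutator_hat (hE.lie_smul (J 5) (J 4) lie_dPlus.2.2)
      (hE.lie_eq (J 5) (J 0) lie_dPlus.1) (hE.lie_smul (J 5) (J 1) lie_dPlus.2.1)).trans ?_
    rw [hE.zero, zero_mul, mul_smul_comm, pow_two]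
    push_cast
    simp only [raisingData]
    module
  N_B₁ := by
    have J := isInfJacobi_posGen
    have N := isInfJacobi_negGen 5
    have c := (hE.commute (J 0) (J 1) (lie_posGen_abelian 0 1 (by decide) (by decide))).eq
    have a := hE.lie_smul N (J 0) lie_dMinus.1
    rw [pow_two]
    refine (commutator_hat (hE.lie_eq N (J 2) lie_dMinus.2.2.1) a a).trans ?_
    rw [mul_smul_comm, smul_mul_assoc, ← c]
    push_cast
    simp only [raisingData]
    module
  N_B₂ := by
    have J := isInfJacobi_posGen
    have N := isInfJacobi_negGen 5
    have a := hE.commute N (J 1) lie_dMinus.2.1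
    rw [pow_two]
    exact commute_hat (hE.commute N (J 3) lie_dMinus.2.2.2.1) a a
  N_C := by
    have J := isInfJacobi_posGen
    have N := isInfJacobi_negGen 5
    refine (commutator_hat (hE.lie_smul N (J 4) lie_dMinus.2.2.2.2.1)
      (hE.lie_smul N (J 0) lie_dMinus.1) (hE.lie_eq N (J 1) lie_dMinus.2.1)).trans ?_
    rw [hE.zero, mul_zero, smul_mul_assoc, pow_two]
    push_cast
    simp only [raisingData]
    module
  B_B₁ := by
    have J := isInfJacobi_posGen
    have N := isInfJacobi_negGen 3
    have a := hE.commute N (J 0) lie_bMinus.1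
    rw [pow_two]
    exact commute_hat (hE.commute N (J 2) lie_bMinus.2.2.1) a a
  B_B₂ := by
    have J := isInfJacobi_posGen
    have N := isInfJacobi_negGen 3
    have a := hE.lie_eq N (J 1) lie_bMinus.2.1
    have b := hE.lie_eq (isInfJacobi_negGen 1) (J 1) lie_aMinus.2.1
    rw [pow_two]
    refine (commutator_hat (hE.lie_smul N (J 3) lie_bMinus.2.2.2.1) a a).trans ?_
    -- Reordering `a₂⁻ a₂⁺` costs the central element, which acts by one: this is the shift by one
    -- half in the commutator.
    rw [b, hz]
    push_cast
    simp only [raisingData]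
    module
  B_C := by
    have J := isInfJacobi_posGen
    have N := isInfJacobi_negGen 3
    refine (commutator_hat (hE.lie_eq N (J 4) lie_bMinus.2.2.2.2.1)
      (hE.lie_eq N (J 0) lie_bMinus.1) (hE.lie_eq N (J 1) lie_bMinus.2.1)).trans ?_
    rw [hE.zero, zero_mul, zero_add]
    rfl
  m_B₁ := by
    have J := isInfJacobi_posGen
    have N := isInfJacobi_negGen 1
    have a := hE.commute N (J 0) lie_aMinus.1
    rw [pow_two]
    exact commute_hat (hE.commute N (J 2) lie_aMinus.2.2.1) a a
  m_B₂ := by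
    have J := isInfJacobi_posGen
    have N := isInfJacobi_negGen 1
    have a := hE.lie_eq N (J 1) lie_aMinus.2.1
    rw [pow_two]
    refine (commutator_hat (hE.lie_eq N (J 3) lie_aMinus.2.2.2.1) a a).trans ?_
    -- Since the central element acts by one, the square contributes exactly `a₂⁺` after the factor
    -- one half, cancelling `[a₂⁻, b₂⁺]`.
    rw [hz, one_mul, mul_one]
    simp only [raisingData]
    module
  m_C := by
    have J := isInfJacobi_posGen
    have N := isInfJacobi_negGen 1
    refine (commutator_hat (hE.lie_smul N (J 4) lie_aMinus.2.2.2.2.1)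
      (hE.lie_eq N (J 0) lie_aMinus.1) (hE.lie_eq N (J 1) lie_aMinus.2.1)).trans ?_
    rw [hz, hE.zero, zero_mul, mul_one]
    push_cast
    simp only [raisingData]
    module
  h₁_B₁ := by
    have J := isInfJacobi_posGen
    have N := isInfJacobi_cartanGen 0
    have a := hE.lie_smul N (J 0) lie_cartan_zero.1
    rw [pow_two]
    refine (commutator_hat (hE.lie_eq N (J 2) lie_cartan_zero.2.2.1) a a).trans ?_
    rw [smul_mul_assoc, mul_smul_comm]
    push_cast
    simp only [raisingData]
    module
  h₁_B₂ := by
    have J := isInfJacobi_posGen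
    have N := isInfJacobi_cartanGen 0
    have a := hE.commute N (J 1) lie_cartan_zero.2.1
    rw [pow_two, zero_smul, add_zero]
    exact commute_hat (hE.commute N (J 3) lie_cartan_zero.2.2.2.1) a a
  h₁_C := by
    have J := isInfJacobi_posGen
    have N := isInfJacobi_cartanGen 0
    refine (commutator_hat (hE.lie_smul N (J 4) lie_cartan_zero.2.2.2.2.1)
      (hE.lie_smul N (J 0) lie_cartan_zero.1) (hE.lie_eq N (J 1) lie_cartan_zero.2.1)).trans ?_
    rw [hE.zero, mul_zero, smul_mul_assoc]
    push_cast
    simp only [raisingData]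
    module
  h₂_B₁ := by
    have J := isInfJacobi_posGen
    have N := isInfJacobi_cartanGen 1
    have a := hE.commute N (J 0) lie_cartan_one.1
    rw [pow_two, zero_smul, add_zero]
    exact commute_hat (hE.commute N (J 2) lie_cartan_one.2.2.1) a a
  h₂_B₂ := by
    have J := isInfJacobi_posGen
    have N := isInfJacobi_cartanGen 1
    have a := hE.lie_smul N (J 1) lie_cartan_one.2.1
    rw [pow_two]
    refine (commutator_hat (hE.lie_eq N (J 3) lie_cartan_one.2.2.2.1) a a).trans ?_
    rw [smul_mul_assoc, mul_smul_comm]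
    push_cast
    simp only [raisingData]
    module
  h₂_C := by
    have J := isInfJacobi_posGen
    have N := isInfJacobi_cartanGen 1
    refine (commutator_hat (hE.lie_smul N (J 4) lie_cartan_one.2.2.2.2.1)
      (hE.lie_eq N (J 0) lie_cartan_one.1) (hE.lie_smul N (J 1) lie_cartan_one.2.1)).trans ?_
    rw [hE.zero, zero_mul, mul_smul_comm]
    push_cast
    simp only [raisingData]
    module

/-- `𝒢₂⁻` is generated by `d⁻`, `b₂⁻` and `a₂⁻`. -/
theorem isSingular (hE : IsRep E) {Λ : Weight} {μ : M} (hN : E (negGen 5) μ = 0)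
    (hB : E (negGen 3) μ = 0) (hm : E (negGen 1) μ = 0) (h₁ : E (cartanGen 0) μ = Λ.h₁ • μ)
    (h₂ : E (cartanGen 1) μ = Λ.h₂ • μ) (hat : E (cartanGen 2) μ = Λ.hat • μ) :
    IsSingular E Λ μ := by
  have J := isInfJacobi_negGen
  -- A vector killed by `X` and `d⁻` is killed by their bracket. This reaches `c⁻` from `b₂⁻`, then
  -- `b₁⁻` from `c⁻`, and `a₁⁻` from `a₂⁻`.
  have key : ∀ {X : Mat} {Z : Mat}, IsInfJacobi X → E X μ = 0 → ⁅X, negGen 5⁆ = Z → E Z μ = 0 := by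
    intro X Z hX h0 h
    have := LinearMap.congr_fun (hE.lie_eq hX (J 5) h) μ
    simpa [hN, h0] using this.symm
  have half : ∀ {Z : Mat}, E ((1 / 2 : ℝ) • Z) μ = 0 → E Z μ = 0 := by
    intro Z h
    rw [hE.smul] at h
    simpa using h
  have h4 := key (J 3) hB lie_neg.2.1
  refine ⟨fun i => ?_, h₁, h₂, hat⟩
  fin_cases i
  exacts [half (key (J 1) hm lie_neg.1), hm, half (key (J 4) h4 lie_neg.2.2), hB, h4, hN]

end IsRep

end Rep

/-! ### Right-invariant operators on functionals at a point -/

/-- Linear functionals on the smooth functions. -/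
abbrev Functional : Type := Module.Dual ℂ SmoothFun

/-- Evaluation at the point with coordinates `v`. -/
def evalAt (v : Coord) : Functional where
  toFun f := (f : Coord → ℂ) v
  map_add' _ _ := rfl
  map_smul' _ _ := rfl

/-- The inverse of `adj v`. -/
def adjInv (v : Coord) : Mat →ₗ[ℝ] Mat where
  toFun X := gPlus v * X * gPlusInv v
  map_add' X Y := by rw [mul_add, add_mul]
  map_smul' c X := by simp

theorem adjInv_apply (v : Coord) (X : Mat) : adjInv v X = gPlus v * X * gPlusInv v := rfl

theorem adj_adjInv (v : Coord) (X : Mat) : adj v (adjInv v X) = X := by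
  rw [adj_apply, adjInv_apply]
  simp only [mul_assoc, gPlusInv_mul, mul_one]
  rw [← mul_assoc, gPlusInv_mul, one_mul]

theorem adjInv_adj (v : Coord) (X : Mat) : adjInv v (adj v X) = X := by
  rw [adj_apply, adjInv_apply]
  simp only [mul_assoc, mul_gPlusInv, mul_one]
  rw [← mul_assoc, mul_gPlusInv, one_mul]

theorem adjInv_lie (v : Coord) (X Y : Mat) : adjInv v ⁅X, Y⁆ = ⁅adjInv v X, adjInv v Y⁆ := by
  conv_lhs => rw [← adj_adjInv v X, ← adj_adjInv v Y, ← adj_lie, adjInv_adj]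

theorem IsInfJacobi.adjInv {X : Mat} (hX : IsInfJacobi X) (v : Coord) :
    IsInfJacobi (adjInv v X) :=
  hX.conj (isJacobi_gPlusInv v) (mul_gPlusInv v)

theorem exists_adjInv_posMat (v : Coord) (y : Fin 6 → ℝ) :
    ∃ y', adjInv v (posMat y) = posMat y' := by
  obtain ⟨y', h⟩ := exists_adj_posMat v y
  exact ⟨y', by rw [← h, adjInv_adj]⟩

/-- The contragredient of the left action, conjugated to the point `v`. -/
def dualRep (Λ : Weight) (v : Coord) (Y : Mat) : Module.End ℂ Functional :=
  -(leftOp Λ (adjInv v Y)).dualMap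

theorem dualRep_apply (Λ : Weight) (v : Coord) (Y : Mat) (μ : Functional) (f : SmoothFun) :
    dualRep Λ v Y μ f = -μ (leftOp Λ (adjInv v Y) f) := rfl

theorem isRep_dualRep (Λ : Weight) (v : Coord) : IsRep (dualRep Λ v) where
  add X Y := by
    ext μ f
    simp only [dualRep_apply, map_add, LinearMap.add_apply, neg_add]
  smul c X := by
    ext μ f
    simp only [dualRep_apply, map_smul, LinearMap.smul_apply]
    rw [← Complex.coe_smul c, map_smul, smul_neg]
  lie X Y hX hY := by
    ext μ f
    have h := LinearMap.congr_fun (leftOp_lie Λ (hX.adjInv v) (hY.adjInv v)) f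
    rw [← adjInv_lie] at h
    simp only [LinearMap.add_apply, Module.End.mul_apply, dualRep_apply, neg_neg, ← h,
      LinearMap.sub_apply, map_sub]
    ring

theorem dualRep_evalAt (Λ : Weight) (v : Coord) (Y : Mat) (f : SmoothFun) :
    dualRep Λ v Y (evalAt v) f = jet Λ Y f v := by
  rw [dualRep_apply]
  change -((leftOp Λ (adjInv v Y) f : Coord → ℂ) v) = _
  rw [leftOp_apply, adj_adjInv, neg_neg]

theorem jet_eq (Λ : Weight) (y : Fin 6 → ℝ) (s : Fin 3 → ℝ) (u : Fin 6 → ℝ) (f : SmoothFun)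
    (v : Coord) : jet Λ (posMat y + cartanMat s + negMat u) f v =
      ∑ i, (y i : ℂ) * (rightOp i f : Coord → ℂ) v +
        (Λ.h₁ * s 0 + Λ.h₂ * s 1 + Λ.hat * s 2) * (f : Coord → ℂ) v := by
  simp only [jet, Weight.val, LinearMap.coe_mk, AddHom.coe_mk, posC_eq, cartC_eq]

theorem jet_posMat (Λ : Weight) (y : Fin 6 → ℝ) (f : SmoothFun) (v : Coord) :
    jet Λ (posMat y) f v = ∑ i, (y i : ℂ) * (rightOp i f : Coord → ℂ) v := by
  have h := jet_eq Λ y 0 0 f v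
  simpa [← sum_cartanGen, ← sum_negGen] using h

theorem jet_posGen (Λ : Weight) (i : Fin 6) (f : SmoothFun) (v : Coord) :
    jet Λ (posGen i) f v = (rightOp i f : Coord → ℂ) v := by
  have h := jet_posMat Λ (Pi.single i 1) f v
  rw [← sum_posGen] at h
  simpa [Pi.single_apply, apply_ite ((↑) : ℝ → ℂ)] using h

theorem jet_cartanGen (Λ : Weight) (i : Fin 3) (f : SmoothFun) (v : Coord) :
    jet Λ (cartanGen i) f v = ![Λ.h₁, Λ.h₂, Λ.hat] i * (f : Coord → ℂ) v := by
  have h := jet_eq Λ 0 (Pi.single i 1) 0 f v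
  simp only [← sum_posGen, ← sum_cartanGen, ← sum_negGen] at h
  fin_cases i <;> simpa [Pi.single_apply] using h

theorem jet_negGen (Λ : Weight) (i : Fin 6) (f : SmoothFun) (v : Coord) :
    jet Λ (negGen i) f v = 0 := by
  have h := jet_eq Λ 0 0 (Pi.single i 1) f v
  simp only [← sum_posGen, ← sum_cartanGen, ← sum_negGen] at h
  simpa [Pi.single_apply] using h

/-- After the twist, a generator acts on the evaluation through the jet at `v` itself, where `𝒢₂⁻`
acts by zero and `𝒦₂` by `Λ`. -/
theorem isSingular_evalAt (Λ : Weight) (v : Coord) :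
    IsSingular (dualRep Λ v) Λ (evalAt v) where
  neg i := by ext f; rw [dualRep_evalAt, jet_negGen]; rfl
  h₁ := by ext f; rw [dualRep_evalAt, jet_cartanGen]; rfl
  h₂ := by ext f; rw [dualRep_evalAt, jet_cartanGen]; rfl
  hat := by ext f; rw [dualRep_evalAt, jet_cartanGen]; rfl

theorem IsJacobi.mul_central {g : Mat} (hg : IsJacobi g) : g * central = central := by
  rw [central, mul_smul_comm]
  congr 1
  ext i j
  rw [unitMat, Matrix.mul_apply]
  simp only [Matrix.single_apply, mul_ite, mul_one, mul_zero]
  rw [Finset.sum_eq_single 0 (by intro b _ hb; simp [hb.symm]) (by simp), hg.col, Matrix.one_apply]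
  by_cases h : (5 : Fin 6) = j <;> simp [h, eq_comm]

theorem IsJacobi.central_mul {g : Mat} (hg : IsJacobi g) : central * g = central := by
  rw [central, smul_mul_assoc]
  congr 1
  ext i j
  rw [unitMat, Matrix.mul_apply]
  simp only [Matrix.single_apply, ite_mul, one_mul, zero_mul]
  rw [Finset.sum_eq_single 5 (by intro b _ hb; simp [hb.symm]) (by simp), hg.row, Matrix.one_apply]
  by_cases h : (0 : Fin 6) = i <;> simp [h]

theorem adj_central (v : Coord) : adj v (cartanGen 2) = cartanGen 2 := by
  change gPlusInv v * central * gPlus v = central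
  rw [(isJacobi_gPlusInv v).mul_central, (isJacobi_gPlus v).central_mul]

/-- The central element is fixed by the adjoint action, so it acts by a scalar on all functionals,
not only on evaluations. -/
theorem dualRep_central (Λ : Weight) (v : Coord) :
    dualRep Λ v (cartanGen 2) = Λ.hat • (1 : Module.End ℂ Functional) := by
  have e : leftOp Λ (adjInv v (cartanGen 2)) = -(Λ.hat • (1 : Op)) := by
    ext f w
    rw [leftOp_apply, ← adj_central v, adjInv_adj, adj_central, jet_cartanGen]
    rfl
  ext μ f
  rw [dualRep_apply, e]
  simp

/-- The pairs of an operator which commutes with the left action of `𝒢₂⁺` and its action on the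
functionals at a point. -/
def pointwise (Λ : Weight) (v : Coord) : Subalgebra ℂ (Op × Module.End ℂ Functional) where
  carrier := {x | (∀ y, Commute x.1 (leftOp Λ (posMat y))) ∧
    ∀ b : Op, (∀ y, Commute b (leftOp Λ (posMat y))) →
      evalAt v ∘ₗ (x.1 * b) = x.2 (evalAt v ∘ₗ b)}
  mul_mem' := by
    rintro ⟨a, A⟩ ⟨a', A'⟩ ⟨h1, h2⟩ ⟨h1', h2'⟩
    refine ⟨fun y => (h1 y).mul_left (h1' y), fun b hb => ?_⟩
    have e := h2 (a' * b) fun y => (h1' y).mul_left (hb y)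
    change evalAt v ∘ₗ ((a * a') * b) = A (A' (evalAt v ∘ₗ b))
    rw [← h2' b hb, mul_assoc]
    exact e
  add_mem' := by
    rintro ⟨a, A⟩ ⟨a', A'⟩ ⟨h1, h2⟩ ⟨h1', h2'⟩
    refine ⟨fun y => (h1 y).add_left (h1' y), fun b hb => ?_⟩
    change evalAt v ∘ₗ ((a + a') * b) = A (evalAt v ∘ₗ b) + A' (evalAt v ∘ₗ b)
    rw [← h2' b hb, ← h2 b hb, add_mul, LinearMap.comp_add]
  algebraMap_mem' c := by
    refine ⟨fun y => Algebra.commute_algebraMap_left c _, fun b hb => ?_⟩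
    ext f
    change evalAt v ((algebraMap ℂ Op c) (b f)) =
      (algebraMap ℂ (Module.End ℂ Functional) c (evalAt v ∘ₗ b)) f
    simp [Module.algebraMap_end_apply]

/-- At `v` a right derivative equals minus the left action of the conjugated generator. That
generator lies in `𝒢₂⁺`, so its left action may be moved past `b`; hence products keep their order.
-/
theorem rightOp_mem_pointwise (Λ : Weight) (v : Coord) (i : Fin 6) :
    (rightOp i, dualRep Λ v (posGen i)) ∈ pointwise Λ v := by
  refine ⟨fun y => rightOp_leftOp_comm Λ y i, fun b hb => ?_⟩
  ext f
  have hy : posGen i = posMat (Pi.single i 1) := by rw [← sum_posGen]; simp [Pi.single_apply]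
  obtain ⟨y', h⟩ := exists_adjInv_posMat v (Pi.single i 1)
  rw [← hy] at h
  have hc := LinearMap.congr_fun (hb y').eq f
  rw [← h] at hc
  have hj := jet_posGen Λ i (b f) v
  rw [← dualRep_evalAt, dualRep_apply] at hj
  rw [dualRep_apply]
  change (rightOp i (b f) : Coord → ℂ) v = -(evalAt v (b (leftOp Λ (adjInv v (posGen i)) f)))
  rw [← hj]
  exact congrArg (fun g => -(evalAt v g)) hc.symm

/-! ### Intertwining operators -/

theorem leftOp_posMat (Λ Λ' : Weight) (y : Fin 6 → ℝ) :
    leftOp Λ (posMat y) = leftOp Λ' (posMat y) := by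
  ext f v
  rw [leftOp_apply, leftOp_apply, adj_posMat, jet_posMat, jet_posMat]

/-- An operator which maps evaluations to singular vectors intertwines the left actions. -/
theorem mul_leftOp {Λ Λ' : Weight} {a : Op}
    (h : ∀ v, ∃ A, (a, A) ∈ pointwise Λ v ∧ IsSingular (dualRep Λ v) Λ' (A (evalAt v)))
    {X : Mat} (hX : IsInfJacobi X) : a * leftOp Λ X = leftOp Λ' X * a := by
  ext f v
  obtain ⟨A, ⟨hc, hA⟩, hs⟩ := h v
  have hA' : ∀ g, A (evalAt v) g = (a g : Coord → ℂ) v := fun g =>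
    (LinearMap.congr_fun (hA 1 fun y => Commute.one_left _) g).symm
  have hE := isRep_dualRep Λ v
  -- The positive part is handled by commutation with left translations, the Cartan part by the
  -- weight `Λ'`, and the negative part by singularity. Only the first needs more than the vector at
  -- `v`.
  have key : ∀ Y, IsInfJacobi Y →
      dualRep Λ v Y (A (evalAt v)) f = jet Λ' Y (a f) v := by
    intro Y hY
    obtain ⟨y, s, u, rfl⟩ := (isInfJacobi_iff Y).mp hY
    have hp : dualRep Λ v (posMat y) (A (evalAt v)) f = jet Λ' (posMat y) (a f) v := by
      obtain ⟨y', e⟩ := exists_adjInv_posMat v y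
      rw [dualRep_apply, hA', ← dualRep_evalAt, dualRep_apply, e, leftOp_posMat Λ' Λ]
      exact congrArg (fun g => -(evalAt v g)) (LinearMap.congr_fun (hc y').eq f)
    let lin (μ : Functional) : Mat →ₗ[ℝ] Functional :=
      { toFun := fun Y => dualRep Λ v Y μ
        map_add' := fun X Y => LinearMap.congr_fun (hE.add X Y) μ
        map_smul' := fun c X => LinearMap.congr_fun (hE.smul c X) μ }
    have hk : dualRep Λ v (cartanMat s) (A (evalAt v)) f =
        (Λ'.h₁ * s 0 + Λ'.h₂ * s 1 + Λ'.hat * s 2) * (a f : Coord → ℂ) v := by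
      have e := LinearMap.congr_fun
        (map_sum (lin (A (evalAt v))) (fun i => s i • cartanGen i) Finset.univ) f
      rw [sum_cartanGen] at e
      refine e.trans ?_
      simp only [map_smul, Fin.sum_univ_three]
      change (s 0 : ℂ) * dualRep Λ v (cartanGen 0) (A (evalAt v)) f +
        (s 1 : ℂ) * dualRep Λ v (cartanGen 1) (A (evalAt v)) f +
        (s 2 : ℂ) * dualRep Λ v (cartanGen 2) (A (evalAt v)) f = _
      rw [hs.h₁, hs.h₂, hs.hat]
      simp only [LinearMap.smul_apply, hA', smul_eq_mul]
      ring
    have hn : dualRep Λ v (negMat u) (A (evalAt v)) = 0 := by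
      rw [← sum_negGen]
      refine (map_sum (lin (A (evalAt v))) (fun i => u i • negGen i) Finset.univ).trans ?_
      refine Finset.sum_eq_zero fun i _ => ?_
      rw [map_smul]
      exact (congrArg (u i • ·) (hs.neg i)).trans (smul_zero _)
    rw [hE.add, hE.add, LinearMap.add_apply, LinearMap.add_apply, hn,
      LinearMap.zero_apply, add_zero, LinearMap.add_apply, LinearMap.add_apply, hp, hk,
      jet_posMat, jet_eq]
  have hk := key _ (hX.adj v)
  rw [dualRep_apply, adjInv_adj, hA', neg_eq_iff_eq_neg] at hk
  exact hk.trans (leftOp_apply Λ' X (a f) v).symm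

theorem intertwines {Λ Λ' : Weight} {a : Op}
    (h : ∀ v, ∃ A, (a, A) ∈ pointwise Λ v ∧ IsSingular (dualRep Λ v) Λ' (A (evalAt v))) :
    Intertwines Λ Λ' a := by
  let T : CovFun Λ →ₗ[ℂ] CovFun Λ' :=
    (restrictEquiv Λ').symm.toLinearMap ∘ₗ a ∘ₗ (restrictEquiv Λ).toLinearMap
  have hT : ∀ F, restrict Λ' (T F) = a (restrict Λ F) := fun F =>
    (restrictEquiv Λ').apply_symm_apply (a (restrict Λ F))
  have hTX : ∀ (X : jacobiAlgebra) F, T (leftRep Λ X F) = leftRep Λ' X (T F) := by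
    intro X F
    apply (restrictEquiv Λ').injective
    rw [restrictEquiv_apply, restrictEquiv_apply, hT, restrict_leftRep, restrict_leftRep, hT]
    exact LinearMap.congr_fun (mul_leftOp h ((mem_jacobiAlgebra_iff _).mp X.2)) _
  refine ⟨leftRep Λ, leftRep Λ', T, isLeftAction_leftRep Λ, isLeftAction_leftRep Λ', hT, ?_⟩
  intro X Y
  refine LinearMap.ext fun F => ?_
  simp only [LinearMap.comp_apply, LinearMap.add_apply, LinearMap.smul_apply, map_add,
    map_smul, hTX]

theorem isRightSubstitution_of_eq {𝒟 : Op} {P : (Fin 6 → Op) → Op} (h : 𝒟 = P rightOp) :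
    IsRightSubstitution 𝒟 P :=
  ⟨rightOp, isRightAction_rightOp, h⟩

/-! ### The coefficients -/

theorem gammaFall_succ (x : ℂ) (m : ℕ) : gammaFall x (m + 1) = gammaFall x m * (x - 1 - m) := by
  rw [gammaFall, gammaFall, Finset.prod_range_succ]

theorem gammaFall_nat {p m : ℕ} (h : m ≤ p) :
    gammaFall (p + 1) m = (p ! : ℂ) / ((p - m)! : ℂ) := by
  rw [eq_div_iff (by exact_mod_cast (Nat.factorial_ne_zero _))]
  induction m with
  | zero => simp [gammaFall]
  | succ m ih =>
    rw [← ih (by omega), gammaFall_succ, show p - m = p - (m + 1) + 1 by omega,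
      Nat.factorial_succ]
    push_cast [Nat.cast_sub h]
    ring

theorem gammaFall_nat_of_lt {p m : ℕ} (h : p < m) : gammaFall (p + 1) m = 0 :=
  Finset.prod_eq_zero (Finset.mem_range.mpr h) (by ring)

/-- Reflection `x ↦ 1 - x`, which brings type (v) into the common form. -/
theorem gammaRise_eq_gammaFall (x : ℂ) (m : ℕ) :
    gammaRise x m = (-1) ^ m * gammaFall (1 - x) m := by
  rw [gammaRise, gammaFall, ← Finset.card_range m, ← Finset.prod_const, Finset.card_range,
    ← Finset.prod_mul_distrib]
  exact Finset.prod_congr rfl fun j _ => by ring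

/-- The common form of the coefficients of types (iii), (iv) and (v). -/
def coeffHat (x y : ℂ) (k n : ℕ) : ℂ :=
  gammaFall x (2 * k + n) * gammaFall y (k + n) / (4 ^ k * (k ! : ℂ) * (n ! : ℂ))

/-- The two indices have equal `k + n`, while `2 * k + n` differs by one: only the factorial in `x`
changes. -/
theorem coeffHat_succ_pred (x y : ℂ) (k n : ℕ) :
    ((k : ℂ) + 1) * coeffHat x y (k + 1) n =
      (x - 2 - 2 * k - n) * (n + 1) / 4 * coeffHat x y k (n + 1) := by
  have h : 2 * (k + 1) + n = 2 * k + (n + 1) + 1 := by ring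
  have h' : k + 1 + n = k + (n + 1) := by ring
  have hk : (k : ℂ) + 1 ≠ 0 := Nat.cast_add_one_ne_zero k
  have hn : (n : ℂ) + 1 ≠ 0 := Nat.cast_add_one_ne_zero n
  have hk' : (k ! : ℂ) ≠ 0 := by exact_mod_cast Nat.factorial_ne_zero k
  have hn' : (n ! : ℂ) ≠ 0 := by exact_mod_cast Nat.factorial_ne_zero n
  rw [coeffHat, coeffHat, h, h', gammaFall_succ, Nat.factorial_succ, Nat.factorial_succ, pow_succ]
  push_cast
  field_simp
  ring

theorem coeffHat_succ (x y : ℂ) (k n : ℕ) :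
    ((n : ℂ) + 1) * coeffHat x y k (n + 1) =
      (x - 1 - 2 * k - n) * (y - 1 - k - n) * coeffHat x y k n := by
  have hn : (n : ℂ) + 1 ≠ 0 := Nat.cast_add_one_ne_zero n
  have hk' : (k ! : ℂ) ≠ 0 := by exact_mod_cast Nat.factorial_ne_zero k
  have hn' : (n ! : ℂ) ≠ 0 := by exact_mod_cast Nat.factorial_ne_zero n
  rw [coeffHat, coeffHat, ← add_assoc, ← add_assoc, gammaFall_succ, gammaFall_succ,
    Nat.factorial_succ]
  push_cast
  field_simp
  ring

/-- Here `2 * k + n` is the same on both sides, so only the factorial in `y` changes. -/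
theorem coeffHat_pred_succ (x y : ℂ) (k n : ℕ) :
    ((n : ℂ) + 2) * (n + 1) / 4 * coeffHat x y k (n + 2) =
      (k + 1) * (y - 2 - k - n) * coeffHat x y (k + 1) n := by
  have h : 2 * k + (n + 2) = 2 * (k + 1) + n := by ring
  have h' : k + (n + 2) = k + 1 + n + 1 := by ring
  have hk : (k : ℂ) + 1 ≠ 0 := Nat.cast_add_one_ne_zero k
  have hn : (n : ℂ) + 1 ≠ 0 := Nat.cast_add_one_ne_zero n
  have hn2 : (n : ℂ) + 1 + 1 ≠ 0 := by exact_mod_cast Nat.succ_ne_zero (n + 1)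
  have hk' : (k ! : ℂ) ≠ 0 := by exact_mod_cast Nat.factorial_ne_zero k
  have hn' : (n ! : ℂ) ≠ 0 := by exact_mod_cast Nat.factorial_ne_zero n
  rw [coeffHat, coeffHat, h, h', gammaFall_succ, Nat.factorial_succ, Nat.factorial_succ,
    Nat.factorial_succ, pow_succ]
  push_cast
  field_simp
  ring

theorem coeffIII_eq {p q k n : ℕ} (hp : 2 * k + n ≤ p) (hq : k + n ≤ q) :
    coeffIII p q k n = coeffHat (p + 1) (q + 1) k n := by
  rw [coeffIII, coeffHat, gammaFall_nat hp, gammaFall_nat hq, Nat.sub_sub, Nat.sub_sub,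
    div_mul_div_comm, div_div]
  congr 1
  ring

theorem coeffIV_eq (x : ℂ) {p k n : ℕ} (hp : 2 * k + n ≤ p) :
    coeffIV x p k n = coeffHat (p + 1) (2 * x + p - 3 / 2) k n := by
  rw [coeffIV, coeffHat, gammaFall_nat hp, Nat.sub_sub, div_mul_eq_mul_div, div_mul_eq_mul_div,
    div_div]
  congr 1
  ring

theorem coeffV_eq (x : ℂ) {p k n : ℕ} (hp : k + n ≤ p) :
    coeffV x p k n = coeffHat (p + 5 / 2 - 2 * x) (p + 1) k n := by
  have e : 1 - (2 * x - p - 3 / 2) = (p : ℂ) + 5 / 2 - 2 * x := by ring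
  -- The sign in the coefficient cancels the sign produced by reflection.
  have s : (-1 : ℂ) ^ n * (-1) ^ (2 * k + n) = 1 := by
    rw [← pow_add, show n + (2 * k + n) = 2 * (k + n) by ring, pow_mul]
    simp
  rw [coeffV, coeffHat, gammaFall_nat hp, Nat.sub_sub, gammaRise_eq_gammaFall, e]
  linear_combination (gammaFall (p + 5 / 2 - 2 * x) (2 * k + n) *
    ((p ! : ℂ) / ((p - (k + n))! : ℂ)) /
    (4 ^ k * (k ! : ℂ) * (n ! : ℂ))) * s

/-! ### The double sums as sums over a common region -/

section Sums

variable {A : Type} [Ring A] [Algebra ℂ A]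

/-- The terms `B₁ᵏ B₂ˡ Cⁿ Dᵐ` of a fixed weight. -/
def sumHat (W : ℕ → ℕ → ℕ → ℕ → A) (l₀ m₀ : ℕ) (κ : ℕ → ℕ → ℂ) : A :=
  ∑ x ∈ region l₀ m₀, κ x.1 x.2 • W x.1 (l₀ - x.1 - x.2) x.2 (m₀ - 2 * x.1 - x.2)

theorem sum_eq_sumHat (W : ℕ → ℕ → ℕ → ℕ → A) {l₀ m₀ : ℕ} {s : Finset ℕ} {t : ℕ → Finset ℕ}
    {c κ : ℕ → ℕ → ℂ} (h : ∀ k n, (k + n ≤ l₀ ∧ 2 * k + n ≤ m₀) ↔ k ∈ s ∧ n ∈ t k)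
    (hc : ∀ k n, k + n ≤ l₀ → 2 * k + n ≤ m₀ → c k n = κ k n) :
    ∑ k ∈ s, ∑ n ∈ t k, c k n • W k (l₀ - k - n) n (m₀ - 2 * k - n) = sumHat W l₀ m₀ κ := by
  rw [sumHat, ← Finset.sum_finset_product' (region l₀ m₀) s t
    (fun x => mem_region.trans (h x.1 x.2))
    (f := fun k n => c k n • W k (l₀ - k - n) n (m₀ - 2 * k - n))]
  refine Finset.sum_congr rfl fun x hx => ?_
  rw [hc _ _ (mem_region.mp hx).1 (mem_region.mp hx).2]

theorem sumIIIa_eq (W : ℕ → ℕ → ℕ → ℕ → A) {p q : ℕ} (h : p < q) :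
    sumIIIa W p q = sumHat W q p (coeffHat (p + 1) (q + 1)) :=
  sum_eq_sumHat W (fun k n => by simp only [Finset.mem_Icc]; omega)
    fun _ _ hq hp => coeffIII_eq hp hq

/-- The two upper bounds `q - k` and `p - 2 * k` for `n` cross at `k = p - q`, which is where the
sum is split. -/
theorem sumIIIb_eq (W : ℕ → ℕ → ℕ → ℕ → A) {p q : ℕ} (h : q < p) (h' : p < 2 * q) :
    sumIIIb W p q = sumHat W q p (coeffHat (p + 1) (q + 1)) := by
  rw [← sum_eq_sumHat W (s := Finset.Icc 0 (p - q) ∪ Finset.Icc (p - q + 1) (p / 2))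
    (t := fun k => if k ≤ p - q then Finset.Icc 0 (q - k) else Finset.Icc 0 (p - 2 * k))
    (c := coeffIII p q) (fun k n => ?_) fun _ _ hq hp => coeffIII_eq hp hq, sumIIIb,
    Finset.sum_union]
  · congr 1
    · refine Finset.sum_congr rfl fun k hk => ?_
      rw [if_pos (Finset.mem_Icc.mp hk).2]
    · refine Finset.sum_congr rfl fun k hk => ?_
      rw [if_neg (by have := (Finset.mem_Icc.mp hk).1; omega)]
  · rw [Finset.disjoint_left]
    intro k hk hk'
    rw [Finset.mem_Icc] at hk hk'
    omega
  · rw [Finset.mem_union, Finset.mem_Icc, Finset.mem_Icc]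
    split_ifs <;> rw [Finset.mem_Icc] <;> omega

theorem sumIIIc_eq (W : ℕ → ℕ → ℕ → ℕ → A) {p q : ℕ} (h : 2 * q < p) :
    sumIIIc W p q = sumHat W q p (coeffHat (p + 1) (q + 1)) :=
  sum_eq_sumHat W (fun k n => by simp only [Finset.mem_Icc]; omega)
    fun _ _ hq hp => coeffIII_eq hp hq

theorem sumIV_eq (W : ℕ → ℕ → ℕ → ℕ → A) (x : ℂ) (p : ℕ) :
    sumIV W x p = sumHat W p p (coeffHat (p + 1) (2 * x + p - 3 / 2)) :=
  sum_eq_sumHat W (fun k n => by simp only [Finset.mem_Icc]; omega)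
    fun _ _ _ hp => coeffIV_eq x hp

theorem sumV_eq (W : ℕ → ℕ → ℕ → ℕ → A) (x : ℂ) (p : ℕ) :
    sumV W x p = sumHat W p (2 * p) (coeffHat (p + 5 / 2 - 2 * x) (p + 1)) :=
  sum_eq_sumHat W (fun k n => by simp only [Finset.mem_Icc]; omega)
    fun _ _ hp _ => coeffV_eq x hp

end Sums

/-! ### The five types of intertwining operators -/

theorem hatWord_prod {A B : Type} [Ring A] [Algebra ℂ A] [Ring B] [Algebra ℂ B] (a : Fin 6 → A)
    (b : Fin 6 → B) (k l n m : ℕ) : hatWord (fun i => (a i, b i)) k l n m =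
      (hatWord a k l n m, hatWord b k l n m) :=
  Prod.ext (by simp [hatWord]) (by simp [hatWord])

theorem hatWord_mem {A : Type} [Ring A] [Algebra ℂ A] (S : Subalgebra ℂ A) {ρ : Fin 6 → A}
    (h : ∀ i, ρ i ∈ S) (k l n m : ℕ) : hatWord ρ k l n m ∈ S :=
  S.mul_mem (S.mul_mem (S.mul_mem
    (S.pow_mem (S.sub_mem (h 2) (S.smul_mem (S.pow_mem (h 0) 2) _)) k)
    (S.pow_mem (S.sub_mem (h 3) (S.smul_mem (S.pow_mem (h 1) 2) _)) l))
    (S.pow_mem (S.sub_mem (h 4) (S.smul_mem (S.mul_mem (h 0) (h 1)) _)) n))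
    (S.pow_mem (h 5) m)

theorem opWord_eq : opWord = hatWord rightOp := by
  funext k l n m
  have h0 : rightOp 0 = dξ₁ := rfl
  have h1 : rightOp 1 = dξ₂ := rfl
  have h2 : rightOp 2 = dη₁ := rfl
  have h3 : rightOp 3 = dη₂ := rfl
  have h4 : rightOp 4 = dζ := rfl
  have h5 : rightOp 5 = opD := rfl
  rw [opWord, hatWord, h0, h1, h2, h3, h4, h5, opB₁, opB₂, opC]

theorem hatWord_mem_pointwise (Λ : Weight) (v : Coord) (k l n m : ℕ) :
    (opWord k l n m, hatWord (fun i => dualRep Λ v (posGen i)) k l n m) ∈ pointwise Λ v := by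
  rw [opWord_eq, ← hatWord_prod]
  exact hatWord_mem (pointwise Λ v) (ρ := fun i => (rightOp i, dualRep Λ v (posGen i)))
    (rightOp_mem_pointwise Λ v) k l n m

theorem sumHat_mem_pointwise (Λ : Weight) (v : Coord) (l₀ m₀ : ℕ) (κ : ℕ → ℕ → ℂ) :
    (sumHat opWord l₀ m₀ κ, sumHat (hatWord fun i => dualRep Λ v (posGen i)) l₀ m₀ κ) ∈
      pointwise Λ v := by
  have e : (sumHat opWord l₀ m₀ κ, sumHat (hatWord fun i => dualRep Λ v (posGen i)) l₀ m₀ κ) =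
      ∑ x ∈ region l₀ m₀, κ x.1 x.2 •
        (opWord x.1 (l₀ - x.1 - x.2) x.2 (m₀ - 2 * x.1 - x.2),
          hatWord (fun i => dualRep Λ v (posGen i)) x.1 (l₀ - x.1 - x.2) x.2
            (m₀ - 2 * x.1 - x.2)) := by
    refine Prod.ext ?_ ?_
    · rw [Prod.fst_sum]; rfl
    · rw [Prod.snd_sum]; rfl
  rw [e]
  exact Subalgebra.sum_mem _ fun x _ =>
    (pointwise Λ v).smul_mem (hatWord_mem_pointwise Λ v _ _ _ _) _

theorem dualRep_central_eq_one {Λ : Weight} (hat : Λ.hat = 1) (v : Coord) :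
    dualRep Λ v (cartanGen 2) = 1 := by
  rw [dualRep_central, hat, one_smul]

theorem shift_eq {Λ : Weight} {m₁ m₂ m₁' m₂' : ℤ} (h₁ : m₁ = m₁') (h₂ : m₂ = m₂') :
    Λ.shift m₁ m₂ = Λ.shift m₁' m₂' := by rw [h₁, h₂]

/-- No hatted generator occurs and `d⁺` commutes with `b₂⁻` and `a₂⁻`, so the central character is
free. -/
theorem intertwines_opI (Λ : Weight) (p : ℕ) (h : Λ.h₁ - Λ.h₂ = (1 / 2) * (1 - (p : ℂ))) :
    Intertwines Λ (Λ.shift p (-p)) (opI p) := by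
  refine intertwines fun v => ⟨dualRep Λ v (posGen 5) ^ p,
    (pointwise Λ v).pow_mem (rightOp_mem_pointwise Λ v 5) p, ?_⟩
  have hE := isRep_dualRep Λ v
  let S : RaisingData Functional := hE.raisingData (isSingular_evalAt Λ v)
  refine hE.isSingular ((S.N_pow p).trans ?_) (RaisingData.comm_pow S.B_D S.B_vac p)
    (RaisingData.comm_pow S.m_D S.m_vac p) ((S.h₁_pow p).trans ?_) ((S.h₂_pow p).trans ?_) ?_
  · have e : (p : ℂ) / 2 * (S.w₂ - S.w₁ - (p - 1) / 2) = 0 := by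
      change (p : ℂ) / 2 * (Λ.h₂ - Λ.h₁ - (p - 1) / 2) = 0
      linear_combination (-(p : ℂ) / 2) * h
    rw [e, zero_smul]
  · simp only [Weight.shift]
    push_cast
    rfl
  · simp only [Weight.shift]
    push_cast
    rw [neg_div, ← sub_eq_add_neg]
    rfl
  · rw [dualRep_central]
    rfl

theorem intertwines_opII {Λ : Weight} {p : ℕ} (hat : Λ.hat = 1) (h : Λ.h₂ = 3 / 4 - (p : ℂ) / 2) :
    Intertwines Λ (Λ.shift 0 (2 * p)) (opII p) := by
  have e : opII p = opWord 0 p 0 0 := by simp [opII, opWord]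
  rw [e]
  refine intertwines fun v => ⟨_, hatWord_mem_pointwise Λ v 0 p 0 0, ?_⟩
  have hE := isRep_dualRep Λ v
  let S : HatData Functional :=
    hE.hatData (dualRep_central_eq_one hat v) (isSingular_evalAt Λ v)
  have hS : hatWord (fun i => dualRep Λ v (posGen i)) 0 p 0 0 (evalAt v) = S.word 0 p 0 0 := rfl
  have hw : S.w₂ = 3 / 4 - (p : ℂ) / 2 := h
  rw [hS]
  refine hE.isSingular ((S.N_word 0 p 0 0).trans ?_) ((S.B_word 0 p 0 0).trans ?_)
    (S.m_word 0 p 0 0) ((S.h₁_word 0 p 0 0).trans ?_) ((S.h₂_word 0 p 0 0).trans ?_) ?_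
  · simp
  · rw [hw]
    simp only [Nat.cast_zero, zero_smul, zero_mul, zero_div, add_zero, sub_zero]
    rw [show 2 * (3 / 4 - (p : ℂ) / 2) - 3 / 2 + p = 0 by ring, mul_zero, zero_smul]
  · congr 1
    change Λ.h₁ + ((0 : ℕ) : ℂ) / 2 + ((0 : ℕ) : ℂ) / 2 + ((0 : ℕ) : ℂ) = Λ.h₁ + ((0 : ℤ) : ℂ) / 2
    simp
  · congr 1
    change Λ.h₂ - ((0 : ℕ) : ℂ) / 2 + ((0 : ℕ) : ℂ) / 2 + p = Λ.h₂ + ((2 * p : ℤ) : ℂ) / 2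
    push_cast
    ring
  · rw [dualRep_central]
    rfl

/-- By contiguity each recursion becomes `coeffHat x y k n` times a polynomial in `k` and `n`. `hN`
and `hB` ask that these polynomials vanish identically, which fixes `x`, `y` and the weight in each
family. -/
theorem intertwines_sumHat {Λ : Weight} (hat : Λ.hat = 1) {l₀ m₀ : ℕ} {x y : ℂ}
    (hout : ∀ k n, l₀ < k + n ∨ m₀ < 2 * k + n → coeffHat x y k n = 0)
    (hN : ∀ t u : ℂ, (x - 1 - 2 * t - u) * (u / 4 + (y - 1 - t - u) / 2) +
      (m₀ - 2 * t - u) / 2 * (Λ.h₂ - Λ.h₁ - (m₀ - 2 * t - u - 1) / 2) = 0)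
    (hB : ∀ t u : ℂ, (l₀ - t - u) * (2 * Λ.h₂ - 3 / 2 + (l₀ - t - u) + u - (m₀ - 2 * t - u)) +
      (y - 1 - t - u) * (x - 1 - t - u) = 0) :
    Intertwines Λ (Λ.shift m₀ (2 * l₀ - m₀)) (sumHat opWord l₀ m₀ (coeffHat x y)) := by
  refine intertwines fun v => ⟨_, sumHat_mem_pointwise Λ v l₀ m₀ _, ?_⟩
  have hE := isRep_dualRep Λ v
  let S : HatData Functional := hE.hatData (dualRep_central_eq_one hat v) (isSingular_evalAt Λ v)
  have e : sumHat (hatWord fun i => dualRep Λ v (posGen i)) l₀ m₀ (coeffHat x y) (evalAt v) =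
      S.vec l₀ m₀ (coeffHat x y) := by
    rw [sumHat, HatData.vec, LinearMap.sum_apply]
    exact Finset.sum_congr rfl fun _ _ => rfl
  rw [e]
  refine hE.isSingular (S.N_vec l₀ m₀ _ hout fun k n _ _ => ?_)
    (S.B_vec l₀ m₀ _ hout fun k n _ _ => ?_) (S.m_vec l₀ m₀ _)
    ((S.h₁_vec l₀ m₀ _).trans ?_) ((S.h₂_vec l₀ m₀ _).trans ?_) ?_
  · change _ + _ + ((m₀ : ℂ) - 2 * k - n) / 2 * (Λ.h₂ - Λ.h₁ - (m₀ - 2 * k - n - 1) / 2) * _ = 0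
    have hs := coeffHat_succ x y k n
    have key : (if n = 0 then 0 else ((k : ℂ) + 1) * coeffHat x y (k + 1) (n - 1)) =
        (x - 1 - 2 * k - n) * n / 4 * coeffHat x y k n := by
      cases n with
      | zero => simp
      | succ n =>
        rw [if_neg (Nat.succ_ne_zero n), Nat.add_sub_cancel, coeffHat_succ_pred]
        push_cast
        ring
    linear_combination coeffHat x y k n * hN k n + key + hs / 2
  · change ((l₀ : ℂ) - k - n) * (2 * Λ.h₂ - 3 / 2 + (l₀ - k - n) + n - (m₀ - 2 * k - n)) * _ +
      _ + _ = 0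
    have hs := coeffHat_succ x y k n
    have key : (if k = 0 then 0 else ((n : ℂ) + 2) * (n + 1) / 4 * coeffHat x y (k - 1) (n + 2)) =
        k * (y - 1 - k - n) * coeffHat x y k n := by
      cases k with
      | zero => simp
      | succ k =>
        rw [if_neg (Nat.succ_ne_zero k), Nat.add_sub_cancel, coeffHat_pred_succ]
        push_cast
        ring
    linear_combination coeffHat x y k n * hB k n + key + hs
  · simp only [Weight.shift]
    push_cast
    rfl
  · congr 1
    change Λ.h₂ + l₀ - (m₀ : ℂ) / 2 = Λ.h₂ + _
    push_cast
    ring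
  · rw [dualRep_central]
    rfl

theorem intertwines_sumHat_III {Λ : Weight} {p q : ℕ} (hat : Λ.hat = 1)
    (h₁ : Λ.h₁ = 5 / 4 - (1 / 2) * ((p : ℂ) - q)) (h₂ : Λ.h₂ = 3 / 4 - (1 / 2) * (q : ℂ)) :
    Intertwines Λ (Λ.shift p (2 * q - p)) (sumHat opWord q p (coeffHat (p + 1) (q + 1))) := by
  refine intertwines_sumHat hat (fun k n h => ?_) (fun t u => ?_) fun t u => ?_
  -- Each of the two integral factorials provides one edge of the region.
  · rcases h with h | h <;> rw [coeffHat, gammaFall_nat_of_lt h] <;> simp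
  · rw [h₁, h₂]; ring
  · rw [h₂]; ring

theorem intertwines_opIV {Λ : Weight} {p : ℕ} (hat : Λ.hat = 1)
    (h : Λ.h₁ + Λ.h₂ = 2 - (p : ℂ) / 2) : Intertwines Λ (Λ.shift p p) (opIV Λ.h₁ p) := by
  rw [opIV, sumIV_eq, shift_eq (Eq.refl (p : ℤ)) (show (p : ℤ) = 2 * p - p by ring)]
  have h₂ : Λ.h₂ = 2 - (p : ℂ) / 2 - Λ.h₁ := by linear_combination h
  refine intertwines_sumHat hat (fun k n h => ?_) (fun t u => ?_) fun t u => ?_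
  -- With `l₀ = m₀ = p`, either inequality gives `p < 2 * k + n`, so the integral factorial in `x`
  -- alone suffices.
  · rw [coeffHat, gammaFall_nat_of_lt (by omega)]; simp
  · rw [h₂]; ring
  · rw [h₂]; ring

theorem intertwines_opV {Λ : Weight} {p : ℕ} (hat : Λ.hat = 1)
    (h : Λ.h₁ = 5 / 4 - (p : ℂ) / 2) : Intertwines Λ (Λ.shift (2 * p) 0) (opV Λ.h₂ p) := by
  rw [opV, sumV_eq, shift_eq (show 2 * (p : ℤ) = (2 * p : ℕ) by push_cast; ring)
    (show (0 : ℤ) = 2 * p - (2 * p : ℕ) by push_cast; ring)]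
  refine intertwines_sumHat hat (fun k n h => ?_) (fun t u => ?_) fun t u => ?_
  -- With `l₀ = p` and `m₀ = 2 * p`, either inequality gives `p < k + n`, so the factorial in `y`
  -- suffices.
  · rw [coeffHat, gammaFall_nat_of_lt (show p < k + n by omega)]; simp
  · rw [h]; push_cast; ring
  · push_cast; ring

end JacobiG2

end

/-! ### Assembly of the five families -/

theorem mainTheorem1 :
    -- right covariant functions are the smooth functions on `G⁺`
    (∀ Λ : JacobiG2.Weight, Function.Bijective (JacobiG2.restrict Λ)) ∧
    -- (i)
    (∀ (Λ : JacobiG2.Weight) (p : ℕ), 0 < p → Λ.h₁ - Λ.h₂ = (1 / 2) * (1 - (p : ℂ)) →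
      JacobiG2.IsRightSubstitution (JacobiG2.opI p) (fun ρ => ρ 5 ^ p) ∧
      JacobiG2.Intertwines Λ (Λ.shift p (-p)) (JacobiG2.opI p)) ∧
    -- (ii)
    (∀ (Λ : JacobiG2.Weight) (p : ℕ), 0 < p → Λ.hat = 1 → Λ.h₂ = 3 / 4 - (p : ℂ) / 2 →
      JacobiG2.IsRightSubstitution (JacobiG2.opII p)
        (fun ρ => (ρ 3 - (1 / 2 : ℂ) • ρ 1 ^ 2) ^ p) ∧
      JacobiG2.Intertwines Λ (Λ.shift 0 (2 * p)) (JacobiG2.opII p)) ∧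
    -- (iii)
    (∀ (Λ : JacobiG2.Weight) (p q : ℕ), 0 < p → 0 < q → Λ.hat = 1 →
      Λ.h₁ = 5 / 4 - (1 / 2) * ((p : ℂ) - q) → Λ.h₂ = 3 / 4 - (1 / 2) * (q : ℂ) →
      (p < q →
        JacobiG2.IsRightSubstitution (JacobiG2.opIIIa p q)
          (fun ρ => JacobiG2.sumIIIa (JacobiG2.hatWord ρ) p q) ∧
        JacobiG2.Intertwines Λ (Λ.shift p (2 * q - p)) (JacobiG2.opIIIa p q)) ∧
      (q < p → p < 2 * q →
        JacobiG2.IsRightSubstitution (JacobiG2.opIIIb p q)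
          (fun ρ => JacobiG2.sumIIIb (JacobiG2.hatWord ρ) p q) ∧
        JacobiG2.Intertwines Λ (Λ.shift p (2 * q - p)) (JacobiG2.opIIIb p q)) ∧
      (2 * q < p →
        JacobiG2.IsRightSubstitution (JacobiG2.opIIIc p q)
          (fun ρ => JacobiG2.sumIIIc (JacobiG2.hatWord ρ) p q) ∧
        JacobiG2.Intertwines Λ (Λ.shift p (2 * q - p)) (JacobiG2.opIIIc p q))) ∧
    -- (iv)
    (∀ (Λ : JacobiG2.Weight) (p : ℕ), 0 < p → Λ.hat = 1 → Λ.h₁ + Λ.h₂ = 2 - (p : ℂ) / 2 →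
      JacobiG2.IsRightSubstitution (JacobiG2.opIV Λ.h₁ p)
        (fun ρ => JacobiG2.sumIV (JacobiG2.hatWord ρ) Λ.h₁ p) ∧
      JacobiG2.Intertwines Λ (Λ.shift p p) (JacobiG2.opIV Λ.h₁ p)) ∧
    -- (v)
    (∀ (Λ : JacobiG2.Weight) (p : ℕ), 0 < p → Λ.hat = 1 → Λ.h₁ = 5 / 4 - (p : ℂ) / 2 →
      JacobiG2.IsRightSubstitution (JacobiG2.opV Λ.h₂ p)
        (fun ρ => JacobiG2.sumV (JacobiG2.hatWord ρ) Λ.h₂ p) ∧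
      JacobiG2.Intertwines Λ (Λ.shift (2 * p) 0) (JacobiG2.opV Λ.h₂ p)) := by
  open JacobiG2 in
  refine ⟨restrict_bijective, fun Λ p _ h => ⟨isRightSubstitution_of_eq rfl, intertwines_opI Λ p h⟩,
    fun Λ p _ hat h => ⟨isRightSubstitution_of_eq rfl, intertwines_opII hat h⟩,
    fun Λ p q _ _ hat h₁ h₂ => ⟨fun hpq => ⟨isRightSubstitution_of_eq ?_, ?_⟩,
      fun hqp hpq => ⟨isRightSubstitution_of_eq ?_, ?_⟩,
      fun hpq => ⟨isRightSubstitution_of_eq ?_, ?_⟩⟩,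
    fun Λ p _ hat h => ⟨isRightSubstitution_of_eq ?_, intertwines_opIV hat h⟩,
    fun Λ p _ hat h => ⟨isRightSubstitution_of_eq ?_, intertwines_opV hat h⟩⟩
  · rw [opIIIa, opWord_eq]
  · rw [opIIIa, sumIIIa_eq _ hpq]
    exact intertwines_sumHat_III hat h₁ h₂
  · rw [opIIIb, opWord_eq]
  · rw [opIIIb, sumIIIb_eq _ hqp hpq]
    exact intertwines_sumHat_III hat h₁ h₂
  · rw [opIIIc, opWord_eq]
  · rw [opIIIc, sumIIIc_eq _ hpq]
    exact intertwines_sumHat_III hat h₁ h₂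
  · rw [opIV, opWord_eq]
  · rw [opV, opWord_eq]
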